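/- Let $n\ge 0$ be an integer and let $\ell_2^n$ be the $n$-dimensional complex Hilbert space. Consider the operator spaces $R_n=B(\ell_2^n,\mathbb C)$ and $C_n=B(\mathbb C,\ell_2^n)$, identified with $\ell_2^n$ in the obvious linear way (in $R_n$ the vector $x$ is the functional $y\mapsto\sum_i x_iy_i$; in $C_n$ it is the map $c\mapsto c\,x$). Let $OH_n$ denote the $n$-dimensional operator Hilbert space, that is, $\ell_2^n$ with an operator space structure given by a linear isometric embedding $j:\ell_2^n\to B(K)$, $K$ a complex Hilbert space, such that the natural identification $x\mapsto\langle x,\cdot\rangle$ of $E=j(\ell_2^n)$ with its antidual $\overline{E^*}$ is a complete isometry, where $M_m(E^*)=cb(E,M_m)$ and where the complex conjugate $\overline F\subset B(\overline K)$ of an operator space $F\subset B(K)$ has the same matrix norms as $F$. Such an embedding exists. For operator spaces $E\subset B(K,L)$ and $F\subset B(K',L')$ let $E\otimes_{\min}F$ be the (completed) tensor product with the operator space structure induced by $B(K\otimes K',L\otimes L')$, where $\otimes$ between Hilbert spaces is the Hilbertian tensor product; and for a compatible couple $(E_0,E_1)$ of operator spaces let $(E_0,E_1)_\theta$ be Calderón's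 complex interpolation space (first method), with the operator space structure $M_m((E_0,E_1)_\theta)=(M_m(E_0),M_m(E_1))_\theta$ for all $m$. Then for every such realization of $OH_n$ and every complex Hilbert space $H$, the identity map of $\ell_2^n\otimes B(H)$ is a complete isometry $$\big(R_n\otimes_{\min}B(H),\;C_n\otimes_{\min}B(H)\big)_{1/2}\;\approx\;OH_n\otimes_{\min}B(H):$$ every element of $\ell_2^n\otimes B(H)$ belongs to the interpolation space, and for every $m$ the norms of $M_m$ of the two sides coincide. -/

import Mathlib

open scoped TensorProduct ENNReal ZeroAtInfty

noncomputable section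

namespace OpInterp

/-! ### Matrix norms, operator spaces and complete isometries -/

/-- A system of (extended) norms on the spaces `M_m(V)`, `m = 0, 1, 2, …`. The value `∞` is used
only for matrices that do not belong to the space in question. -/
abbrev MatNorms (V : Type*) : Type _ := (m : ℕ) → Matrix (Fin m) (Fin m) V → ℝ≥0∞

section Concrete

variable {V K L : Type*} [AddCommGroup V] [Module ℂ V]
  [NormedAddCommGroup K] [InnerProductSpace ℂ K]
  [NormedAddCommGroup L] [InnerProductSpace ℂ L]

/-- An operator space is given by an embedding `j` of a complex vector space `V` in `B(K, L)`,
with `K`, `L` Hilbert spaces. The amplification of `j` sends a matrix `(x i k)` over `V` to the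
operator `(ξ k)_k ↦ (∑ k, j (x i k) (ξ k))_i` from the Hilbert sum `K^m` to the Hilbert
sum `L^m`. -/
def amplify (j : V →ₗ[ℂ] (K →L[ℂ] L)) (m : ℕ) :
    Matrix (Fin m) (Fin m) V →ₗ[ℂ]
      (PiLp 2 (fun _ : Fin m => K) →L[ℂ] PiLp 2 (fun _ : Fin m => L)) where
  toFun x := ((PiLp.continuousLinearEquiv 2 ℂ (fun _ : Fin m => L)).symm :
      (Fin m → L) →L[ℂ] PiLp 2 (fun _ : Fin m => L)) ∘L
    ContinuousLinearMap.pi fun i => ∑ k, j (x i k) ∘L PiLp.proj 2 (fun _ : Fin m => K) k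
  map_add' x y := by
    ext ξ i
    simp [Finset.sum_add_distrib]
  map_smul' c x := by
    ext ξ i
    simp [Finset.smul_sum]

theorem amplify_apply (j : V →ₗ[ℂ] (K →L[ℂ] L)) (m : ℕ) (x : Matrix (Fin m) (Fin m) V)
    (ξ : PiLp 2 (fun _ : Fin m => K)) (i : Fin m) :
    amplify j m x ξ i = ∑ k, j (x i k) (ξ k) := by
  simp [amplify]

/-- The matrix norms of the operator space given by `j`: `M_m(V)` is normed as a space of
operators from `K^m` to `L^m`. -/
def opMatNorm (j : V →ₗ[ℂ] (K →L[ℂ] L)) : MatNorms V := fun m x => ‖amplify j m x‖ₑ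

end Concrete

section CB

variable {V W : Type*} [AddCommGroup V] [Module ℂ V] [AddCommGroup W] [Module ℂ W]

/-- `u` is a complete isometry of `V` onto `W`: it is isometric from `M_m(V)` onto `M_m(W)` for
every `m`. -/
def IsCompleteIsometry (N : MatNorms V) (N' : MatNorms W) (u : V ≃ₗ[ℂ] W) : Prop :=
  ∀ (m : ℕ) (x : Matrix (Fin m) (Fin m) V), N' m (x.map u) = N m x

/-- The completely bounded norm. -/
def cbNorm (N : MatNorms V) (N' : MatNorms W) (u : V →ₗ[ℂ] W) : ℝ≥0∞ :=
  ⨆ (p : ℕ) (y : Matrix (Fin p) (Fin p) V) (_ : N p y ≤ 1), N' p (y.map u)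

end CB

/-- The operator space `M_m = B(ℓ₂^m)`. -/
def matEmb (m : ℕ) : Matrix (Fin m) (Fin m) ℂ →ₗ[ℂ]
    (EuclideanSpace ℂ (Fin m) →L[ℂ] EuclideanSpace ℂ (Fin m)) where
  toFun a := Matrix.toEuclideanCLM (n := Fin m) (𝕜 := ℂ) a
  map_add' a b := map_add _ a b
  map_smul' c a := map_smul _ c a

section Dual

variable {V : Type*} [NormedAddCommGroup V] [NormedSpace ℂ V]

/-- The linear map `V → M_m`, `v ↦ (ξ i k v)`, associated with a matrix `ξ` of functionals. -/
def matFunctional {m : ℕ} (ξ : Matrix (Fin m) (Fin m) (StrongDual ℂ V)) :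
    V →ₗ[ℂ] Matrix (Fin m) (Fin m) ℂ where
  toFun v := Matrix.of fun i k => ξ i k v
  map_add' v w := by ext i k; simp
  map_smul' c v := by ext i k; simp

/-- The operator space structure of the dual: `M_m(V^*) = cb(V, M_m)`. -/
def dualMatNorm (N : MatNorms V) : MatNorms (StrongDual ℂ V) :=
  fun m ξ => cbNorm N (opMatNorm (matEmb m)) (matFunctional ξ)

end Dual

/-! ### The spaces `R_n`, `C_n`, `OH_n` -/

/-- The row space `R_n = B(ℓ₂^n, ℂ)`, identified with `ℓ₂^n`: the vector `x` is the operator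
`y ↦ ∑ i, x i * y i`. -/
def rowEmb (n : ℕ) :
    EuclideanSpace ℂ (Fin n) →ₗ[ℂ] (EuclideanSpace ℂ (Fin n) →L[ℂ] ℂ) where
  toFun x := ∑ i, x i • (EuclideanSpace.proj i : EuclideanSpace ℂ (Fin n) →L[ℂ] ℂ)
  map_add' x y := by
    ext y
    simp [add_mul, Finset.sum_add_distrib]
  map_smul' c x := by
    ext y
    simp [Finset.mul_sum, mul_assoc]

/-- The column space `C_n = B(ℂ, ℓ₂^n)`, identified with `ℓ₂^n`: the vector `x` is the operator
`c ↦ c • x`. -/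
def colEmb (n : ℕ) :
    EuclideanSpace ℂ (Fin n) →ₗ[ℂ] (ℂ →L[ℂ] EuclideanSpace ℂ (Fin n)) where
  toFun x := ContinuousLinearMap.toSpanSingleton ℂ x
  map_add' x y := by ext; simp
  map_smul' c x := by ext; simp

/-- The isometric embedding `j` of `ℓ₂^n` in `B(K)` realizes the operator space `OH_n`: the natural
identification `x ↦ ⟪x, ·⟫` of `E = j(ℓ₂^n)` with the antidual, the complex conjugate of `E^*`, is
a complete isometry. It is antilinear as a map to `E^*` and linear as a map to the conjugate
of `E^*`. The conjugate of an operator space `F ⊆ B(K)` sits in `B(conj K)` through the same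
operators, so that it has the same matrix norms as `F`, and no conjugate space appears below. -/
def IsOH {n : ℕ} {K : Type*} [NormedAddCommGroup K] [InnerProductSpace ℂ K]
    (j : EuclideanSpace ℂ (Fin n) →ₗᵢ[ℂ] (K →L[ℂ] K)) : Prop :=
  ∀ (m : ℕ) (x : Matrix (Fin m) (Fin m) (EuclideanSpace ℂ (Fin n))),
    dualMatNorm (opMatNorm j.toLinearMap) m
        (x.map (InnerProductSpace.toDual ℂ (EuclideanSpace ℂ (Fin n))))
      = opMatNorm j.toLinearMap m x

/-! ### The minimal tensor product -/

section MinTensor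

variable {V W K L K' L' : Type*} [AddCommGroup V] [Module ℂ V] [AddCommGroup W] [Module ℂ W]
  [NormedAddCommGroup K] [InnerProductSpace ℂ K] [NormedAddCommGroup L] [InnerProductSpace ℂ L]
  [NormedAddCommGroup K'] [InnerProductSpace ℂ K'] [NormedAddCommGroup L'] [InnerProductSpace ℂ L']

/-- The Hilbert space tensor product. -/
abbrev HilbertTensor (K K' : Type*) [NormedAddCommGroup K] [InnerProductSpace ℂ K]
    [NormedAddCommGroup K'] [InnerProductSpace ℂ K'] : Type _ :=
  UniformSpace.Completion (K ⊗[ℂ] K')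

/-- The operator `a ⊗ b` between Hilbert space tensor products. -/
def opTmul (a : K →L[ℂ] L) (b : K' →L[ℂ] L') : HilbertTensor K K' →L[ℂ] HilbertTensor L L' :=
  (TensorProduct.mapL a b).completion

theorem opTmul_coe_tmul (a : K →L[ℂ] L) (b : K' →L[ℂ] L') (ξ : K) (η : K') :
    opTmul a b ((ξ ⊗ₜ[ℂ] η : K ⊗[ℂ] K') : HilbertTensor K K')
      = ((a ξ ⊗ₜ[ℂ] b η : L ⊗[ℂ] L') : HilbertTensor L L') := by
  rw [opTmul, ContinuousLinearMap.completion_apply_coe, TensorProduct.mapL_tmul]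

theorem clm_ext_completion {A B : Type*} [NormedAddCommGroup A] [NormedSpace ℂ A]
    [NormedAddCommGroup B] [NormedSpace ℂ B]
    {f g : UniformSpace.Completion A →L[ℂ] B} (h : ∀ a : A, f (a : UniformSpace.Completion A) = g a) :
    f = g := by
  ext x
  exact congrFun (UniformSpace.Completion.ext f.continuous g.continuous h) x

/-- The minimal tensor product of the operator spaces `V ⊆ B(K, L)` and `W ⊆ B(K', L')`: the
algebraic tensor product `V ⊗ W` embedded in `B(K ⊗ K', L ⊗ L')` by `v ⊗ w ↦ j v ⊗ j' w`. (No
completion is needed when `V` is finite-dimensional and `W` is complete, the only case in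
which this is used.) -/
def minEmb (j : V →ₗ[ℂ] (K →L[ℂ] L)) (j' : W →ₗ[ℂ] (K' →L[ℂ] L')) :
    (V ⊗[ℂ] W) →ₗ[ℂ] (HilbertTensor K K' →L[ℂ] HilbertTensor L L') :=
  TensorProduct.lift <| LinearMap.mk₂ ℂ (fun v w => opTmul (j v) (j' w))
    (fun v v' w => clm_ext_completion fun a => by
      simp only [opTmul, add_apply, ContinuousLinearMap.completion_apply_coe,
        map_add, TensorProduct.mapL_add_left, UniformSpace.Completion.coe_add])
    (fun c v w => clm_ext_completion fun a => by
      simp only [opTmul, smul_apply, ContinuousLinearMap.completion_apply_coe,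
        map_smul, TensorProduct.mapL_smul_left, UniformSpace.Completion.coe_smul])
    (fun v w w' => clm_ext_completion fun a => by
      simp only [opTmul, add_apply, ContinuousLinearMap.completion_apply_coe,
        map_add, TensorProduct.mapL_add_right, UniformSpace.Completion.coe_add])
    (fun c v w => clm_ext_completion fun a => by
      simp only [opTmul, smul_apply, ContinuousLinearMap.completion_apply_coe,
        map_smul, TensorProduct.mapL_smul_right, UniformSpace.Completion.coe_smul])

theorem minEmb_tmul (j : V →ₗ[ℂ] (K →L[ℂ] L)) (j' : W →ₗ[ℂ] (K' →L[ℂ] L')) (v : V) (w : W) :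
    minEmb j j' (v ⊗ₜ w) = opTmul (j v) (j' w) := by
  simp [minEmb]

end MinTensor

/-! ### Complex interpolation -/

section Interpolation

variable {E₀ E₁ X : Type*} [SeminormedAddCommGroup E₀] [NormedSpace ℂ E₀]
  [SeminormedAddCommGroup E₁] [NormedSpace ℂ E₁] [AddCommGroup X] [Module ℂ X]

/-- The map `(a, b) ↦ a + b` from `E₀ ⊕₁ E₁` to the ambient space `X`, for a couple `(E₀, E₁)`
embedded in `X` by `i₀` and `i₁`. -/
def coupleMap (i₀ : E₀ →ₗ[ℂ] X) (i₁ : E₁ →ₗ[ℂ] X) : WithLp 1 (E₀ × E₁) →ₗ[ℂ] X :=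
  (i₀.coprod i₁) ∘ₗ (WithLp.linearEquiv 1 ℂ (E₀ × E₁)).toLinearMap

/-- The space `E₀ + E₁`, with the quotient norm
`‖x‖ = inf {‖a‖ + ‖b‖ : a ∈ E₀, b ∈ E₁, x = a + b}`. -/
abbrev SumSpace (i₀ : E₀ →ₗ[ℂ] X) (i₁ : E₁ →ₗ[ℂ] X) : Type _ :=
  WithLp 1 (E₀ × E₁) ⧸ LinearMap.ker (coupleMap i₀ i₁)

/-- The class of `a + b` in `E₀ + E₁`. -/
def SumSpace.mk (i₀ : E₀ →ₗ[ℂ] X) (i₁ : E₁ →ₗ[ℂ] X) (a : E₀) (b : E₁) : SumSpace i₀ i₁ :=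
  (LinearMap.ker (coupleMap i₀ i₁)).mkQ (WithLp.toLp 1 (a, b))

/-- The inclusion of `E₀ + E₁` in the ambient space. -/
def SumSpace.toAmbient (i₀ : E₀ →ₗ[ℂ] X) (i₁ : E₁ →ₗ[ℂ] X) : SumSpace i₀ i₁ →ₗ[ℂ] X :=
  (LinearMap.ker (coupleMap i₀ i₁)).liftQ (coupleMap i₀ i₁) le_rfl

theorem SumSpace.toAmbient_mk (i₀ : E₀ →ₗ[ℂ] X) (i₁ : E₁ →ₗ[ℂ] X) (a : E₀) (b : E₁) :
    SumSpace.toAmbient i₀ i₁ (SumSpace.mk i₀ i₁ a b) = i₀ a + i₁ b := by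
  rw [SumSpace.toAmbient, SumSpace.mk, Submodule.mkQ_apply, Submodule.liftQ_apply]
  simp [coupleMap]

/-- The space `𝓕(E₀, E₁)` of Calderón: the functions `f`, bounded and continuous on the strip
`0 ≤ Re z ≤ 1` with values in `E₀ + E₁`, holomorphic in its interior, such that `t ↦ f(it)`
and `t ↦ f(1 + it)` are continuous functions with values in `E₀` and `E₁` that vanish at
infinity. -/
structure Calderon (i₀ : E₀ →ₗ[ℂ] X) (i₁ : E₁ →ₗ[ℂ] X) where
  /-- the function on the strip (its values outside are irrelevant) -/
  toFun : ℂ → SumSpace i₀ i₁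
  bounded' : ∃ M : ℝ, ∀ z : ℂ, 0 ≤ z.re → z.re ≤ 1 → ‖toFun z‖ ≤ M
  continuousOn' : ContinuousOn toFun {z : ℂ | 0 ≤ z.re ∧ z.re ≤ 1}
  differentiableOn' : DifferentiableOn ℂ toFun {z : ℂ | 0 < z.re ∧ z.re < 1}
  /-- the boundary function `t ↦ f(it)` -/
  left : C₀(ℝ, E₀)
  left_eq : ∀ t : ℝ, toFun (t * Complex.I) = SumSpace.mk i₀ i₁ (left t) 0
  /-- the boundary function `t ↦ f(1 + it)` -/
  right : C₀(ℝ, E₁)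
  right_eq : ∀ t : ℝ, toFun (1 + t * Complex.I) = SumSpace.mk i₀ i₁ 0 (right t)

/-- The norm of the complex interpolation space `(E₀, E₁)_θ`: the infimum of
`max (sup_t ‖f(it)‖) (sup_t ‖f(1 + it)‖)` over the `f ∈ 𝓕(E₀, E₁)` with `f θ = x`. It is `∞`
when there is no such `f`, that is, when `x` is not in `(E₀, E₁)_θ`. -/
def interpNorm (i₀ : E₀ →ₗ[ℂ] X) (i₁ : E₁ →ₗ[ℂ] X) (θ : ℝ) (x : X) : ℝ≥0∞ :=
  ⨅ (f : Calderon i₀ i₁) (_ : SumSpace.toAmbient i₀ i₁ (f.toFun (θ : ℂ)) = x),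
    max ‖f.left‖ₑ ‖f.right‖ₑ

end Interpolation

/-- The vector space `V` with the norm `v ↦ ‖j v‖`. -/
def Induced {V F : Type*} [AddCommGroup V] [Module ℂ V] [NormedAddCommGroup F] [NormedSpace ℂ F]
    (_j : V →ₗ[ℂ] F) : Type _ := V

namespace Induced

variable {V F : Type*} [AddCommGroup V] [Module ℂ V] [NormedAddCommGroup F] [NormedSpace ℂ F]
  (j : V →ₗ[ℂ] F)

instance : AddCommGroup (Induced j) := inferInstanceAs (AddCommGroup V)

instance : Module ℂ (Induced j) := inferInstanceAs (Module ℂ V)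

/-- The identity map to the underlying vector space. -/
def toV : Induced j ≃ₗ[ℂ] V := LinearEquiv.refl ℂ V

instance : SeminormedAddCommGroup (Induced j) :=
  SeminormedAddCommGroup.induced (Induced j) F (j ∘ₗ (toV j).toLinearMap)

instance : NormedSpace ℂ (Induced j) :=
  NormedSpace.induced ℂ (Induced j) F (j ∘ₗ (toV j).toLinearMap)

theorem norm_eq (v : Induced j) : ‖v‖ = ‖j (toV j v)‖ := rfl

end Induced

/-- The normed space `M_m(V)` of the operator space given by `j`. -/
abbrev MatSpace {V K L : Type*} [AddCommGroup V] [Module ℂ V]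
    [NormedAddCommGroup K] [InnerProductSpace ℂ K] [NormedAddCommGroup L] [InnerProductSpace ℂ L]
    (j : V →ₗ[ℂ] (K →L[ℂ] L)) (m : ℕ) : Type _ :=
  Induced (F := PiLp 2 (fun _ : Fin m => K) →L[ℂ] PiLp 2 (fun _ : Fin m => L)) (amplify j m)

/-- The embedding of `M_m(V)` in `M_m(X)` induced by an embedding of `V` in `X`. -/
def matIncl {V X K L : Type*} [AddCommGroup V] [Module ℂ V] [AddCommGroup X] [Module ℂ X]
    [NormedAddCommGroup K] [InnerProductSpace ℂ K] [NormedAddCommGroup L] [InnerProductSpace ℂ L]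
    (j : V →ₗ[ℂ] (K →L[ℂ] L)) (i : V →ₗ[ℂ] X) (m : ℕ) :
    MatSpace j m →ₗ[ℂ] Matrix (Fin m) (Fin m) X :=
  i.mapMatrix ∘ₗ
    (Induced.toV (F := PiLp 2 (fun _ : Fin m => K) →L[ℂ] PiLp 2 (fun _ : Fin m => L))
      (amplify j m)).toLinearMap

section InterpolationOpSpace

variable {V₀ V₁ X K₀ L₀ K₁ L₁ : Type*} [AddCommGroup V₀] [Module ℂ V₀]
  [AddCommGroup V₁] [Module ℂ V₁] [AddCommGroup X] [Module ℂ X]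
  [NormedAddCommGroup K₀] [InnerProductSpace ℂ K₀] [NormedAddCommGroup L₀] [InnerProductSpace ℂ L₀]
  [NormedAddCommGroup K₁] [InnerProductSpace ℂ K₁] [NormedAddCommGroup L₁] [InnerProductSpace ℂ L₁]

/-- The operator space structure of `(V₀, V₁)_θ`, for operator spaces `V₀`, `V₁` (given by
`j₀`, `j₁`) embedded in `X` by `i₀`, `i₁`: `M_m((V₀, V₁)_θ) = (M_m(V₀), M_m(V₁))_θ`. -/
def interpMatNorm (j₀ : V₀ →ₗ[ℂ] (K₀ →L[ℂ] L₀)) (j₁ : V₁ →ₗ[ℂ] (K₁ →L[ℂ] L₁))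
    (i₀ : V₀ →ₗ[ℂ] X) (i₁ : V₁ →ₗ[ℂ] X) (θ : ℝ) : MatNorms X := fun m x =>
  interpNorm (matIncl j₀ i₀ m) (matIncl j₁ i₁ m) θ x

end InterpolationOpSpace

end OpInterp

end

/-! For a tuple x = (x_l) of square matrices let Φ_x(ζ) = ∑ x_l ζ x_l^*, acting on Hilbert–Schmidt
matrices; `HSBound` records bounds for such maps and for the mixed maps ζ ↦ ∑ u_l ζ w_l. The theorem
comes down to the fact that both norms of x in M_m are ‖Φ_x‖^{1/2}.

Two facts about matrices carry the proof. If f and h are bounded holomorphic families on the strip,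
with row bounds c₁, c₂ for ∑ a_l a_l^* on the left side and column bounds c₁, c₂ for ∑ a_l^* a_l on
the right side, then the three lines theorem bounds ζ ↦ ∑ f_l(1/2) ζ h_l(1/2) by √c₁ √c₂
(`hsBound_of_strip`). Conversely, if ‖Φ_y‖ < ρ, a Perron–Frobenius argument gives positive definite
ξ, η with ∑ y_l ξ y_l^* ≤ ρη and ∑ y_l^* η y_l ≤ ρξ, and F_l(z) = η^{z-1/2} y_l ξ^{1/2-z} is such a
family with bound ρ and F(1/2) = y (`exists_strip_family`). Together they give the Cauchy–Schwarz
inequality ‖∑ y_l ⊗ conj x_l‖ ≤ ‖Φ_y‖^{1/2} ‖Φ_x‖^{1/2} (`HSBound.cauchy_schwarz`).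

The norm of x in M_m of the antidual is the supremum of ‖∑ y_l ⊗ conj x_l‖ over the unit ball.
Testing with y proportional to x, and using Cauchy–Schwarz in the other direction, self-duality
forces the norm of OH to be ‖Φ_x‖^{1/2} (`IsOH.norm_amplify_le_iff`). The direct sum of the
conjugates of all tuples with ‖Φ_y‖ ≤ 1 realizes this norm (`isOH_ohIsometry`).

With coefficients in B(H), a matrix over ℓ₂^n ⊗ B(H) is an n-tuple of operators on H^m. The two
endpoint norms are its row and column norms, and the OH norm is the supremum over its compressions
to finite-dimensional subspaces. For the lower bound on the interpolation norm, a function of the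
Calderón space is compressed and paired, by three lines, with the strip family of the adjoint tuple
(`hsBound_of_calderon`). For the upper bound, the strip families of all compressions have a weak
operator limit along an ultrafilter (`exists_interpolating_family`). This limit is controlled only
in the open strip, so it is moved inside by an affine map and damped by a Gaussian, at a cost that
tends to 1 (`exists_calderon`). -/

namespace OpInterp

/-! ### Hilbert–Schmidt bounds and the three lines theorem -/

section HilbertSchmidt

open scoped Matrix ComplexOrder Matrix.Norms.Frobenius

variable {ι p m : Type*} [Fintype ι] [Fintype p] [Fintype m]

theorem frobenius_norm_sq (A : Matrix p m ℂ) : ‖A‖ ^ 2 = ∑ i, ∑ j, ‖A i j‖ ^ 2 := by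
  rw [Matrix.frobenius_norm_def, ← Real.rpow_natCast, ← Real.rpow_mul (by positivity)]
  norm_num

theorem trace_conjTranspose_mul (A B : Matrix p m ℂ) :
    (Aᴴ * B).trace = ∑ i, ∑ j, star (A i j) * B i j := by
  simp only [Matrix.trace, Matrix.diag, Matrix.mul_apply, Matrix.conjTranspose_apply]
  rw [Finset.sum_comm]

theorem trace_conjTranspose_mul_self (A : Matrix p m ℂ) :
    (Aᴴ * A).trace = ((‖A‖ ^ 2 : ℝ) : ℂ) := by
  rw [trace_conjTranspose_mul, frobenius_norm_sq]
  push_cast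
  refine Finset.sum_congr rfl fun i _ => Finset.sum_congr rfl fun j _ => ?_
  exact Complex.conj_mul' _

theorem norm_trace_conjTranspose_mul_le (A B : Matrix p m ℂ) :
    ‖(Aᴴ * B).trace‖ ≤ ‖A‖ * ‖B‖ := by
  rw [trace_conjTranspose_mul, ← Finset.sum_product']
  refine (norm_sum_le _ _).trans ?_
  simp only [norm_mul, norm_star]
  refine (Real.sum_mul_le_sqrt_mul_sqrt _ _ _).trans (le_of_eq ?_)
  have hsum : ∀ A : Matrix p m ℂ,
      ∑ x ∈ (Finset.univ : Finset p) ×ˢ (Finset.univ : Finset m), ‖A x.1 x.2‖ ^ 2 = ‖A‖ ^ 2 :=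
    fun A => by rw [frobenius_norm_sq, Finset.sum_product]
  rw [hsum, hsum, Real.sqrt_sq (norm_nonneg _), Real.sqrt_sq (norm_nonneg _)]

theorem frobenius_norm_le_of_entries {A : Matrix p m ℂ} {C : ℝ} (h : ∀ i j, ‖A i j‖ ≤ C) :
    ‖A‖ ≤ Real.sqrt (Fintype.card p * (Fintype.card m * C ^ 2)) := by
  apply Real.le_sqrt_of_sq_le
  rw [frobenius_norm_sq]
  calc ∑ i, ∑ j, ‖A i j‖ ^ 2 ≤ ∑ _i : p, ∑ _j : m, C ^ 2 :=
        Finset.sum_le_sum fun i _ => Finset.sum_le_sum fun j _ =>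
          pow_le_pow_left₀ (norm_nonneg _) (h i j) 2
    _ = _ := by simp

/-- The map `ζ ↦ ∑ u l * ζ * w l` has norm at most `c` for the Hilbert–Schmidt norm. -/
def HSBound (u : ι → Matrix p p ℂ) (w : ι → Matrix m m ℂ) (c : ℝ) : Prop :=
  ∀ ζ ζ' : Matrix p m ℂ, ‖(ζ'ᴴ * ∑ l, u l * ζ * w l).trace‖ ≤ c * ‖ζ‖ * ‖ζ'‖

/-- The map with coefficients uᴴ, wᴴ is the adjoint for the Hilbert–Schmidt inner product. -/
theorem HSBound.conjTranspose {u : ι → Matrix p p ℂ} {w : ι → Matrix m m ℂ} {c : ℝ}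
    (h : HSBound u w c) : HSBound (fun l => (u l)ᴴ) (fun l => (w l)ᴴ) c := by
  intro ζ ζ'
  have h' := h ζ' ζ
  rw [mul_right_comm]
  refine le_trans (le_of_eq ?_) h'
  rw [← norm_star, ← Matrix.trace_conjTranspose]
  congr 1
  simp only [Matrix.mul_sum, Matrix.conjTranspose_sum, Matrix.trace_sum]
  refine Finset.sum_congr rfl fun l _ => ?_
  simp only [Matrix.conjTranspose_mul, Matrix.conjTranspose_conjTranspose, Matrix.mul_assoc]
  rw [Matrix.trace_mul_comm]
  simp only [Matrix.mul_assoc]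

theorem HSBound.norm_le {u : ι → Matrix p p ℂ} {w : ι → Matrix m m ℂ} {c : ℝ}
    (h : HSBound u w c) (ζ : Matrix p m ℂ) : ‖∑ l, u l * ζ * w l‖ ≤ c * ‖ζ‖ := by
  have h' := h ζ (∑ l, u l * ζ * w l)
  rw [trace_conjTranspose_mul_self, Complex.norm_real, Real.norm_of_nonneg (by positivity)] at h'
  rcases (norm_nonneg (∑ l, u l * ζ * w l)).eq_or_lt with h0 | h0
  · by_contra! hc
    rw [← h0] at hc
    have h1 := h ζ ζ
    have : 0 ≤ c * ‖ζ‖ * ‖ζ‖ := (norm_nonneg _).trans h1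
    have h2 : ‖ζ‖ ≠ 0 := by
      rintro h2
      simp [h2] at hc
    have h3 : 0 < ‖ζ‖ := lt_of_le_of_ne (norm_nonneg _) (Ne.symm h2)
    nlinarith
  · rw [sq] at h'
    exact le_of_mul_le_mul_right h' h0

theorem HSBound.of_norm_le {u : ι → Matrix p p ℂ} {w : ι → Matrix m m ℂ} {c : ℝ}
    (h : ∀ ζ : Matrix p m ℂ, ‖∑ l, u l * ζ * w l‖ ≤ c * ‖ζ‖) : HSBound u w c := by
  intro ζ ζ'
  refine (norm_trace_conjTranspose_mul_le _ _).trans ?_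
  rw [mul_comm]
  exact mul_le_mul_of_nonneg_right (h ζ) (norm_nonneg _)

variable [DecidableEq p]

/-- `∑ a l * (a l)ᴴ ≤ c`. -/
def IsRow (a : ι → Matrix p p ℂ) (c : ℝ) : Prop :=
  ((c : ℂ) • (1 : Matrix p p ℂ) - ∑ l, a l * (a l)ᴴ).PosSemidef

/-- `∑ (a l)ᴴ * a l ≤ c`. -/
def IsCol (a : ι → Matrix p p ℂ) (c : ℝ) : Prop :=
  IsRow (fun l => (a l)ᴴ) c

/-- The difference of the two sides is the trace of the positive matrix Zᴴ (c - ∑ a_l a_lᴴ) Z. -/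
theorem IsRow.sum_norm_sq_le {a : ι → Matrix p p ℂ} {c : ℝ} (h : IsRow a c) (Z : Matrix p m ℂ) :
    ∑ l, ‖(a l)ᴴ * Z‖ ^ 2 ≤ c * ‖Z‖ ^ 2 := by
  have h1 := (h.conjTranspose_mul_mul_same Z).trace_nonneg
  have h2 : (Zᴴ * ((c : ℂ) • (1 : Matrix p p ℂ) - ∑ l, a l * (a l)ᴴ) * Z).trace
      = ((c * ‖Z‖ ^ 2 - ∑ l, ‖(a l)ᴴ * Z‖ ^ 2 : ℝ) : ℂ) := by
    rw [Matrix.mul_sub, Matrix.sub_mul, Matrix.trace_sub, Matrix.mul_smul, Matrix.smul_mul,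
      Matrix.mul_one, Matrix.trace_smul, trace_conjTranspose_mul_self]
    push_cast
    rw [Matrix.mul_sum, Matrix.sum_mul, Matrix.trace_sum]
    congr 1
    refine Finset.sum_congr rfl fun l _ => ?_
    have := trace_conjTranspose_mul_self ((a l)ᴴ * Z)
    push_cast at this
    rw [← this]
    simp [Matrix.conjTranspose_mul, Matrix.mul_assoc]
  rw [h2] at h1
  have h3 : (0 : ℝ) ≤ c * ‖Z‖ ^ 2 - ∑ l, ‖(a l)ᴴ * Z‖ ^ 2 := by exact_mod_cast h1
  linarith

/-- The trace of ζ'ᴴ u_l ζ w_l is the inner product of u_lᴴ ζ' with ζ w_l, and ζ w_l has the norm of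
w_lᴴ ζᴴ. Cauchy–Schwarz over l then separates the two row bounds. -/
theorem IsRow.hsBound {u : ι → Matrix p p ℂ} {w : ι → Matrix m m ℂ} {c₁ c₂ : ℝ}
    [DecidableEq m] (hu : IsRow u c₁) (hw : IsRow w c₂) : HSBound u w (√c₁ * √c₂) := by
  intro ζ ζ'
  have h1 := hu.sum_norm_sq_le ζ'
  have h2 := hw.sum_norm_sq_le ζᴴ
  rw [Matrix.mul_sum, Matrix.trace_sum]
  refine (norm_sum_le _ _).trans ?_
  calc ∑ l, ‖(ζ'ᴴ * (u l * ζ * w l)).trace‖ ≤ ∑ l, ‖(u l)ᴴ * ζ'‖ * ‖(w l)ᴴ * ζᴴ‖ := by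
        refine Finset.sum_le_sum fun l _ => ?_
        rw [← Matrix.conjTranspose_mul, Matrix.frobenius_norm_conjTranspose]
        refine le_trans (le_of_eq ?_) (norm_trace_conjTranspose_mul_le _ _)
        simp [Matrix.conjTranspose_mul, Matrix.mul_assoc]
    _ ≤ √(∑ l, ‖(u l)ᴴ * ζ'‖ ^ 2) * √(∑ l, ‖(w l)ᴴ * ζᴴ‖ ^ 2) :=
        Real.sum_mul_le_sqrt_mul_sqrt _ _ _
    _ ≤ √(c₁ * ‖ζ'‖ ^ 2) * √(c₂ * ‖ζᴴ‖ ^ 2) := by gcongr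
    _ = √c₁ * √c₂ * ‖ζ‖ * ‖ζ'‖ := by
        rw [Real.sqrt_mul' _ (by positivity), Real.sqrt_mul' _ (by positivity),
          Real.sqrt_sq (norm_nonneg _), Real.sqrt_sq (norm_nonneg _),
          Matrix.frobenius_norm_conjTranspose]
        ring

theorem IsCol.hsBound {u : ι → Matrix p p ℂ} {w : ι → Matrix m m ℂ} {c₁ c₂ : ℝ}
    [DecidableEq m] (hu : IsCol u c₁) (hw : IsCol w c₂) : HSBound u w (√c₁ * √c₂) := by
  simpa using (IsRow.hsBound hu hw).conjTranspose

/-- The three lines theorem for the pairing of two families of matrices on the strip. -/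
theorem hsBound_of_strip [DecidableEq m] {f : ℂ → ι → Matrix p p ℂ} {h : ℂ → ι → Matrix m m ℂ} {c₁ c₂ C₁ C₂ : ℝ}
    (hf : ∀ l i j, DiffContOnCl ℂ (fun z => f z l i j) (Complex.HadamardThreeLines.verticalStrip 0 1))
    (hh : ∀ l i j, DiffContOnCl ℂ (fun z => h z l i j) (Complex.HadamardThreeLines.verticalStrip 0 1))
    (hfC : ∀ z : ℂ, 0 ≤ z.re → z.re ≤ 1 → ∀ l i j, ‖f z l i j‖ ≤ C₁)
    (hhC : ∀ z : ℂ, 0 ≤ z.re → z.re ≤ 1 → ∀ l i j, ‖h z l i j‖ ≤ C₂)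
    (hf0 : ∀ z : ℂ, z.re = 0 → IsRow (f z) c₁) (hh0 : ∀ z : ℂ, z.re = 0 → IsRow (h z) c₂)
    (hf1 : ∀ z : ℂ, z.re = 1 → IsCol (f z) c₁) (hh1 : ∀ z : ℂ, z.re = 1 → IsCol (h z) c₂) :
    HSBound (f (1 / 2)) (h (1 / 2)) (√c₁ * √c₂) := by
  intro ζ ζ'
  set K := √c₁ * √c₂ * ‖ζ‖ * ‖ζ'‖ with hK
  have hK0 : 0 ≤ K := by positivity
  -- For fixed ζ, ζ' the pairing is a scalar holomorphic function, since no adjoint of f or h occurs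
  -- in it. It has the same bound K on both sides of the strip: from the row bounds on the left,
  -- from the column bounds on the right.
  have key := Complex.HadamardThreeLines.norm_le_interp_of_mem_verticalClosedStrip'
    (f := fun z => (ζ'ᴴ * ∑ l, f z l * ζ * h z l).trace) (z := 1 / 2) (a := K) (b := K)
    (l := 0) (u := 1) zero_lt_one (by constructor <;> norm_num) ?_ ?_ ?_ ?_
  · refine key.trans (le_of_eq ?_)
    rw [← Real.rpow_add_of_nonneg hK0 (by norm_num) (by norm_num)]
    norm_num
  · have hd := fun l i j => (hf l i j).differentiableOn
    have hd' := fun l i j => (hh l i j).differentiableOn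
    have hc := fun l i j => (hf l i j).continuousOn
    have hc' := fun l i j => (hh l i j).continuousOn
    constructor
    · simp only [Matrix.trace, Matrix.diag, Matrix.mul_apply, Matrix.sum_apply]
      fun_prop
    · simp only [Matrix.trace, Matrix.diag, Matrix.mul_apply, Matrix.sum_apply]
      fun_prop
  · refine ⟨‖ζ'‖ * ∑ _l : ι, √(Fintype.card p * (Fintype.card p * C₁ ^ 2)) * ‖ζ‖ *
      √(Fintype.card m * (Fintype.card m * C₂ ^ 2)), ?_⟩
    rintro _ ⟨z, hz, rfl⟩
    refine (norm_trace_conjTranspose_mul_le _ _).trans ?_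
    refine mul_le_mul_of_nonneg_left ((norm_sum_le _ _).trans ?_) (norm_nonneg _)
    refine Finset.sum_le_sum fun l _ => ?_
    refine (Matrix.frobenius_norm_mul _ _).trans ?_
    refine mul_le_mul ((Matrix.frobenius_norm_mul _ _).trans ?_) ?_ (by positivity) (by positivity)
    · exact mul_le_mul_of_nonneg_right (frobenius_norm_le_of_entries (hfC z hz.1 hz.2 l))
        (norm_nonneg _)
    · exact frobenius_norm_le_of_entries (hhC z hz.1 hz.2 l)
  · intro z hz
    exact (hf0 z hz).hsBound (hh0 z hz) ζ ζ'
  · intro z hz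
    exact (hf1 z hz).hsBound (hh1 z hz) ζ ζ'

end HilbertSchmidt

end OpInterp

namespace OpInterp

/-! ### Perron–Frobenius weights, strip families and Cauchy–Schwarz -/

section PositiveWeights

open scoped Matrix ComplexOrder Matrix.Norms.Frobenius

variable {ι p : Type*} [Fintype ι] [Fintype p]

theorem isClosed_posSemidef : IsClosed {A : Matrix p p ℂ | A.PosSemidef} := by
  simp only [Matrix.posSemidef_iff_dotProduct_mulVec, Set.ofPred_and, Set.ofPred_forall]
  refine IsClosed.inter ?_ (isClosed_iInter fun x => ?_)
  · exact isClosed_eq continuous_star continuous_id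
  · refine isClosed_le continuous_const ?_
    simp only [dotProduct, Matrix.mulVec]
    fun_prop

/-- Banach's fixed point theorem inside an invariant closed set. With S the cone of positive
semidefinite matrices, the solution comes out positive. -/
theorem exists_fixedPoint_of_closed {V : Type*} [NormedAddCommGroup V] [NormedSpace ℂ V]
    [CompleteSpace V] (L : V →ₗ[ℂ] V) {r : ℝ} (hr0 : 0 ≤ r) (hr : r < 1)
    (hL : ∀ v, ‖L v‖ ≤ r * ‖v‖) {S : Set V} (hS : IsClosed S) {e : V} (he : e ∈ S)
    (hm : ∀ v ∈ S, e + L v ∈ S) : ∃ v ∈ S, v = e + L v := by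
  have hmt : Set.MapsTo (fun v => e + L v) S S := fun v hv => hm v hv
  have hlip : LipschitzWith ⟨r, hr0⟩ (fun v => e + L v) := by
    refine LipschitzWith.of_dist_le_mul fun v w => ?_
    rw [dist_add_left, dist_eq_norm, dist_eq_norm, ← map_sub]
    exact hL _
  have hc : ContractingWith ⟨r, hr0⟩ (hmt.restrict (fun v => e + L v) S S) :=
    ⟨by exact_mod_cast hr, fun v w => hlip v.1 w.1⟩
  obtain ⟨v, hv, hfix, -⟩ := hc.exists_fixedPoint' hS.isComplete hmt he (edist_ne_top _ _)
  exact ⟨v, hv, hfix.symm⟩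

variable [DecidableEq p]

theorem exists_smul_one_sub_posSemidef {M : Matrix p p ℂ} (hM : M.IsHermitian) :
    ∃ K : ℝ, 0 < K ∧ ((K : ℂ) • (1 : Matrix p p ℂ) - M).PosSemidef := by
  set U : Matrix p p ℂ := hM.eigenvectorUnitary.1 with hU
  have hU1 : U * Uᴴ = 1 := Matrix.mem_unitaryGroup_iff.1 hM.eigenvectorUnitary.2
  have hspec : M = U * Matrix.diagonal (fun i => (hM.eigenvalues i : ℂ)) * Uᴴ := by
    have := hM.spectral_theorem
    rw [Unitary.conjStarAlgAut_apply] at this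
    exact this
  refine ⟨1 + ∑ i, |hM.eigenvalues i|, by positivity, ?_⟩
  set K := 1 + ∑ i, |hM.eigenvalues i| with hK
  have hle : ∀ i, hM.eigenvalues i ≤ K := fun i => by
    have := Finset.single_le_sum (f := fun i => |hM.eigenvalues i|)
      (fun i _ => abs_nonneg _) (Finset.mem_univ i)
    have := le_abs_self (hM.eigenvalues i)
    linarith
  have : (K : ℂ) • (1 : Matrix p p ℂ) - M
      = U * Matrix.diagonal (fun i => ((K - hM.eigenvalues i : ℝ) : ℂ)) * Uᴴ := by
    have hd : Matrix.diagonal (fun i => ((K - hM.eigenvalues i : ℝ) : ℂ))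
        = (K : ℂ) • (1 : Matrix p p ℂ) - Matrix.diagonal (fun i => (hM.eigenvalues i : ℂ)) := by
      rw [Matrix.smul_one_eq_diagonal, Matrix.diagonal_sub]
      simp
    rw [hd, Matrix.mul_sub, Matrix.sub_mul, ← hspec]
    simp [hU1]
  rw [this]
  refine Matrix.PosSemidef.mul_mul_conjTranspose_same (Matrix.PosSemidef.diagonal fun i => ?_) U
  change (0 : ℂ) ≤ _
  exact_mod_cast sub_nonneg.2 (hle i)

/-- A completely positive map that is strictly bounded by `ρ` on the Hilbert–Schmidt class has
strictly positive weights. -/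
theorem exists_posDef_weights {y : ι → Matrix p p ℂ} {c ρ : ℝ} (hc : 0 ≤ c) (hcρ : c < ρ)
    (h : HSBound y (fun l => (y l)ᴴ) c) :
    ∃ ξ η : Matrix p p ℂ, ξ.PosDef ∧ η.PosDef ∧
      ((ρ : ℂ) • η - ∑ l, y l * ξ * (y l)ᴴ).PosSemidef ∧
      ((ρ : ℂ) • ξ - ∑ l, (y l)ᴴ * η * y l).PosSemidef := by
  have hρ : 0 < ρ := hc.trans_lt hcρ
  have h' : HSBound (fun l => (y l)ᴴ) y c := by simpa using h.conjTranspose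
  let T : Matrix p p ℂ →ₗ[ℂ] Matrix p p ℂ :=
    { toFun := fun ζ => ∑ l, y l * ζ * (y l)ᴴ
      map_add' := fun a b => by simp [Matrix.mul_add, Matrix.add_mul, Finset.sum_add_distrib]
      map_smul' := fun a b => by simp [Finset.smul_sum] }
  let T' : Matrix p p ℂ →ₗ[ℂ] Matrix p p ℂ :=
    { toFun := fun ζ => ∑ l, (y l)ᴴ * ζ * y l
      map_add' := fun a b => by simp [Matrix.mul_add, Matrix.add_mul, Finset.sum_add_distrib]
      map_smul' := fun a b => by simp [Finset.smul_sum] }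
  have hT : ∀ ζ, ‖T ζ‖ ≤ c * ‖ζ‖ := h.norm_le
  have hT' : ∀ ζ, ‖T' ζ‖ ≤ c * ‖ζ‖ := h'.norm_le
  have hTp : ∀ ζ : Matrix p p ℂ, ζ.PosSemidef → (T ζ).PosSemidef := fun ζ hζ =>
    Matrix.posSemidef_sum _ fun l _ => hζ.mul_mul_conjTranspose_same (y l)
  have hTp' : ∀ ζ : Matrix p p ℂ, ζ.PosSemidef → (T' ζ).PosSemidef := fun ζ hζ =>
    Matrix.posSemidef_sum _ fun l _ => hζ.conjTranspose_mul_mul_same (y l)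
  have hscal : (0 : ℂ) ≤ ((ρ⁻¹ ^ 2 : ℝ) : ℂ) := by
    exact_mod_cast (by positivity : (0 : ℝ) ≤ ρ⁻¹ ^ 2)
  have hscal1 : (0 : ℂ) ≤ ((ρ⁻¹ : ℝ) : ℂ) := by
    exact_mod_cast (by positivity : (0 : ℝ) ≤ ρ⁻¹)
  -- The weight ξ solves ξ = 1 + ρ⁻² T'Tξ. The norm of L is at most (c/ρ)² < 1, and the summand 1
  -- makes ξ definite.
  let L : Matrix p p ℂ →ₗ[ℂ] Matrix p p ℂ := ((ρ⁻¹ ^ 2 : ℝ) : ℂ) • (T' ∘ₗ T)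
  have hLapp : ∀ ζ, L ζ = ((ρ⁻¹ ^ 2 : ℝ) : ℂ) • T' (T ζ) := fun ζ => rfl
  have hL : ∀ ζ, ‖L ζ‖ ≤ ρ⁻¹ ^ 2 * (c * c) * ‖ζ‖ := fun ζ => by
    rw [hLapp, norm_smul, Complex.norm_real, Real.norm_of_nonneg (by positivity), mul_assoc]
    refine mul_le_mul_of_nonneg_left ?_ (by positivity)
    calc ‖T' (T ζ)‖ ≤ c * ‖T ζ‖ := hT' _
      _ ≤ c * (c * ‖ζ‖) := mul_le_mul_of_nonneg_left (hT ζ) hc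
      _ = c * c * ‖ζ‖ := by ring
  have hLp : ∀ ζ : Matrix p p ℂ, ζ.PosSemidef → (L ζ).PosSemidef := fun ζ hζ =>
    (hTp' _ (hTp _ hζ)).smul hscal
  have hr : ρ⁻¹ ^ 2 * (c * c) < 1 := by
    rw [inv_pow, inv_mul_lt_iff₀ (by positivity), mul_one, sq]
    exact mul_lt_mul'' hcρ hcρ hc hc
  have : CompleteSpace (Matrix p p ℂ) := FiniteDimensional.complete ℂ _
  obtain ⟨ξ, hξp, hξL⟩ := exists_fixedPoint_of_closed L (by positivity) hr hL
    (S := {A : Matrix p p ℂ | A.PosSemidef}) isClosed_posSemidef Matrix.PosSemidef.one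
    fun v hv => Matrix.PosSemidef.one.add (hLp v hv)
  replace hξp : ξ.PosSemidef := hξp
  have hξd : ξ.PosDef := by
    rw [hξL]
    exact Matrix.PosDef.one.add_posSemidef (hLp _ hξp)
  -- the second weight is `T ξ / ρ + δ`
  have hTone : (T' 1).PosSemidef := hTp' _ Matrix.PosSemidef.one
  -- Tξ may be singular, so a multiple of the identity has to be added to make the second weight
  -- definite. It must be small because δ T'1 is subtracted in the second inequality.
  obtain ⟨δ, hδ, hδT⟩ : ∃ δ : ℝ, 0 < δ ∧
      ((ρ : ℂ) • (1 : Matrix p p ℂ) - (δ : ℂ) • T' 1).PosSemidef := by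
    obtain ⟨K, hK, hKT⟩ := exists_smul_one_sub_posSemidef hTone.isHermitian
    refine ⟨ρ / K, by positivity, ?_⟩
    have : (ρ : ℂ) • (1 : Matrix p p ℂ) - ((ρ / K : ℝ) : ℂ) • T' 1
        = ((ρ / K : ℝ) : ℂ) • ((K : ℂ) • (1 : Matrix p p ℂ) - T' 1) := by
      rw [smul_sub, smul_smul, ← Complex.ofReal_mul, div_mul_cancel₀ _ hK.ne']
    rw [this]
    exact hKT.smul (by exact_mod_cast (by positivity : 0 ≤ ρ / K))
  refine ⟨ξ, ((ρ⁻¹ : ℝ) : ℂ) • T ξ + (δ : ℂ) • 1, hξd, ?_, ?_, ?_⟩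
  · refine Matrix.PosDef.posSemidef_add ((hTp _ hξp).smul hscal1) ?_
    exact Matrix.PosDef.one.smul (by exact_mod_cast hδ)
  · have : (ρ : ℂ) • (((ρ⁻¹ : ℝ) : ℂ) • T ξ + (δ : ℂ) • (1 : Matrix p p ℂ)) - ∑ l, y l * ξ * (y l)ᴴ
        = ((ρ * δ : ℝ) : ℂ) • (1 : Matrix p p ℂ) := by
      change _ - T ξ = _
      rw [smul_add, smul_smul, smul_smul, ← Complex.ofReal_mul, mul_inv_cancel₀ hρ.ne']
      simp
    rw [this]
    exact Matrix.PosSemidef.one.smul (by exact_mod_cast (by positivity : 0 ≤ ρ * δ))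
  · have : (ρ : ℂ) • ξ - ∑ l, (y l)ᴴ * (((ρ⁻¹ : ℝ) : ℂ) • T ξ + (δ : ℂ) • 1) * y l
        = (ρ : ℂ) • (1 : Matrix p p ℂ) - (δ : ℂ) • T' 1 := by
      change _ - T' (((ρ⁻¹ : ℝ) : ℂ) • T ξ + (δ : ℂ) • 1) = _
      rw [map_add, map_smul, map_smul]
      -- The fixed point equation turns ρξ into ρ + ρ⁻¹ T'Tξ, whose last term cancels.
      nth_rewrite 1 [hξL]
      rw [smul_add, hLapp, smul_smul, ← Complex.ofReal_mul,
        show ρ * ρ⁻¹ ^ 2 = ρ⁻¹ by field_simp]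
      abel
    rw [this]
    exact hδT

/-- The complex powers of a positive definite matrix. -/
theorem exists_complex_powers {η : Matrix p p ℂ} (hη : η.PosDef) :
    ∃ P : ℂ → Matrix p p ℂ, (∀ i j, Differentiable ℂ fun w => P w i j) ∧ P 0 = 1 ∧
      (∃ C : ℝ, ∀ w : ℂ, |w.re| ≤ 1 / 2 → ‖P w‖ ≤ C) ∧
      (∀ w : ℂ, w.re = 1 / 2 → (P w)ᴴ * P w = η ∧ P w * (P w)ᴴ = η) ∧
      (∀ w : ℂ, w.re = -1 / 2 → (P w)ᴴ * η * P w = 1 ∧ P w * η * (P w)ᴴ = 1) := by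
  set U : Matrix p p ℂ := hη.isHermitian.eigenvectorUnitary.1 with hU
  have hU1 : U * Uᴴ = 1 := Matrix.mem_unitaryGroup_iff.1 hη.isHermitian.eigenvectorUnitary.2
  have hU2 : Uᴴ * U = 1 := Matrix.mem_unitaryGroup_iff'.1 hη.isHermitian.eigenvectorUnitary.2
  set lam := hη.isHermitian.eigenvalues with hlam
  have hpos : ∀ i, 0 < lam i := hη.eigenvalues_pos
  have hspec : η = U * Matrix.diagonal (fun i => (lam i : ℂ)) * Uᴴ := by
    have := hη.isHermitian.spectral_theorem
    rw [Unitary.conjStarAlgAut_apply] at this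
    exact this
  let e : ℂ → p → ℂ := fun w i => Complex.exp (w * Real.log (lam i))
  let P : ℂ → Matrix p p ℂ := fun w => U * Matrix.diagonal (e w) * Uᴴ
  have hnorm : ∀ w i, e w i * star (e w i) = ((lam i ^ (2 * w.re) : ℝ) : ℂ) := by
    intro w i
    have : e w i * star (e w i) = ((‖e w i‖ ^ 2 : ℝ) : ℂ) := by
      push_cast; exact Complex.mul_conj' _
    rw [this, Complex.norm_exp]
    congr 1
    rw [← Real.exp_nat_mul, Real.rpow_def_of_pos (hpos i)]
    congr 1
    simp
    ring
  have hPH : ∀ w, (P w)ᴴ = U * Matrix.diagonal (fun i => star (e w i)) * Uᴴ := by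
    intro w
    simp only [P, Matrix.conjTranspose_mul, Matrix.conjTranspose_conjTranspose,
      Matrix.diagonal_conjTranspose, Matrix.mul_assoc]
    rfl
  have hmul : ∀ a b : p → ℂ, U * Matrix.diagonal a * Uᴴ * (U * Matrix.diagonal b * Uᴴ)
      = U * Matrix.diagonal (fun i => a i * b i) * Uᴴ := by
    intro a b
    calc U * Matrix.diagonal a * Uᴴ * (U * Matrix.diagonal b * Uᴴ)
        = U * Matrix.diagonal a * (Uᴴ * U) * Matrix.diagonal b * Uᴴ := by
          simp only [Matrix.mul_assoc]
      _ = U * Matrix.diagonal (fun i => a i * b i) * Uᴴ := by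
          rw [hU2, Matrix.mul_one, Matrix.mul_assoc U, Matrix.diagonal_mul_diagonal]
  have hone : U * Matrix.diagonal (fun _ => (1 : ℂ)) * Uᴴ = 1 := by
    rw [Matrix.diagonal_one, Matrix.mul_one, hU1]
  have hentry : ∀ w i j, P w i j = ∑ k, U i k * e w k * star (U j k) := by
    intro w i j
    simp [P, Matrix.mul_apply, Matrix.diagonal_apply]
  refine ⟨P, ?_, ?_, ?_, ?_, ?_⟩
  · intro i j
    simp only [hentry, e]
    fun_prop
  · simpa [P, e] using hone
  · set R := Real.exp (∑ i, |Real.log (lam i)|) with hR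
    refine ⟨‖U‖ * √(Fintype.card p * (Fintype.card p * R ^ 2)) * ‖Uᴴ‖, fun w hw => ?_⟩
    refine (Matrix.frobenius_norm_mul _ _).trans (mul_le_mul_of_nonneg_right
      ((Matrix.frobenius_norm_mul _ _).trans (mul_le_mul_of_nonneg_left
        (frobenius_norm_le_of_entries fun i j => ?_) (norm_nonneg _))) (norm_nonneg _))
    rw [Matrix.diagonal_apply]
    split_ifs
    · rw [Complex.norm_exp]
      refine Real.exp_le_exp.2 ?_
      rw [Complex.re_mul_ofReal]
      calc w.re * Real.log (lam i) ≤ |w.re * Real.log (lam i)| := le_abs_self _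
        _ = |w.re| * |Real.log (lam i)| := abs_mul _ _
        _ ≤ 1 * |Real.log (lam i)| := by gcongr; linarith
        _ ≤ ∑ i, |Real.log (lam i)| := by
          rw [one_mul]
          exact Finset.single_le_sum (f := fun i => |Real.log (lam i)|)
            (fun i _ => abs_nonneg _) (Finset.mem_univ i)
    · rw [norm_zero]; positivity
  · intro w hw
    have h1 : ∀ i, e w i * star (e w i) = lam i := fun i => by rw [hnorm, hw]; norm_num
    rw [hPH]
    simp only [P, hmul]
    simp only [mul_comm (star (e w _)), h1, hspec.symm, and_self]
  · intro w hw
    have h1 : ∀ i, star (e w i) * lam i * e w i = 1 := fun i => by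
      rw [mul_right_comm, mul_comm (star _), hnorm, hw, ← Complex.ofReal_mul]
      norm_num [Real.rpow_neg_one, (hpos i).ne']
    rw [hPH]
    simp only [P]
    rw [hspec]
    have h2 : ∀ i, e w i * lam i * star (e w i) = 1 := fun i => by
      rw [← h1 i]; ring
    simp only [hmul, h1, h2, hone, and_self]

/-- A tuple whose Hilbert–Schmidt bound is less than `ρ` is the value at `1 / 2` of a bounded
entire family that is bounded by `ρ` in the row sense on the left side of the strip and in the
column sense on its right side. -/
theorem exists_strip_family {y : ι → Matrix p p ℂ} {c ρ : ℝ} (hc : 0 ≤ c) (hcρ : c < ρ)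
    (h : HSBound y (fun l => (y l)ᴴ) c) :
    ∃ F : ℂ → ι → Matrix p p ℂ, (∀ l i j, Differentiable ℂ fun z => F z l i j) ∧
      (∃ C : ℝ, ∀ z : ℂ, 0 ≤ z.re → z.re ≤ 1 → ∀ l i j, ‖F z l i j‖ ≤ C) ∧
      F (1 / 2) = y ∧ (∀ z : ℂ, z.re = 0 → IsRow (F z) ρ) ∧
      (∀ z : ℂ, z.re = 1 → IsCol (F z) ρ) := by
  obtain ⟨ξ, η, hξ, hη, h1, h2⟩ := exists_posDef_weights hc hcρ h
  obtain ⟨P, hPd, hP0, ⟨C, hPC⟩, hPp, hPm⟩ := exists_complex_powers hη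
  obtain ⟨Q, hQd, hQ0, ⟨D, hQD⟩, hQp, hQm⟩ := exists_complex_powers hξ
  -- This is F_l(z) = η^{z-1/2} y_l ξ^{1/2-z}. On the left side the powers have real exponents -1/2
  -- and 1/2, so ∑ F_l F_lᴴ ≤ ρ is a conjugate of the first weight inequality; on the right side the
  -- exponents are exchanged and the second inequality gives ∑ F_lᴴ F_l ≤ ρ.
  refine ⟨fun z l => P (z - 1 / 2) * y l * Q (1 / 2 - z), ?_, ⟨C * (∑ l, ‖y l‖) * D, ?_⟩, ?_, ?_, ?_⟩
  · intro l i j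
    have hP' : ∀ i j, Differentiable ℂ fun z => P (z - 1 / 2) i j := fun i j =>
      (hPd i j).comp (by fun_prop : Differentiable ℂ fun z : ℂ => z - 1 / 2)
    have hQ' : ∀ i j, Differentiable ℂ fun z => Q (1 / 2 - z) i j := fun i j =>
      (hQd i j).comp (by fun_prop : Differentiable ℂ fun z : ℂ => 1 / 2 - z)
    simp only [Matrix.mul_apply]
    fun_prop
  · intro z hz0 hz1 l i j
    have hw : |(z - 1 / 2).re| ≤ 1 / 2 := by
      rw [abs_le]; constructor <;> simp <;> linarith
    have hw' : |(1 / 2 - z).re| ≤ 1 / 2 := by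
      rw [abs_le]; constructor <;> simp <;> linarith
    have hent : ∀ A : Matrix p p ℂ, ‖A i j‖ ≤ ‖A‖ := fun A => by
      refine abs_le_of_sq_le_sq' ?_ (norm_nonneg _) |>.2
      rw [frobenius_norm_sq]
      exact (Finset.single_le_sum (f := fun j => ‖A i j‖ ^ 2) (fun _ _ => by positivity)
        (Finset.mem_univ j)).trans (Finset.single_le_sum (f := fun i => ∑ j, ‖A i j‖ ^ 2)
        (fun _ _ => by positivity) (Finset.mem_univ i))
    refine (hent _).trans ((Matrix.frobenius_norm_mul _ _).trans ?_)
    have hC0 : 0 ≤ C := (norm_nonneg _).trans (hPC _ hw)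
    refine mul_le_mul ((Matrix.frobenius_norm_mul _ _).trans (mul_le_mul (hPC _ hw) ?_
      (norm_nonneg _) hC0)) (hQD _ hw') (norm_nonneg _) (by positivity)
    exact Finset.single_le_sum (f := fun l => ‖y l‖) (fun _ _ => norm_nonneg _) (Finset.mem_univ l)
  · funext l
    simp [hP0, hQ0]
  · intro z hz
    obtain ⟨-, hP1⟩ := hPm (z - 1 / 2) (by simp [hz]; norm_num)
    obtain ⟨-, hQ1⟩ := hQp (1 / 2 - z) (by simp [hz])
    have := h1.mul_mul_conjTranspose_same (P (z - 1 / 2))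
    rw [Matrix.mul_sub, Matrix.sub_mul, Matrix.mul_smul, Matrix.smul_mul, hP1, Matrix.mul_sum,
      Matrix.sum_mul] at this
    have e : ∀ l, P (z - 1 / 2) * y l * Q (1 / 2 - z) * (P (z - 1 / 2) * y l * Q (1 / 2 - z))ᴴ
        = P (z - 1 / 2) * (y l * ξ * (y l)ᴴ) * (P (z - 1 / 2))ᴴ := fun l => by
      rw [← hQ1]
      simp only [Matrix.conjTranspose_mul, Matrix.mul_assoc]
    rw [IsRow, Finset.sum_congr rfl fun l _ => e l]
    exact this
  · intro z hz
    obtain ⟨hP1, -⟩ := hPp (z - 1 / 2) (by simp [hz]; norm_num)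
    obtain ⟨hQ1, -⟩ := hQm (1 / 2 - z) (by simp [hz]; norm_num)
    have := h2.conjTranspose_mul_mul_same (Q (1 / 2 - z))
    rw [Matrix.mul_sub, Matrix.sub_mul, Matrix.mul_smul, Matrix.smul_mul, hQ1, Matrix.mul_sum,
      Matrix.sum_mul] at this
    have e : ∀ l, (P (z - 1 / 2) * y l * Q (1 / 2 - z))ᴴ *
        (P (z - 1 / 2) * y l * Q (1 / 2 - z))ᴴᴴ
        = (Q (1 / 2 - z))ᴴ * ((y l)ᴴ * η * y l) * Q (1 / 2 - z) := fun l => by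
      rw [← hP1]
      simp only [Matrix.conjTranspose_mul, Matrix.conjTranspose_conjTranspose, Matrix.mul_assoc]
    rw [IsCol, IsRow, Finset.sum_congr rfl fun l _ => e l]
    exact this

/-- The Cauchy–Schwarz inequality for Hilbert–Schmidt bounds. -/
theorem HSBound.cauchy_schwarz {m : Type*} [Fintype m] [DecidableEq m] {y : ι → Matrix p p ℂ}
    {x : ι → Matrix m m ℂ} {c₁ c₂ : ℝ} (hc₁ : 0 ≤ c₁) (hc₂ : 0 ≤ c₂)
    (hy : HSBound y (fun l => (y l)ᴴ) c₁) (hx : HSBound x (fun l => (x l)ᴴ) c₂) :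
    HSBound y (fun l => (x l)ᴴ) (√c₁ * √c₂) := by
  -- The strip family of y is paired with that of the adjoint tuple of x. The slack ε is there
  -- because strip families need a strict inequality.
  have key : ∀ ε : ℝ, 0 < ε → HSBound y (fun l => (x l)ᴴ) (√(c₁ + ε) * √(c₂ + ε)) := by
    intro ε hε
    obtain ⟨F, hFd, ⟨C, hFC⟩, hF, hF0, hF1⟩ := exists_strip_family hc₁ (lt_add_of_pos_right c₁ hε) hy
    obtain ⟨G, hGd, ⟨D, hGD⟩, hG, hG0, hG1⟩ :=
      exists_strip_family hc₂ (lt_add_of_pos_right c₂ hε) hx.conjTranspose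
    rw [← hF, ← hG]
    exact hsBound_of_strip (fun l i j => (hFd l i j).diffContOnCl)
      (fun l i j => (hGd l i j).diffContOnCl) hFC hGD hF0 hG0 hF1 hG1
  intro ζ ζ'
  have hlim : Filter.Tendsto (fun ε : ℝ => √(c₁ + ε) * √(c₂ + ε) * ‖ζ‖ * ‖ζ'‖)
      (nhdsWithin 0 (Set.Ioi 0)) (nhds (√c₁ * √c₂ * ‖ζ‖ * ‖ζ'‖)) := by
    have : Continuous fun ε : ℝ => √(c₁ + ε) * √(c₂ + ε) * ‖ζ‖ * ‖ζ'‖ := by fun_prop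
    simpa using (this.tendsto 0).mono_left nhdsWithin_le_nhds
  exact ge_of_tendsto hlim (eventually_nhdsWithin_of_forall fun ε hε => key ε hε ζ ζ')

end PositiveWeights

end OpInterp

namespace OpInterp

/-! ### Self-duality determines the matrix norms of OH -/

theorem norm_clm_smul {E F : Type*} [NormedAddCommGroup E] [NormedSpace ℂ E]
    [NormedAddCommGroup F] [NormedSpace ℂ F] (c : ℂ) (A : E →L[ℂ] F) : ‖c • A‖ = ‖c‖ * ‖A‖ :=
  norm_smul c A

theorem norm_amplify_smul {V K L : Type*} [AddCommGroup V] [Module ℂ V]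
    [NormedAddCommGroup K] [InnerProductSpace ℂ K] [NormedAddCommGroup L] [InnerProductSpace ℂ L]
    (j : V →ₗ[ℂ] (K →L[ℂ] L)) {m : ℕ} (c : ℂ) (x : Matrix (Fin m) (Fin m) V) :
    ‖amplify j m (c • x)‖ = ‖c‖ * ‖amplify j m x‖ := by
  rw [map_smul]
  exact norm_clm_smul c _

section Coordinates

open scoped Matrix ComplexOrder Matrix.Norms.Frobenius InnerProductSpace

/-- The coordinates in `M_m` of a matrix with entries in `ℓ₂^n`. -/
def coords {n : ℕ} {m : Type*} (x : Matrix m m (EuclideanSpace ℂ (Fin n))) :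
    Fin n → Matrix m m ℂ :=
  fun l => x.map fun v => v l

theorem coords_smul {n m : ℕ} (c : ℂ) (x : Matrix (Fin m) (Fin m) (EuclideanSpace ℂ (Fin n))) :
    coords (c • x) = c • coords x := rfl

/-- A vector of `(ℓ₂^m)^p`, as a matrix. -/
def toMat {p m : ℕ} (ζ : PiLp 2 fun _ : Fin p => EuclideanSpace ℂ (Fin m)) :
    Matrix (Fin p) (Fin m) ℂ :=
  Matrix.of fun s i => ζ s i

theorem norm_toMat {p m : ℕ} (ζ : PiLp 2 fun _ : Fin p => EuclideanSpace ℂ (Fin m)) :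
    ‖toMat ζ‖ = ‖ζ‖ := by
  rw [← sq_eq_sq₀ (norm_nonneg _) (norm_nonneg _), frobenius_norm_sq, PiLp.norm_sq_eq_of_L2]
  refine Finset.sum_congr rfl fun s _ => ?_
  rw [EuclideanSpace.norm_sq_eq]
  rfl

theorem toMat_surjective {p m : ℕ} (Z : Matrix (Fin p) (Fin m) ℂ) :
    ∃ ζ : PiLp 2 fun _ : Fin p => EuclideanSpace ℂ (Fin m), toMat ζ = Z :=
  ⟨WithLp.toLp 2 fun s => WithLp.toLp 2 fun i => Z s i, rfl⟩

variable {n : ℕ}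

/-- With (ℓ₂^m)^p read as p × m matrices, the antilinear identification with the dual becomes right
multiplication by the adjoint coordinates. This is the operator form of ∑ y_l ⊗ conj x_l. -/
theorem toMat_amplify_matFunctional {m p : ℕ}
    (x : Matrix (Fin m) (Fin m) (EuclideanSpace ℂ (Fin n)))
    (y : Matrix (Fin p) (Fin p) (EuclideanSpace ℂ (Fin n)))
    (ζ : PiLp 2 fun _ : Fin p => EuclideanSpace ℂ (Fin m)) :
    toMat (amplify (matEmb m) p (y.map (matFunctional
      (x.map (InnerProductSpace.toDual ℂ (EuclideanSpace ℂ (Fin n)))))) ζ)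
      = ∑ l, coords y l * toMat ζ * (coords x l)ᴴ := by
  ext s i
  simp only [toMat, Matrix.of_apply, amplify_apply, Matrix.map_apply, Matrix.sum_apply,
    Matrix.mul_apply, Matrix.conjTranspose_apply, coords, matEmb, LinearMap.coe_mk,
    AddHom.coe_mk, WithLp.ofLp_sum, Finset.sum_apply, Matrix.ofLp_toEuclideanCLM,
    Matrix.mulVec, dotProduct, matFunctional, InnerProductSpace.toDual_apply_apply,
    PiLp.inner_apply, RCLike.inner_apply, Finset.sum_mul]
  simp only [← Finset.sum_product']
  refine Finset.sum_nbij' (fun x => (x.2.2, x.2.1, x.1)) (fun x => (x.2.2, x.2.1, x.1))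
    (by simp) (by simp) (by simp) (by simp) fun x _ => ?_
  exact mul_right_comm _ _ _

theorem norm_amplify_matFunctional_le_iff {m p : ℕ} {c : ℝ} (hc : 0 ≤ c)
    (x : Matrix (Fin m) (Fin m) (EuclideanSpace ℂ (Fin n)))
    (y : Matrix (Fin p) (Fin p) (EuclideanSpace ℂ (Fin n))) :
    opMatNorm (matEmb m) p (y.map (matFunctional
      (x.map (InnerProductSpace.toDual ℂ (EuclideanSpace ℂ (Fin n)))))) ≤ ENNReal.ofReal c
      ↔ HSBound (coords y) (fun l => (coords x l)ᴴ) c := by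
  rw [opMatNorm, ← ofReal_norm, ENNReal.ofReal_le_ofReal_iff hc]
  constructor
  · intro h
    refine HSBound.of_norm_le fun Z => ?_
    obtain ⟨ζ, rfl⟩ := toMat_surjective Z
    rw [← toMat_amplify_matFunctional, norm_toMat, norm_toMat]
    exact ContinuousLinearMap.le_of_opNorm_le _ h ζ
  · intro h
    refine ContinuousLinearMap.opNorm_le_bound _ hc fun ζ => ?_
    have := h.norm_le (toMat ζ)
    rwa [← toMat_amplify_matFunctional, norm_toMat, norm_toMat] at this

variable {K : Type*} [NormedAddCommGroup K] [InnerProductSpace ℂ K]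

theorem dualMatNorm_le_iff (j : EuclideanSpace ℂ (Fin n) →ₗ[ℂ] (K →L[ℂ] K)) {m : ℕ} {c : ℝ}
    (hc : 0 ≤ c) (x : Matrix (Fin m) (Fin m) (EuclideanSpace ℂ (Fin n))) :
    dualMatNorm (opMatNorm j) m
        (x.map (InnerProductSpace.toDual ℂ (EuclideanSpace ℂ (Fin n)))) ≤ ENNReal.ofReal c
      ↔ ∀ (p : ℕ) (y : Matrix (Fin p) (Fin p) (EuclideanSpace ℂ (Fin n))),
        ‖amplify j p y‖ ≤ 1 → HSBound (coords y) (fun l => (coords x l)ᴴ) c := by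
  simp only [dualMatNorm, cbNorm, iSup_le_iff, norm_amplify_matFunctional_le_iff hc]
  refine forall_congr' fun p => forall_congr' fun y => ?_
  rw [opMatNorm, ← ofReal_norm, ENNReal.ofReal_le_one]

theorem HSBound.of_forall_pos {p m : Type*} [Fintype p] [Fintype m] {u : Fin n → Matrix p p ℂ}
    {w : Fin n → Matrix m m ℂ} {c : ℝ → ℝ} (hc : Continuous c)
    (h : ∀ ε > 0, HSBound u w (c ε)) : HSBound u w (c 0) := by
  intro ζ ζ'
  have hlim : Filter.Tendsto (fun ε : ℝ => c ε * ‖ζ‖ * ‖ζ'‖)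
      (nhdsWithin 0 (Set.Ioi 0)) (nhds (c 0 * ‖ζ‖ * ‖ζ'‖)) :=
    ((hc.tendsto 0).mono_left nhdsWithin_le_nhds).mul_const _ |>.mul_const _
  exact ge_of_tendsto hlim (eventually_nhdsWithin_of_forall fun ε hε => h ε hε ζ ζ')

theorem HSBound.smul_smul {p m : Type*} [Fintype p] [Fintype m] {u : Fin n → Matrix p p ℂ}
    {w : Fin n → Matrix m m ℂ} {c : ℝ} (h : HSBound u w c) (a b : ℂ) :
    HSBound (a • u) (b • w) (‖a‖ * ‖b‖ * c) := by
  intro ζ ζ'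
  have : ∑ l, (a • u) l * ζ * (b • w) l = (a * b) • ∑ l : Fin n, u l * ζ * w l := by
    rw [Finset.smul_sum]
    refine Finset.sum_congr rfl fun l _ => ?_
    rw [Pi.smul_apply, Pi.smul_apply, Matrix.smul_mul, Matrix.smul_mul, Matrix.mul_smul]
    rw [← smul_assoc, smul_eq_mul, mul_comm]
  rw [this, Matrix.mul_smul, Matrix.trace_smul, norm_smul, norm_mul, mul_assoc (‖a‖ * ‖b‖),
    mul_assoc (‖a‖ * ‖b‖)]
  exact mul_le_mul_of_nonneg_left (h ζ ζ') (by positivity)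

/-- The matrix norms of `OH_n`. -/
theorem IsOH.norm_amplify_le_iff {j : EuclideanSpace ℂ (Fin n) →ₗᵢ[ℂ] (K →L[ℂ] K)} (hj : IsOH j)
    {m : ℕ} {c : ℝ} (hc : 0 ≤ c) (x : Matrix (Fin m) (Fin m) (EuclideanSpace ℂ (Fin n))) :
    ‖amplify j.toLinearMap m x‖ ≤ c ↔
      HSBound (coords x) (fun l => (coords x l)ᴴ) (c ^ 2) := by
  have hdual : ∀ (m : ℕ) (c : ℝ), 0 ≤ c →
      ∀ x : Matrix (Fin m) (Fin m) (EuclideanSpace ℂ (Fin n)),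
      ‖amplify j.toLinearMap m x‖ ≤ c ↔
      ∀ (p : ℕ) (y : Matrix (Fin p) (Fin p) (EuclideanSpace ℂ (Fin n))),
        ‖amplify j.toLinearMap p y‖ ≤ 1 → HSBound (coords y) (fun l => (coords x l)ᴴ) c := by
    intro m c hc x
    rw [← dualMatNorm_le_iff _ hc, hj m x, opMatNorm, ← ofReal_norm,
      ENNReal.ofReal_le_ofReal_iff hc]
  have hself : ∀ (m : ℕ) (c : ℝ), 0 ≤ c →
      ∀ x : Matrix (Fin m) (Fin m) (EuclideanSpace ℂ (Fin n)),
      ‖amplify j.toLinearMap m x‖ ≤ c →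
      HSBound (coords x) (fun l => (coords x l)ᴴ) (c ^ 2) := by
    intro m c hc x hx
    -- The dual norm of x is tested on x / (c + ε), which lies in the unit ball; undoing the scaling
    -- squares the constant. The ε avoids division by zero when c = 0.
    have key : ∀ ε > 0, HSBound (coords x) (fun l => (coords x l)ᴴ) ((c + ε) ^ 2) := by
      intro ε hε
      have hcε : 0 < c + ε := by positivity
      have h1 := (hdual m (c + ε) hcε.le x).1 (hx.trans (by linarith)) m
        (((c + ε)⁻¹ : ℂ) • x) (by
          rw [norm_amplify_smul, norm_inv, ← Complex.ofReal_add, Complex.norm_real,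
            Real.norm_of_nonneg hcε.le, inv_mul_le_one₀ hcε]
          linarith)
      have h2 := h1.smul_smul ((c + ε : ℝ) : ℂ) 1
      rw [coords_smul, smul_smul, ← Complex.ofReal_add, ← Complex.ofReal_inv, ← Complex.ofReal_mul,
        mul_inv_cancel₀ hcε.ne', one_smul, Complex.ofReal_one, one_smul, norm_one,
        Complex.norm_real, Real.norm_of_nonneg hcε.le, mul_one, ← sq] at h2
      exact h2
    simpa using HSBound.of_forall_pos (c := fun ε => (c + ε) ^ 2) (by fun_prop) key
  refine ⟨hself m c hc x, fun h => ?_⟩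
  rw [hdual m c hc x]
  intro p y hy
  have hy' := hself p 1 zero_le_one y hy
  have := hy'.cauchy_schwarz (by positivity) (by positivity) h
  simpa [Real.sqrt_sq hc] using this

end Coordinates

end OpInterp

namespace OpInterp

/-! ### A realization of OH -/

section ExistenceOH

open scoped Matrix ComplexOrder Matrix.Norms.Frobenius InnerProductSpace

variable {n : ℕ}

theorem norm_piLp_fin_one {E : Type*} [NormedAddCommGroup E] (ξ : PiLp 2 fun _ : Fin 1 => E) :
    ‖ξ‖ = ‖ξ 0‖ := by
  rw [PiLp.norm_eq_of_L2]
  simp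

theorem norm_apply_eq_norm_amplify_one {V K L : Type*} [AddCommGroup V] [Module ℂ V]
    [NormedAddCommGroup K] [InnerProductSpace ℂ K] [NormedAddCommGroup L] [InnerProductSpace ℂ L]
    (j : V →ₗ[ℂ] (K →L[ℂ] L)) (v : V) :
    ‖j v‖ = ‖amplify j 1 (Matrix.of fun _ _ => v)‖ := by
  refine le_antisymm ?_ ?_
  · refine ContinuousLinearMap.opNorm_le_bound _ (ContinuousLinearMap.opNorm_nonneg _) fun k => ?_
    have := (amplify j 1 (Matrix.of fun _ _ => v)).le_opNorm (WithLp.toLp 2 fun _ => k)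
    rw [norm_piLp_fin_one, norm_piLp_fin_one, amplify_apply] at this
    simpa using this
  · refine ContinuousLinearMap.opNorm_le_bound _ (norm_nonneg _) fun ξ => ?_
    rw [norm_piLp_fin_one, norm_piLp_fin_one, amplify_apply]
    simpa using (j v).le_opNorm (ξ 0)

theorem HSBound.mono {ι p m : Type*} [Fintype ι] [Fintype p] [Fintype m] {u : ι → Matrix p p ℂ}
    {w : ι → Matrix m m ℂ} {c c' : ℝ} (h : HSBound u w c) (hc : c ≤ c') : HSBound u w c' :=
  fun ζ ζ' => (h ζ ζ').trans (by gcongr)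

/-- Replace ζ by ζᴴ and take adjoints. -/
theorem HSBound.swap {ι p m : Type*} [Fintype ι] [Fintype p] [Fintype m] {u : ι → Matrix p p ℂ}
    {w : ι → Matrix m m ℂ} {c : ℝ} (h : HSBound u (fun l => (w l)ᴴ) c) :
    HSBound w (fun l => (u l)ᴴ) c := by
  refine HSBound.of_norm_le fun ζ => ?_
  have := h.norm_le ζᴴ
  rw [← Matrix.frobenius_norm_conjTranspose, Matrix.conjTranspose_sum] at this
  simpa [Matrix.conjTranspose_mul, Matrix.mul_assoc, Matrix.frobenius_norm_conjTranspose] using this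

theorem exists_hsBound {ι p m : Type*} [Fintype ι] [Fintype p] [Fintype m]
    (u : ι → Matrix p p ℂ) (w : ι → Matrix m m ℂ) : ∃ c, 0 ≤ c ∧ HSBound u w c := by
  refine ⟨∑ l, ‖u l‖ * ‖w l‖, by positivity, HSBound.of_norm_le fun ζ => ?_⟩
  refine (norm_sum_le _ _).trans ?_
  rw [Finset.sum_mul]
  refine Finset.sum_le_sum fun l _ => ?_
  refine (Matrix.frobenius_norm_mul _ _).trans ?_
  rw [mul_right_comm]
  exact mul_le_mul_of_nonneg_right (Matrix.frobenius_norm_mul _ _) (norm_nonneg _)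

/-- The best Hilbert–Schmidt bound is attained. -/
theorem exists_least_hsBound {ι p m : Type*} [Fintype ι] [Fintype p] [Fintype m]
    (u : ι → Matrix p p ℂ) (w : ι → Matrix m m ℂ) :
    ∃ c, 0 ≤ c ∧ HSBound u w c ∧ ∀ c', 0 ≤ c' → HSBound u w c' → c ≤ c' := by
  set S : Set ℝ := {c | 0 ≤ c ∧ HSBound u w c} with hS
  have hcl : IsClosed S := by
    simp only [hS, HSBound, Set.ofPred_and, Set.ofPred_forall]
    refine (isClosed_le continuous_const continuous_id).inter ?_
    exact isClosed_iInter fun ζ => isClosed_iInter fun ζ' =>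
      isClosed_le continuous_const (by fun_prop)
  have hbdd : BddBelow S := ⟨0, fun c hc => hc.1⟩
  have hmem := hcl.csInf_mem (exists_hsBound u w) hbdd
  exact ⟨sInf S, hmem.1, hmem.2, fun c' h0 h => csInf_le hbdd ⟨h0, h⟩⟩

/-- The operator space spanned in `M_p` by the entrywise conjugates of the matrices `y l`. -/
noncomputable def conjEmb {p : ℕ} (y : Fin n → Matrix (Fin p) (Fin p) ℂ) :
    EuclideanSpace ℂ (Fin n) →ₗ[ℂ] (EuclideanSpace ℂ (Fin p) →L[ℂ] EuclideanSpace ℂ (Fin p)) where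
  toFun v := matEmb p (∑ l, v l • (y l).map star)
  map_add' v w := by
    rw [← map_add]
    simp [add_smul, Finset.sum_add_distrib]
  map_smul' c v := by
    rw [RingHom.id_apply, ← map_smul]
    simp [Finset.smul_sum, smul_smul]

theorem toMat_amplify_conjEmb {p m : ℕ} (y : Fin n → Matrix (Fin p) (Fin p) ℂ)
    (x : Matrix (Fin m) (Fin m) (EuclideanSpace ℂ (Fin n)))
    (ζ : PiLp 2 fun _ : Fin m => EuclideanSpace ℂ (Fin p)) :
    toMat (amplify (conjEmb y) m x ζ) = ∑ l, coords x l * toMat ζ * (y l)ᴴ := by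
  ext s i
  simp only [toMat, Matrix.of_apply, amplify_apply, conjEmb, Matrix.map_apply, Matrix.sum_apply,
    Matrix.mul_apply, Matrix.conjTranspose_apply, coords, matEmb, LinearMap.coe_mk,
    AddHom.coe_mk, WithLp.ofLp_sum, Finset.sum_apply, Matrix.ofLp_toEuclideanCLM,
    Matrix.mulVec, dotProduct, Matrix.smul_apply, smul_eq_mul, Finset.sum_mul]
  simp only [← Finset.sum_product']
  refine Finset.sum_nbij' (fun x => (x.2.2, x.2.1, x.1)) (fun x => (x.2.2, x.2.1, x.1))
    (by simp) (by simp) (by simp) (by simp) fun x _ => ?_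
  exact mul_right_comm _ _ _

theorem norm_amplify_conjEmb_le_iff {p m : ℕ} {c : ℝ} (hc : 0 ≤ c)
    (y : Fin n → Matrix (Fin p) (Fin p) ℂ)
    (x : Matrix (Fin m) (Fin m) (EuclideanSpace ℂ (Fin n))) :
    ‖amplify (conjEmb y) m x‖ ≤ c ↔ HSBound (coords x) (fun l => (y l)ᴴ) c := by
  constructor
  · intro h
    refine HSBound.of_norm_le fun Z => ?_
    obtain ⟨ζ, rfl⟩ := toMat_surjective Z
    rw [← toMat_amplify_conjEmb, norm_toMat, norm_toMat]
    exact ContinuousLinearMap.le_of_opNorm_le _ h ζ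
  · intro h
    refine ContinuousLinearMap.opNorm_le_bound _ hc fun ζ => ?_
    have := h.norm_le (toMat ζ)
    rwa [← toMat_amplify_conjEmb, norm_toMat, norm_toMat] at this

theorem sum_coords_single (v : EuclideanSpace ℂ (Fin n)) (ζ : Matrix (Fin 1) (Fin 1) ℂ) :
    ∑ l, coords (Matrix.of fun _ _ : Fin 1 => v) l * ζ *
      (coords (Matrix.of fun _ _ : Fin 1 => v) l)ᴴ = ((‖v‖ ^ 2 : ℝ) : ℂ) • ζ := by
  ext i k
  fin_cases i; fin_cases k
  rw [EuclideanSpace.norm_sq_eq]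
  simp only [coords, Matrix.sum_apply, Matrix.mul_apply, Matrix.map_apply, Matrix.of_apply,
    Matrix.conjTranspose_apply, Matrix.smul_apply, Finset.univ_unique, Finset.sum_singleton,
    smul_eq_mul]
  push_cast
  rw [Finset.sum_mul]
  refine Finset.sum_congr rfl fun l _ => ?_
  rw [← Complex.mul_conj', mul_right_comm]
  rfl

theorem hsBound_coords_single (v : EuclideanSpace ℂ (Fin n)) :
    HSBound (coords (Matrix.of fun _ _ : Fin 1 => v))
      (fun l => (coords (Matrix.of fun _ _ : Fin 1 => v) l)ᴴ) (‖v‖ ^ 2) :=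
  HSBound.of_norm_le fun ζ => by
    rw [sum_coords_single, norm_smul, Complex.norm_real, Real.norm_of_nonneg (by positivity)]

theorem norm_sq_le_of_hsBound_coords_single {v : EuclideanSpace ℂ (Fin n)} {c : ℝ}
    (h : HSBound (coords (Matrix.of fun _ _ : Fin 1 => v))
      (fun l => (coords (Matrix.of fun _ _ : Fin 1 => v) l)ᴴ) c) : ‖v‖ ^ 2 ≤ c := by
  have := h.norm_le 1
  rw [sum_coords_single, norm_smul, Complex.norm_real, Real.norm_of_nonneg (by positivity)] at this
  have h1 : 0 < ‖(1 : Matrix (Fin 1) (Fin 1) ℂ)‖ := norm_pos_iff.2 one_ne_zero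
  exact le_of_mul_le_mul_right this h1

/-- Cauchy–Schwarz between y and the 1 × 1 tuple of coordinates of v. The bound is uniform in y, so
the direct sum over all contractive tuples is a bounded operator. -/
theorem norm_conjEmb_le {p : ℕ} {y : Fin n → Matrix (Fin p) (Fin p) ℂ}
    (hy : HSBound y (fun l => (y l)ᴴ) 1) (v : EuclideanSpace ℂ (Fin n)) : ‖conjEmb y v‖ ≤ ‖v‖ := by
  rw [norm_apply_eq_norm_amplify_one, norm_amplify_conjEmb_le_iff (norm_nonneg _)]
  have := (hsBound_coords_single v).cauchy_schwarz (by positivity) zero_le_one hy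
  simpa using this

variable (n) in
/-- The contractive tuples of matrices, for the Hilbert–Schmidt norm. -/
def ContractiveTuple : Type :=
  Σ p : ℕ, {y : Fin n → Matrix (Fin p) (Fin p) ℂ // HSBound y (fun l => (y l)ᴴ) 1}

variable (n) in
/-- The Hilbert sum that carries a realization of `OH_n`. -/
abbrev OHSpace : Type := lp (fun α : ContractiveTuple n => EuclideanSpace ℂ (Fin α.1)) 2

variable (n) in
/-- The direct sum of the maps `conjEmb y`, over the contractive tuples `y`. -/
noncomputable def ohEmb : EuclideanSpace ℂ (Fin n) →ₗ[ℂ] (OHSpace n →L[ℂ] OHSpace n) where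
  toFun v := lp.mapCLM 2 (fun α => conjEmb α.2.1 v) (norm_nonneg v)
    fun α => norm_conjEmb_le α.2.2 v
  map_add' v w := by
    ext ω α : 3
    simp
  map_smul' c v := by
    ext ω α : 3
    simp

theorem ohEmb_apply (v : EuclideanSpace ℂ (Fin n)) (ω : OHSpace n) (α : ContractiveTuple n) :
    ohEmb n v ω α = conjEmb α.2.1 v (ω α) := rfl

theorem hasSum_norm_sq {E : ContractiveTuple n → Type*} [∀ α, NormedAddCommGroup (E α)]
    (f : lp E 2) : HasSum (fun α => ‖f α‖ ^ 2) (‖f‖ ^ 2) := by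
  simpa using lp.hasSum_norm (p := 2) (by norm_num) f

-- The norm of a direct sum is the supremum over its blocks: vectors supported in one block give one
-- direction, summing the squared block estimates gives the other.
open Classical in
theorem norm_amplify_ohEmb_le_iff {m : ℕ} {c : ℝ} (hc : 0 ≤ c)
    (x : Matrix (Fin m) (Fin m) (EuclideanSpace ℂ (Fin n))) :
    ‖amplify (ohEmb n) m x‖ ≤ c ↔
      ∀ α : ContractiveTuple n, ‖amplify (conjEmb α.2.1) m x‖ ≤ c := by
  constructor
  · intro h α
    refine ContinuousLinearMap.opNorm_le_bound _ hc fun ζ => ?_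
    let ω : PiLp 2 fun _ : Fin m => OHSpace n := WithLp.toLp 2 fun k =>
      lp.single 2 α (ζ k)
    have hω : ‖ω‖ = ‖ζ‖ := by
      rw [PiLp.norm_eq_of_L2, PiLp.norm_eq_of_L2]
      simp only [ω, lp.norm_single (by norm_num : (0 : ℝ≥0∞) < 2)]
    have key : ‖amplify (conjEmb α.2.1) m x ζ‖ ≤ ‖amplify (ohEmb n) m x ω‖ := by
      rw [PiLp.norm_eq_of_L2, PiLp.norm_eq_of_L2]
      refine Real.sqrt_le_sqrt (Finset.sum_le_sum fun i _ => ?_)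
      refine pow_le_pow_left₀ (norm_nonneg _) ?_ 2
      refine le_trans (le_of_eq ?_)
        (lp.norm_apply_le_norm two_ne_zero (amplify (ohEmb n) m x ω i) α)
      congr 1
      rw [amplify_apply, amplify_apply, lp.coeFn_sum, Finset.sum_apply]
      refine Finset.sum_congr rfl fun k _ => ?_
      rw [ohEmb_apply]
      simp [ω]
    rw [← hω]
    exact key.trans (ContinuousLinearMap.le_of_opNorm_le _ h ω)
  · intro h
    refine ContinuousLinearMap.opNorm_le_bound _ hc fun ω => ?_
    rw [← sq_le_sq₀ (norm_nonneg _) (by positivity), mul_pow, PiLp.norm_sq_eq_of_L2,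
      PiLp.norm_sq_eq_of_L2]
    have h1 := hasSum_sum fun (i : Fin m) (_ : i ∈ Finset.univ) =>
      hasSum_norm_sq (amplify (ohEmb n) m x ω i)
    have h2 := (hasSum_sum fun (i : Fin m) (_ : i ∈ Finset.univ) => hasSum_norm_sq (ω i)).mul_left
      (c ^ 2)
    refine hasSum_le (fun α => ?_) h1 h2
    let ζ : PiLp 2 fun _ : Fin m => EuclideanSpace ℂ (Fin α.1) := WithLp.toLp 2 fun k => ω k α
    have h3 := ContinuousLinearMap.le_of_opNorm_le _ (h α) ζ
    rw [← sq_le_sq₀ (norm_nonneg _) (by positivity), mul_pow, PiLp.norm_sq_eq_of_L2,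
      PiLp.norm_sq_eq_of_L2] at h3
    refine le_trans (le_of_eq ?_) h3
    refine Finset.sum_congr rfl fun i _ => ?_
    rw [amplify_apply, amplify_apply, lp.coeFn_sum, Finset.sum_apply]
    rfl

/-- Each block pairs x with a contractive y, so Cauchy–Schwarz gives the estimate from above. If s >
0 is the least bound of Φ_x, the block of y = x / √s gives s ≤ √s c, that is s ≤ c². -/
theorem norm_amplify_ohEmb_le_iff_hsBound {m : ℕ} {c : ℝ} (hc : 0 ≤ c)
    (x : Matrix (Fin m) (Fin m) (EuclideanSpace ℂ (Fin n))) :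
    ‖amplify (ohEmb n) m x‖ ≤ c ↔ HSBound (coords x) (fun l => (coords x l)ᴴ) (c ^ 2) := by
  rw [norm_amplify_ohEmb_le_iff hc]
  simp only [norm_amplify_conjEmb_le_iff hc]
  constructor
  · intro h
    obtain ⟨s, hs0, hs, hmin⟩ := exists_least_hsBound (coords x) fun l => (coords x l)ᴴ
    refine hs.mono ?_
    rcases hs0.eq_or_lt with rfl | hs0
    · positivity
    have hr : 0 < √s := Real.sqrt_pos.2 hs0
    have hy : HSBound ((((√s)⁻¹ : ℝ) : ℂ) • coords x)
        (fun l => (((((√s)⁻¹ : ℝ) : ℂ) • coords x) l)ᴴ) 1 := by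
      have h1 := hs.smul_smul (((√s)⁻¹ : ℝ) : ℂ) (((√s)⁻¹ : ℝ) : ℂ)
      convert! h1 using 1
      · funext l
        simp
      · rw [Complex.norm_real, Real.norm_of_nonneg (by positivity), ← mul_inv,
          Real.mul_self_sqrt hs0.le, inv_mul_cancel₀ hs0.ne']
    have h2 := (h ⟨m, _, hy⟩).smul_smul 1 ((√s : ℝ) : ℂ)
    have h3 : HSBound (coords x) (fun l => (coords x l)ᴴ) (√s * c) := by
      convert! h2 using 1
      · simp
      · funext l
        simp [smul_smul, hr.ne']
      · simp [abs_of_pos hr]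
    have h4 := hmin _ (by positivity) h3
    have h5 : √s ≤ c := by
      have : √s * √s ≤ √s * c := by rwa [Real.mul_self_sqrt hs0.le]
      exact le_of_mul_le_mul_left this hr
    calc s = √s ^ 2 := (Real.sq_sqrt hs0.le).symm
      _ ≤ c ^ 2 := by gcongr
  · intro h α
    simpa [Real.sqrt_sq hc] using h.cauchy_schwarz (by positivity) zero_le_one α.2.2

variable (n) in
/-- A realization of `OH_n`. -/
noncomputable def ohIsometry : EuclideanSpace ℂ (Fin n) →ₗᵢ[ℂ] (OHSpace n →L[ℂ] OHSpace n) where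
  toLinearMap := ohEmb n
  norm_map' v := by
    refine le_antisymm ?_ ?_
    · rw [norm_apply_eq_norm_amplify_one, norm_amplify_ohEmb_le_iff_hsBound (norm_nonneg _)]
      exact hsBound_coords_single v
    · have h := (norm_amplify_ohEmb_le_iff_hsBound (norm_nonneg _) _).1
        (norm_apply_eq_norm_amplify_one (ohEmb n) v).ge
      exact (sq_le_sq₀ (norm_nonneg _) (norm_nonneg _)).1 (norm_sq_le_of_hsBound_coords_single h)

/-- The unit ball of the space consists of the contractive tuples, which are also the blocks of the
direct sum. Up to the order of the two factors, the dual norm and the norm are therefore suprema of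
the same quantities. -/
theorem isOH_ohIsometry : IsOH (ohIsometry n) := by
  intro m x
  have key : ∀ c : ℝ, 0 ≤ c →
      (dualMatNorm (opMatNorm (ohEmb n)) m
        (x.map (InnerProductSpace.toDual ℂ (EuclideanSpace ℂ (Fin n)))) ≤ ENNReal.ofReal c ↔
      opMatNorm (ohEmb n) m x ≤ ENNReal.ofReal c) := by
    intro c hc
    rw [dualMatNorm_le_iff _ hc, opMatNorm, ← ofReal_norm, ENNReal.ofReal_le_ofReal_iff hc,
      norm_amplify_ohEmb_le_iff hc]
    simp only [norm_amplify_conjEmb_le_iff hc, norm_amplify_ohEmb_le_iff_hsBound zero_le_one,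
      one_pow]
    constructor
    · intro h α
      refine HSBound.swap ?_
      let y : Matrix (Fin α.1) (Fin α.1) (EuclideanSpace ℂ (Fin n)) :=
        Matrix.of fun s t => WithLp.toLp 2 fun l => α.2.1 l s t
      exact h α.1 y α.2.2
    · intro h p y hy
      exact HSBound.swap (h ⟨p, coords y, hy⟩)
  change dualMatNorm (opMatNorm (ohEmb n)) m _ = opMatNorm (ohEmb n) m x
  have hfin : opMatNorm (ohEmb n) m x = ENNReal.ofReal ‖amplify (ohEmb n) m x‖ :=
    (ofReal_norm _).symm
  refine le_antisymm ?_ ?_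
  · rw [hfin]
    exact (key _ (norm_nonneg _)).2 hfin.le
  · refine le_of_forall_ge fun b hb => ?_
    rcases eq_or_ne b ∞ with rfl | hb'
    · exact le_top
    · rw [← ENNReal.ofReal_toReal hb'] at hb ⊢
      exact (key _ ENNReal.toReal_nonneg).1 hb

end ExistenceOH

end OpInterp

namespace OpInterp

/-! ### Hilbert tensor products and matrices over B(H) as tuples of operators -/

section TensorVectors

open scoped InnerProductSpace

variable {n m : ℕ} {K L H : Type*} [NormedAddCommGroup K] [InnerProductSpace ℂ K]
  [NormedAddCommGroup L] [InnerProductSpace ℂ L] [NormedAddCommGroup H] [InnerProductSpace ℂ H]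

/-- The elementary tensor `k ⊗ g`, for `g = (g i)_i` in the Hilbert sum `H^m`, as an element of the
Hilbert sum `(K ⊗ H)^m`. -/
noncomputable def tensVec (k : K) (g : PiLp 2 fun _ : Fin m => H) :
    PiLp 2 fun _ : Fin m => HilbertTensor K H :=
  WithLp.toLp 2 fun i => ((k ⊗ₜ[ℂ] g i : K ⊗[ℂ] H) : HilbertTensor K H)

theorem tensVec_apply (k : K) (g : PiLp 2 fun _ : Fin m => H) (i : Fin m) :
    tensVec k g i = ((k ⊗ₜ[ℂ] g i : K ⊗[ℂ] H) : HilbertTensor K H) := rfl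

theorem inner_tensVec (k k' : K) (g g' : PiLp 2 fun _ : Fin m => H) :
    ⟪tensVec k g, tensVec k' g'⟫_ℂ = ⟪k, k'⟫_ℂ * ⟪g, g'⟫_ℂ := by
  simp only [PiLp.inner_apply, tensVec_apply, UniformSpace.Completion.inner_coe,
    TensorProduct.inner_tmul, Finset.mul_sum]

theorem tensVec_smul_left (c : ℂ) (k : K) (g : PiLp 2 fun _ : Fin m => H) :
    tensVec (c • k) g = c • tensVec k g := by
  ext i
  rw [PiLp.smul_apply, tensVec_apply, tensVec_apply, ← TensorProduct.smul_tmul',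
    UniformSpace.Completion.coe_smul]

theorem tensVec_smul_right (c : ℂ) (k : K) (g : PiLp 2 fun _ : Fin m => H) :
    tensVec k (c • g) = c • tensVec k g := by
  ext i
  simp [tensVec_apply, TensorProduct.tmul_smul, UniformSpace.Completion.coe_smul]

theorem tensVec_add_left (k k' : K) (g : PiLp 2 fun _ : Fin m => H) :
    tensVec (k + k') g = tensVec k g + tensVec k' g := by
  ext i
  simp [tensVec_apply, TensorProduct.add_tmul, UniformSpace.Completion.coe_add]

theorem tensVec_add_right (k : K) (g g' : PiLp 2 fun _ : Fin m => H) :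
    tensVec k (g + g') = tensVec k g + tensVec k g' := by
  ext i
  simp [tensVec_apply, TensorProduct.tmul_add, UniformSpace.Completion.coe_add]

/-- `tensVec` as a bilinear map. -/
noncomputable def tensVecₗ :
    K →ₗ[ℂ] (PiLp 2 fun _ : Fin m => H) →ₗ[ℂ] PiLp 2 fun _ : Fin m => HilbertTensor K H :=
  LinearMap.mk₂ ℂ tensVec tensVec_add_left tensVec_smul_left tensVec_add_right tensVec_smul_right

theorem tensVec_sum_left {ι : Type*} (s : Finset ι) (k : ι → K) (g : PiLp 2 fun _ : Fin m => H) :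
    tensVec (∑ i ∈ s, k i) g = ∑ i ∈ s, tensVec (k i) g := by
  exact map_sum ((tensVecₗ (K := K) (H := H) (m := m)).flip g) k s

theorem tensVec_sum_right {ι : Type*} (s : Finset ι) (k : K) (g : ι → PiLp 2 fun _ : Fin m => H) :
    tensVec k (∑ i ∈ s, g i) = ∑ i ∈ s, tensVec k (g i) :=
  map_sum (tensVecₗ k) g s

variable (K H m) in
/-- The span of the elementary tensors. -/
noncomputable def tensSpan : Submodule ℂ (PiLp 2 fun _ : Fin m => HilbertTensor K H) :=
  Submodule.span ℂ (Set.range fun x : K × (PiLp 2 fun _ : Fin m => H) => tensVec x.1 x.2)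

theorem tensVec_mem_tensSpan (k : K) (g : PiLp 2 fun _ : Fin m => H) :
    tensVec k g ∈ tensSpan m K H :=
  Submodule.subset_span ⟨(k, g), rfl⟩

/-- Lets all norms on the completed tensor product be computed on finite sums of elementary tensors.
-/
theorem dense_tensSpan : Dense (tensSpan m K H : Set (PiLp 2 fun _ : Fin m => HilbertTensor K H)) := by
  have hmem : ∀ t : Fin m → K ⊗[ℂ] H,
      (WithLp.toLp 2 fun i => (t i : HilbertTensor K H)) ∈ tensSpan m K H := by
    intro t
    have h1 : (WithLp.toLp 2 fun i => (t i : HilbertTensor K H))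
        = ∑ i, PiLp.single 2 i (t i : HilbertTensor K H) := by
      ext i
      simp [Pi.single_apply, WithLp.ofLp_sum]
    rw [h1]
    refine Submodule.sum_mem _ fun i _ => ?_
    induction t i using TensorProduct.induction_on with
    | zero =>
      have h0 : ((0 : K ⊗[ℂ] H) : HilbertTensor K H) = 0 := UniformSpace.Completion.coe_zero
      rw [h0, (PiLp.single_eq_zero_iff 2 i).2 rfl]
      exact Submodule.zero_mem _
    | tmul k h =>
      have : PiLp.single 2 i ((k ⊗ₜ[ℂ] h : K ⊗[ℂ] H) : HilbertTensor K H)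
          = tensVec k (PiLp.single 2 i h) := by
        ext q
        rcases eq_or_ne q i with rfl | hq
        · simp [tensVec_apply]
        · simp [tensVec_apply, hq, UniformSpace.Completion.coe_zero]
      rw [this]
      exact tensVec_mem_tensSpan _ _
    | add x y hx hy =>
      rw [UniformSpace.Completion.coe_add, PiLp.single_add]
      exact Submodule.add_mem _ hx hy
  have hd : DenseRange fun t : Fin m → K ⊗[ℂ] H =>
      (WithLp.toLp 2 fun i => (t i : HilbertTensor K H)) := by
    have h1 : DenseRange (Pi.map fun (_ : Fin m) (x : K ⊗[ℂ] H) => (x : HilbertTensor K H)) :=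
      DenseRange.piMap fun _ => UniformSpace.Completion.denseRange_coe
    exact (PiLp.homeomorph 2 fun _ : Fin m => HilbertTensor K H).symm.surjective.denseRange.comp h1
      (PiLp.homeomorph 2 fun _ : Fin m => HilbertTensor K H).symm.continuous
  exact hd.mono (by rintro _ ⟨t, rfl⟩; exact hmem t)

theorem opNorm_le_of_tensSpan {E : Type*} [NormedAddCommGroup E] [NormedSpace ℂ E]
    (A : (PiLp 2 fun _ : Fin m => HilbertTensor K H) →L[ℂ] E) {c : ℝ} (hc : 0 ≤ c)
    (h : ∀ ω ∈ tensSpan m K H, ‖A ω‖ ≤ c * ‖ω‖) : ‖A‖ ≤ c := by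
  refine A.opNorm_le_bound hc fun ω => ?_
  have hcl : IsClosed {ω | ‖A ω‖ ≤ c * ‖ω‖} := isClosed_le (by fun_prop) (by fun_prop)
  exact hcl.closure_subset_iff.2 h (dense_tensSpan ω)

variable (H) in
/-- The coordinates of an element of `ℓ₂^n ⊗ B(H)`. -/
noncomputable def tensCoord (l : Fin n) :
    (EuclideanSpace ℂ (Fin n) ⊗[ℂ] (H →L[ℂ] H)) →ₗ[ℂ] (H →L[ℂ] H) :=
  TensorProduct.lift (LinearMap.lsmul ℂ (H →L[ℂ] H) ∘ₗ
    (EuclideanSpace.proj l : EuclideanSpace ℂ (Fin n) →L[ℂ] ℂ).toLinearMap)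

theorem tensCoord_tmul (l : Fin n) (v : EuclideanSpace ℂ (Fin n)) (b : H →L[ℂ] H) :
    tensCoord H l (v ⊗ₜ b) = v l • b := by
  simp [tensCoord]

theorem sum_single_tmul_tensCoord (t : EuclideanSpace ℂ (Fin n) ⊗[ℂ] (H →L[ℂ] H)) :
    ∑ l, EuclideanSpace.single l (1 : ℂ) ⊗ₜ[ℂ] tensCoord H l t = t := by
  induction t using TensorProduct.induction_on with
  | zero => simp
  | tmul v b =>
    simp only [tensCoord_tmul, TensorProduct.tmul_smul, TensorProduct.smul_tmul']
    rw [← TensorProduct.sum_tmul]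
    congr 1
    ext i
    simp [WithLp.ofLp_sum, Pi.single_apply]
  | add x y hx hy =>
    simp only [map_add, TensorProduct.tmul_add, Finset.sum_add_distrib, hx, hy]

variable (n m H) in
/-- A matrix with entries in `ℓ₂^n ⊗ B(H)` as a tuple of operators on `H^m`. -/
noncomputable def tuple :
    Matrix (Fin m) (Fin m) (EuclideanSpace ℂ (Fin n) ⊗[ℂ] (H →L[ℂ] H)) →ₗ[ℂ]
      (Fin n → ((PiLp 2 fun _ : Fin m => H) →L[ℂ] (PiLp 2 fun _ : Fin m => H))) :=
  LinearMap.pi fun l => amplify LinearMap.id m ∘ₗ (tensCoord H l).mapMatrix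

theorem tuple_apply_apply (X : Matrix (Fin m) (Fin m) (EuclideanSpace ℂ (Fin n) ⊗[ℂ] (H →L[ℂ] H)))
    (l : Fin n) (g : PiLp 2 fun _ : Fin m => H) (i : Fin m) :
    tuple n m H X l g i = ∑ k, tensCoord H l (X i k) (g k) := by
  simp [tuple, amplify_apply]

theorem minEmb_id_apply_tmul (j : EuclideanSpace ℂ (Fin n) →ₗ[ℂ] (K →L[ℂ] L))
    (t : EuclideanSpace ℂ (Fin n) ⊗[ℂ] (H →L[ℂ] H)) (k : K) (h : H) :
    minEmb j LinearMap.id t ((k ⊗ₜ[ℂ] h : K ⊗[ℂ] H) : HilbertTensor K H)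
      = ∑ l, ((j (EuclideanSpace.single l 1) k ⊗ₜ[ℂ] tensCoord H l t h : L ⊗[ℂ] H) :
          HilbertTensor L H) := by
  conv_lhs => rw [← sum_single_tmul_tensCoord t]
  rw [map_sum, sum_apply]
  refine Finset.sum_congr rfl fun l _ => ?_
  rw [minEmb_tmul, opTmul_coe_tmul]
  rfl

theorem amplify_minEmb_tensVec (j : EuclideanSpace ℂ (Fin n) →ₗ[ℂ] (K →L[ℂ] L))
    (X : Matrix (Fin m) (Fin m) (EuclideanSpace ℂ (Fin n) ⊗[ℂ] (H →L[ℂ] H)))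
    (k : K) (g : PiLp 2 fun _ : Fin m => H) :
    amplify (minEmb j LinearMap.id) m X (tensVec k g)
      = ∑ l, tensVec (j (EuclideanSpace.single l 1) k) (tuple n m H X l g) := by
  ext i
  rw [amplify_apply, WithLp.ofLp_sum, Finset.sum_apply]
  simp only [tensVec_apply, minEmb_id_apply_tmul, tuple_apply_apply, TensorProduct.tmul_sum]
  rw [Finset.sum_comm]
  refine Finset.sum_congr rfl fun l _ => ?_
  exact (map_sum (UniformSpace.Completion.toComplL (𝕜 := ℂ) (E := L ⊗[ℂ] H)) _ _).symm

theorem tuple_injective : Function.Injective (tuple n m H) := by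
  intro X Y h
  ext i k
  rw [← sum_single_tmul_tensCoord (X i k), ← sum_single_tmul_tensCoord (Y i k)]
  refine Finset.sum_congr rfl fun l _ => ?_
  congr 1
  ext ξ
  have := congrArg (fun a => a l (PiLp.single 2 k ξ) i) h
  simp only [tuple_apply_apply] at this
  rw [Finset.sum_eq_single k, Finset.sum_eq_single k] at this
  · simpa using this
  all_goals simp +contextual [PiLp.single_eq_of_ne]

/-- The operators a_l are cut into blocks by the coordinate embeddings and projections of H^m. -/
theorem tuple_surjective : Function.Surjective (tuple n m H) := by
  intro a
  let s : Fin m → H →L[ℂ] PiLp 2 fun _ : Fin m => H := fun k =>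
    (PiLp.continuousLinearEquiv 2 ℂ fun _ : Fin m => H).symm.toContinuousLinearMap ∘L
      ContinuousLinearMap.single ℂ (fun _ : Fin m => H) k
  refine ⟨Matrix.of fun i k => ∑ l, EuclideanSpace.single l (1 : ℂ) ⊗ₜ[ℂ]
    (PiLp.proj 2 (fun _ : Fin m => H) i ∘L a l ∘L s k), ?_⟩
  funext l
  ext g i
  rw [tuple_apply_apply]
  have hg : g = ∑ k, s k (g k) := by
    ext i
    simp [s, WithLp.ofLp_sum, Pi.single_apply]
  conv_rhs => rw [hg, map_sum, WithLp.ofLp_sum, Finset.sum_apply]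
  refine Finset.sum_congr rfl fun k _ => ?_
  simp [tensCoord_tmul]

end TensorVectors

end OpInterp

namespace OpInterp

/-! ### Row and column norms of a tuple -/

section RowColumn

open scoped InnerProductSpace

variable {n m : ℕ} {G : Type*} [NormedAddCommGroup G] [InnerProductSpace ℂ G]

/-- The operator `(w l)_l ↦ ∑ l, a l (w l)`. -/
noncomputable def rowOp : (Fin n → (G →L[ℂ] G)) →ₗ[ℂ] ((PiLp 2 fun _ : Fin n => G) →L[ℂ] G) where
  toFun a := ∑ l, a l ∘L PiLp.proj 2 (fun _ : Fin n => G) l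
  map_add' a b := by
    ext w
    simp [Finset.sum_add_distrib]
  map_smul' c a := by
    ext w
    simp [Finset.smul_sum]

theorem rowOp_apply (a : Fin n → (G →L[ℂ] G)) (w : PiLp 2 fun _ : Fin n => G) :
    rowOp a w = ∑ l, a l (w l) := by
  simp [rowOp]

/-- The operator `g ↦ (a l g)_l`. -/
noncomputable def colOp : (Fin n → (G →L[ℂ] G)) →ₗ[ℂ] (G →L[ℂ] (PiLp 2 fun _ : Fin n => G)) where
  toFun a := ((PiLp.continuousLinearEquiv 2 ℂ (fun _ : Fin n => G)).symm :
      (Fin n → G) →L[ℂ] PiLp 2 (fun _ : Fin n => G)) ∘L ContinuousLinearMap.pi a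
  map_add' a b := by
    ext w i
    simp
  map_smul' c a := by
    ext w i
    simp

theorem colOp_apply (a : Fin n → (G →L[ℂ] G)) (g : G) (l : Fin n) :
    colOp a g l = a l g := by
  simp [colOp]

theorem norm_apply_le_norm_rowOp (a : Fin n → (G →L[ℂ] G)) (l : Fin n) : ‖a l‖ ≤ ‖rowOp a‖ := by
  classical
  refine ContinuousLinearMap.opNorm_le_bound _ (ContinuousLinearMap.opNorm_nonneg _) fun g => ?_
  have := (rowOp a).le_opNorm (PiLp.single 2 l g)
  rw [rowOp_apply, Finset.sum_eq_single l] at this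
  · simpa using this
  · intro b _ hb
    simp [hb]
  · simp

theorem norm_apply_le_norm_colOp (a : Fin n → (G →L[ℂ] G)) (l : Fin n) : ‖a l‖ ≤ ‖colOp a‖ := by
  refine ContinuousLinearMap.opNorm_le_bound _ (ContinuousLinearMap.opNorm_nonneg _) fun g => ?_
  have := (colOp a).le_opNorm g
  refine le_trans ?_ this
  rw [← colOp_apply]
  exact PiLp.norm_apply_le _ l

theorem norm_rowOp_le_sqrt_mul (a : Fin n → (G →L[ℂ] G)) {c : ℝ} (hc : 0 ≤ c) (h : ∀ l, ‖a l‖ ≤ c) :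
    ‖rowOp a‖ ≤ √n * c := by
  refine ContinuousLinearMap.opNorm_le_bound _ (by positivity) fun w => ?_
  rw [rowOp_apply]
  calc ‖∑ l, a l (w l)‖ ≤ ∑ l, c * ‖w l‖ :=
        (norm_sum_le _ _).trans (Finset.sum_le_sum fun l _ => (a l).le_of_opNorm_le (h l) _)
    _ ≤ √(∑ _l : Fin n, c ^ 2) * √(∑ l, ‖w l‖ ^ 2) := Real.sum_mul_le_sqrt_mul_sqrt _ _ _
    _ = √n * c * ‖w‖ := by
        rw [PiLp.norm_eq_of_L2]
        simp [Real.sqrt_sq hc]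

theorem norm_colOp_le_sqrt_mul (a : Fin n → (G →L[ℂ] G)) {c : ℝ} (hc : 0 ≤ c) (h : ∀ l, ‖a l‖ ≤ c) :
    ‖colOp a‖ ≤ √n * c := by
  refine ContinuousLinearMap.opNorm_le_bound _ (by positivity) fun g => ?_
  rw [PiLp.norm_eq_of_L2]
  calc √(∑ l, ‖colOp a g l‖ ^ 2) ≤ √(∑ _l : Fin n, (c * ‖g‖) ^ 2) := by
        refine Real.sqrt_le_sqrt (Finset.sum_le_sum fun l _ => ?_)
        rw [colOp_apply]
        exact pow_le_pow_left₀ (norm_nonneg _) ((a l).le_of_opNorm_le (h l) _) 2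
    _ = √n * c * ‖g‖ := by
        simp [Real.sqrt_sq (mul_nonneg hc (norm_nonneg g)), mul_assoc]

end RowColumn

/-! ### The minimal tensor products of R_n and C_n with B(H) -/

section MinTensorNorms

open scoped InnerProductSpace

variable {n m : ℕ} {K H : Type*} [NormedAddCommGroup K] [InnerProductSpace ℂ K]
  [NormedAddCommGroup H] [InnerProductSpace ℂ H]

/-- The isometric map from `(H^m)^n` to `(ℓ₂^n ⊗ H)^m`. -/
noncomputable def sumTensVec (w : PiLp 2 fun _ : Fin n => PiLp 2 fun _ : Fin m => H) :
    PiLp 2 fun _ : Fin m => HilbertTensor (EuclideanSpace ℂ (Fin n)) H :=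
  ∑ l, tensVec (EuclideanSpace.single l (1 : ℂ)) (w l)

theorem norm_sq_sum_tensVec {d : ℕ} (k : Fin d → K) (g : Fin d → PiLp 2 fun _ : Fin m => H)
    (hk : Orthonormal ℂ k) : ‖∑ s, tensVec (k s) (g s)‖ ^ 2 = ∑ s, ‖g s‖ ^ 2 := by
  have h : ⟪∑ s, tensVec (k s) (g s), ∑ s, tensVec (k s) (g s)⟫_ℂ = ∑ s, ⟪g s, g s⟫_ℂ := by
    rw [sum_inner]
    simp only [inner_sum, inner_tensVec, orthonormal_iff_ite.1 hk, ite_mul, one_mul, zero_mul,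
      Finset.sum_ite_eq, Finset.mem_univ, if_true]
  simp only [inner_self_eq_norm_sq_to_K] at h
  exact_mod_cast h

theorem norm_sumTensVec (w : PiLp 2 fun _ : Fin n => PiLp 2 fun _ : Fin m => H) :
    ‖sumTensVec w‖ = ‖w‖ := by
  rw [← sq_eq_sq₀ (norm_nonneg _) (norm_nonneg _), sumTensVec,
    norm_sq_sum_tensVec _ _ EuclideanSpace.orthonormal_single,
    PiLp.norm_sq_eq_of_L2]

theorem exists_sumTensVec {ω : PiLp 2 fun _ : Fin m => HilbertTensor (EuclideanSpace ℂ (Fin n)) H}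
    (hω : ω ∈ tensSpan m (EuclideanSpace ℂ (Fin n)) H) : ∃ w, sumTensVec w = ω := by
  induction hω using Submodule.span_induction with
  | mem x hx =>
    obtain ⟨⟨k, g⟩, rfl⟩ := hx
    refine ⟨WithLp.toLp 2 fun l => k l • g, ?_⟩
    simp only [sumTensVec, tensVec_smul_right, ← tensVec_smul_left]
    rw [← tensVec_sum_left]
    congr 1
    ext i
    simp [WithLp.ofLp_sum, Pi.single_apply]
  | zero =>
    refine ⟨0, Finset.sum_eq_zero fun l _ => ?_⟩
    rw [PiLp.zero_apply, ← zero_smul ℂ (0 : PiLp 2 fun _ : Fin m => H), tensVec_smul_right,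
      zero_smul]
  | add x y _ _ hx hy =>
    obtain ⟨w, rfl⟩ := hx
    obtain ⟨w', rfl⟩ := hy
    exact ⟨w + w', by simp [sumTensVec, tensVec_add_right, Finset.sum_add_distrib]⟩
  | smul c x _ hx =>
    obtain ⟨w, rfl⟩ := hx
    exact ⟨c • w, by simp [sumTensVec, tensVec_smul_right, Finset.smul_sum]⟩

theorem norm_tensVec (k : K) (g : PiLp 2 fun _ : Fin m => H) : ‖tensVec k g‖ = ‖k‖ * ‖g‖ := by
  have h := inner_tensVec k k g g
  simp only [inner_self_eq_norm_sq_to_K] at h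
  have h' : ‖tensVec k g‖ ^ 2 = ‖k‖ ^ 2 * ‖g‖ ^ 2 := by exact_mod_cast h
  rwa [← mul_pow, sq_eq_sq₀ (norm_nonneg _) (by positivity)] at h'

variable (X : Matrix (Fin m) (Fin m) (EuclideanSpace ℂ (Fin n) ⊗[ℂ] (H →L[ℂ] H)))

theorem rowEmb_apply (x y : EuclideanSpace ℂ (Fin n)) : rowEmb n x y = ∑ i, x i * y i := by
  simp [rowEmb, sum_apply]

/-- Under the isometries from (H^m)^n to (ℓ₂^n ⊗ H)^m and from H^m to (ℂ ⊗ H)^m, the operator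
becomes the row of the tuple. -/
theorem amplify_rowEmb_sumTensVec (w : PiLp 2 fun _ : Fin n => PiLp 2 fun _ : Fin m => H) :
    amplify (minEmb (rowEmb n) LinearMap.id) m X (sumTensVec w)
      = tensVec (1 : ℂ) (rowOp (tuple n m H X) w) := by
  rw [sumTensVec, map_sum, rowOp_apply, tensVec_sum_right]
  refine Finset.sum_congr rfl fun l _ => ?_
  rw [amplify_minEmb_tensVec, Finset.sum_eq_single l]
  · congr 1
    simp [rowEmb_apply]
  · intro q _ hq
    have : rowEmb n (EuclideanSpace.single q 1) (EuclideanSpace.single l 1) = 0 := by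
      simp [rowEmb_apply, hq.symm]
    rw [this, ← zero_smul ℂ (0 : ℂ), tensVec_smul_left, zero_smul]
  · simp

/-- The norm of `M_m(R_n ⊗ B(H))`. -/
theorem norm_amplify_rowEmb :
    ‖amplify (minEmb (rowEmb n) LinearMap.id) m X‖ = ‖rowOp (tuple n m H X)‖ := by
  have key : ∀ w, ‖amplify (minEmb (rowEmb n) LinearMap.id) m X (sumTensVec w)‖
      = ‖rowOp (tuple n m H X) w‖ := fun w => by
    rw [amplify_rowEmb_sumTensVec, norm_tensVec, norm_one, one_mul]
  refine le_antisymm ?_ ?_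
  · refine opNorm_le_of_tensSpan _ (ContinuousLinearMap.opNorm_nonneg _) fun ω hω => ?_
    obtain ⟨w, rfl⟩ := exists_sumTensVec hω
    rw [key, norm_sumTensVec]
    exact ContinuousLinearMap.le_opNorm _ _
  · refine ContinuousLinearMap.opNorm_le_bound _ (ContinuousLinearMap.opNorm_nonneg _) fun w => ?_
    rw [← key, ← norm_sumTensVec]
    exact ContinuousLinearMap.le_opNorm _ _

theorem amplify_colEmb_tensVec (g : PiLp 2 fun _ : Fin m => H) :
    amplify (minEmb (colEmb n) LinearMap.id) m X (tensVec (1 : ℂ) g)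
      = sumTensVec (colOp (tuple n m H X) g) := by
  rw [amplify_minEmb_tensVec, sumTensVec]
  refine Finset.sum_congr rfl fun l _ => ?_
  rw [colOp_apply]
  congr 1
  simp [colEmb]

/-- The norm of `M_m(C_n ⊗ B(H))`. -/
theorem norm_amplify_colEmb :
    ‖amplify (minEmb (colEmb n) LinearMap.id) m X‖ = ‖colOp (tuple n m H X)‖ := by
  have key : ∀ g, ‖amplify (minEmb (colEmb n) LinearMap.id) m X (tensVec (1 : ℂ) g)‖
      = ‖colOp (tuple n m H X) g‖ := fun g => by
    rw [amplify_colEmb_tensVec, norm_sumTensVec]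
  have hn : ∀ g : PiLp 2 fun _ : Fin m => H, ‖tensVec (1 : ℂ) g‖ = ‖g‖ := fun g => by
    rw [norm_tensVec, norm_one, one_mul]
  have hspan : ∀ ω ∈ tensSpan m ℂ H, ∃ g, tensVec (1 : ℂ) g = ω := by
    intro ω hω
    induction hω using Submodule.span_induction with
    | mem x hx =>
      obtain ⟨⟨k, g⟩, rfl⟩ := hx
      exact ⟨k • g, by rw [tensVec_smul_right, ← tensVec_smul_left, smul_eq_mul, mul_one]⟩
    | zero => exact ⟨0, by rw [← zero_smul ℂ (0 : PiLp 2 fun _ : Fin m => H), tensVec_smul_right,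
        zero_smul]⟩
    | add x y _ _ hx hy =>
      obtain ⟨w, rfl⟩ := hx
      obtain ⟨w', rfl⟩ := hy
      exact ⟨w + w', tensVec_add_right _ _ _⟩
    | smul c x _ hx =>
      obtain ⟨w, rfl⟩ := hx
      exact ⟨c • w, tensVec_smul_right _ _ _⟩
  refine le_antisymm ?_ ?_
  · refine opNorm_le_of_tensSpan _ (ContinuousLinearMap.opNorm_nonneg _) fun ω hω => ?_
    obtain ⟨w, rfl⟩ := hspan ω hω
    rw [key, hn]
    exact ContinuousLinearMap.le_opNorm _ _
  · refine ContinuousLinearMap.opNorm_le_bound _ (ContinuousLinearMap.opNorm_nonneg _) fun w => ?_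
    rw [← key, ← hn w]
    exact ContinuousLinearMap.le_opNorm _ _

end MinTensorNorms

/-! ### Minimal tensor norms through finite-dimensional compressions -/

section Compression

open scoped InnerProductSpace

variable {n m : ℕ}

/-- The matrix of the compression of an operator to an orthonormal family. -/
noncomputable def compMat {G : Type*} [NormedAddCommGroup G] [InnerProductSpace ℂ G] {d : ℕ}
    (v : Fin d → G) (A : G →L[ℂ] G) : Matrix (Fin d) (Fin d) ℂ :=
  Matrix.of fun s t => ⟪v s, A (v t)⟫_ℂ

/-- The compression of a tuple of operators, as a matrix with entries in `ℓ₂^n`. -/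
noncomputable def compTuple {G : Type*} [NormedAddCommGroup G] [InnerProductSpace ℂ G] {d : ℕ}
    (v : Fin d → G) (a : Fin n → (G →L[ℂ] G)) :
    Matrix (Fin d) (Fin d) (EuclideanSpace ℂ (Fin n)) :=
  Matrix.of fun s t => WithLp.toLp 2 fun l => ⟪v s, a l (v t)⟫_ℂ

theorem coords_compTuple {G : Type*} [NormedAddCommGroup G] [InnerProductSpace ℂ G] {d : ℕ}
    (v : Fin d → G) (a : Fin n → (G →L[ℂ] G)) :
    coords (compTuple v a) = fun l => compMat v (a l) := rfl

variable {K L H : Type*} [NormedAddCommGroup K] [InnerProductSpace ℂ K]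
  [NormedAddCommGroup L] [InnerProductSpace ℂ L]
  [NormedAddCommGroup H] [InnerProductSpace ℂ H]

/-- The isometric map from `K^d` to `(K ⊗ H)^m` given by an orthonormal family in `H^m`. -/
noncomputable def frameVec {d : ℕ} (v : Fin d → PiLp 2 fun _ : Fin m => H)
    (k : PiLp 2 fun _ : Fin d => K) : PiLp 2 fun _ : Fin m => HilbertTensor K H :=
  ∑ s, tensVec (k s) (v s)

theorem norm_frameVec {d : ℕ} {v : Fin d → PiLp 2 fun _ : Fin m => H} (hv : Orthonormal ℂ v)
    (k : PiLp 2 fun _ : Fin d => K) : ‖frameVec v k‖ = ‖k‖ := by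
  rw [← sq_eq_sq₀ (norm_nonneg _) (norm_nonneg _), PiLp.norm_sq_eq_of_L2 _ k]
  have h : ⟪frameVec v k, frameVec v k⟫_ℂ = ∑ s, ⟪k s, k s⟫_ℂ := by
    rw [frameVec, sum_inner]
    simp only [inner_sum, inner_tensVec, orthonormal_iff_ite.1 hv, mul_ite, mul_one, mul_zero,
      Finset.sum_ite_eq, Finset.mem_univ, if_true]
  simp only [inner_self_eq_norm_sq_to_K] at h
  exact_mod_cast h

/-- Restricting H^m to the span of an orthonormal family replaces operator coefficients by scalar
matrices, so the matrix norms of `j` control the minimal tensor norm. -/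
theorem inner_frameVec_amplify {d : ℕ} (v : Fin d → PiLp 2 fun _ : Fin m => H)
    (j : EuclideanSpace ℂ (Fin n) →ₗ[ℂ] (K →L[ℂ] L))
    (X : Matrix (Fin m) (Fin m) (EuclideanSpace ℂ (Fin n) ⊗[ℂ] (H →L[ℂ] H)))
    (k : PiLp 2 fun _ : Fin d => K) (k' : PiLp 2 fun _ : Fin d => L) :
    ⟪frameVec v k', amplify (minEmb j LinearMap.id) m X (frameVec v k)⟫_ℂ
      = ⟪k', amplify j d (compTuple v (tuple n m H X)) k⟫_ℂ := by
  have hj : ∀ u : EuclideanSpace ℂ (Fin n), j u = ∑ l, u l • j (EuclideanSpace.single l 1) := by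
    intro u
    conv_lhs => rw [← (EuclideanSpace.basisFun (Fin n) ℂ).sum_repr u]
    simp [map_sum]
  rw [frameVec, frameVec, map_sum, sum_inner, PiLp.inner_apply]
  refine Finset.sum_congr rfl fun s _ => ?_
  rw [amplify_apply, inner_sum, inner_sum]
  refine Finset.sum_congr rfl fun t _ => ?_
  rw [amplify_minEmb_tensVec, inner_sum, hj, sum_apply, inner_sum]
  refine Finset.sum_congr rfl fun l _ => ?_
  rw [inner_tensVec, smul_apply, inner_smul_right, mul_comm]
  rfl

theorem norm_amplify_compTuple_le {d : ℕ} {v : Fin d → PiLp 2 fun _ : Fin m => H}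
    (hv : Orthonormal ℂ v) (j : EuclideanSpace ℂ (Fin n) →ₗ[ℂ] (K →L[ℂ] L))
    (X : Matrix (Fin m) (Fin m) (EuclideanSpace ℂ (Fin n) ⊗[ℂ] (H →L[ℂ] H))) :
    ‖amplify j d (compTuple v (tuple n m H X))‖ ≤ ‖amplify (minEmb j LinearMap.id) m X‖ := by
  refine ContinuousLinearMap.opNorm_le_bound _ (ContinuousLinearMap.opNorm_nonneg _) fun k => ?_
  set B := amplify j d (compTuple v (tuple n m H X))
  have h := norm_inner_le_norm (𝕜 := ℂ) (frameVec v (B k))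
    (amplify (minEmb j LinearMap.id) m X (frameVec v k))
  rw [inner_frameVec_amplify, inner_self_eq_norm_sq_to_K, norm_frameVec hv] at h
  have h2 := (amplify (minEmb j LinearMap.id) m X).le_opNorm (frameVec v k)
  rw [norm_frameVec hv] at h2
  rcases (norm_nonneg (B k)).eq_or_lt with h0 | h0
  · rw [← h0]
    exact mul_nonneg (ContinuousLinearMap.opNorm_nonneg _) (norm_nonneg _)
  · refine le_trans ?_ h2
    rw [norm_pow, RCLike.norm_ofReal, abs_norm, sq] at h
    exact le_of_mul_le_mul_left h h0

/-- The orthonormal basis of a finite-dimensional subspace, as a family of vectors of the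
ambient space. -/
noncomputable def frame {G : Type*} [NormedAddCommGroup G] [InnerProductSpace ℂ G]
    (Q : Submodule ℂ G) [FiniteDimensional ℂ Q] : Fin (Module.finrank ℂ Q) → G :=
  fun s => (stdOrthonormalBasis ℂ Q s : G)

section Frame

variable {G : Type*} [NormedAddCommGroup G] [InnerProductSpace ℂ G]
    (Q : Submodule ℂ G) [FiniteDimensional ℂ Q]

theorem orthonormal_frame : Orthonormal ℂ (frame Q) :=
  (stdOrthonormalBasis ℂ Q).orthonormal.comp_linearIsometry Q.subtypeₗᵢ

variable {Q} in
theorem sum_inner_frame {g : G} (hg : g ∈ Q) : ∑ s, ⟪frame Q s, g⟫_ℂ • frame Q s = g := by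
  have := congrArg (Submodule.subtype Q) ((stdOrthonormalBasis ℂ Q).sum_repr' ⟨g, hg⟩)
  simpa [frame] using this

end Frame

/-- A finite sum of elementary tensors involves finitely many vectors of H^m. All larger Q are
allowed so that two such sums can be expanded in one common frame. -/
theorem exists_frameVec {ω : PiLp 2 fun _ : Fin m => HilbertTensor K H}
    (hω : ω ∈ tensSpan m K H) :
    ∃ Q₀ : Submodule ℂ (PiLp 2 fun _ : Fin m => H), FiniteDimensional ℂ Q₀ ∧
      ∀ (Q : Submodule ℂ (PiLp 2 fun _ : Fin m => H)) [FiniteDimensional ℂ Q], Q₀ ≤ Q →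
        ∃ k, frameVec (frame Q) k = ω := by
  induction hω using Submodule.span_induction with
  | mem x hx =>
    obtain ⟨⟨k, g⟩, rfl⟩ := hx
    refine ⟨ℂ ∙ g, inferInstance, fun Q _ hQ => ?_⟩
    have hg : g ∈ Q := hQ (Submodule.mem_span_singleton_self g)
    refine ⟨WithLp.toLp 2 fun s => ⟪frame Q s, g⟫_ℂ • k, ?_⟩
    simp only [frameVec, tensVec_smul_left, ← tensVec_smul_right]
    rw [← tensVec_sum_right, sum_inner_frame hg]
  | zero =>
    refine ⟨⊥, inferInstance, fun Q _ _ => ⟨0, ?_⟩⟩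
    refine Finset.sum_eq_zero fun s _ => ?_
    rw [PiLp.zero_apply, ← zero_smul ℂ (0 : K), tensVec_smul_left, zero_smul]
  | add x y _ _ hx hy =>
    obtain ⟨P, _, hP⟩ := hx
    obtain ⟨R, _, hR⟩ := hy
    refine ⟨P ⊔ R, inferInstance, fun Q _ hQ => ?_⟩
    obtain ⟨k, rfl⟩ := hP Q (le_sup_left.trans hQ)
    obtain ⟨k', rfl⟩ := hR Q (le_sup_right.trans hQ)
    exact ⟨k + k', by simp [frameVec, tensVec_add_left, Finset.sum_add_distrib]⟩
  | smul c x _ hx =>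
    obtain ⟨P, hPf, hP⟩ := hx
    refine ⟨P, hPf, fun Q _ hQ => ?_⟩
    obtain ⟨k, rfl⟩ := hP Q hQ
    exact ⟨c • k, by simp [frameVec, tensVec_smul_left, Finset.smul_sum]⟩

/-- Two finite sums of tensors lie over a common Q, where their pairing is a matrix coefficient of a
compression. Density extends the second vector to the image of the first. -/
theorem norm_amplify_minEmb_le (j : EuclideanSpace ℂ (Fin n) →ₗ[ℂ] (K →L[ℂ] L))
    (X : Matrix (Fin m) (Fin m) (EuclideanSpace ℂ (Fin n) ⊗[ℂ] (H →L[ℂ] H))) {c : ℝ} (hc : 0 ≤ c)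
    (h : ∀ (Q : Submodule ℂ (PiLp 2 fun _ : Fin m => H)) [FiniteDimensional ℂ Q],
      ‖amplify j _ (compTuple (frame Q) (tuple n m H X))‖ ≤ c) :
    ‖amplify (minEmb j LinearMap.id) m X‖ ≤ c := by
  refine opNorm_le_of_tensSpan _ hc fun ω hω => ?_
  have key : ∀ ω' ∈ tensSpan m L H, ‖⟪ω', amplify (minEmb j LinearMap.id) m X ω⟫_ℂ‖
      ≤ c * ‖ω‖ * ‖ω'‖ := by
    intro ω' hω'
    obtain ⟨P, _, hP⟩ := exists_frameVec hω
    obtain ⟨R, _, hR⟩ := exists_frameVec hω'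
    obtain ⟨k, rfl⟩ := hP (P ⊔ R) le_sup_left
    obtain ⟨k', rfl⟩ := hR (P ⊔ R) le_sup_right
    rw [inner_frameVec_amplify, norm_frameVec (orthonormal_frame _),
      norm_frameVec (orthonormal_frame _), mul_comm]
    exact (norm_inner_le_norm _ _).trans (mul_le_mul_of_nonneg_left
      (ContinuousLinearMap.le_of_opNorm_le _ (h _) _) (norm_nonneg _))
  set ψ := amplify (minEmb j LinearMap.id) m X ω
  have hcl : IsClosed {ω' | ‖⟪ω', ψ⟫_ℂ‖ ≤ c * ‖ω‖ * ‖ω'‖} :=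
    isClosed_le (by fun_prop) (by fun_prop)
  have hψ : ‖⟪ψ, ψ⟫_ℂ‖ ≤ c * ‖ω‖ * ‖ψ‖ := hcl.closure_subset_iff.2 key (dense_tensSpan ψ)
  rw [inner_self_eq_norm_sq_to_K, norm_pow, RCLike.norm_ofReal, abs_norm, sq] at hψ
  rcases (norm_nonneg ψ).eq_or_lt with h0 | h0
  · rw [← h0]; positivity
  · exact le_of_mul_le_mul_right hψ h0

end Compression

end OpInterp

namespace OpInterp

/-! ### Weak operator limits of bounded holomorphic functions -/

section WeakLimits

open scoped InnerProductSpace Topology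
open Filter

variable {I G G' : Type*} [NormedAddCommGroup G] [InnerProductSpace ℂ G]
  [NormedAddCommGroup G'] [InnerProductSpace ℂ G']

theorem opNorm_le_of_inner (A : G →L[ℂ] G') {c : ℝ} (hc : 0 ≤ c)
    (h : ∀ x y, ‖⟪y, A x⟫_ℂ‖ ≤ c * ‖x‖ * ‖y‖) : ‖A‖ ≤ c := by
  refine A.opNorm_le_bound hc fun x => ?_
  have := h x (A x)
  rw [inner_self_eq_norm_sq_to_K, norm_pow, RCLike.norm_ofReal, abs_norm, sq] at this
  rcases (norm_nonneg (A x)).eq_or_lt with h0 | h0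
  · rw [← h0]; positivity
  · exact le_of_mul_le_mul_right this h0

/-- Banach–Alaoglu, through the Riesz identification of the space with its dual. -/
theorem exists_weak_limit [CompleteSpace G'] (𝒰 : Ultrafilter I) {x : I → G'} {C : ℝ}
    (hx : ∀ i, ‖x i‖ ≤ C) : ∃ y : G', ∀ g, Tendsto (fun i => ⟪x i, g⟫_ℂ) 𝒰 (𝓝 ⟪y, g⟫_ℂ) := by
  let u : I → WeakDual ℂ G' := fun i =>
    StrongDual.toWeakDual (InnerProductSpace.toDual ℂ G' (x i))
  have hu : ∀ i, u i ∈ WeakDual.toStrongDual ⁻¹' Metric.closedBall (0 : StrongDual ℂ G') C := by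
    intro i
    rw [Set.mem_preimage, mem_closedBall_zero_iff]
    change ‖InnerProductSpace.toDual ℂ G' (x i)‖ ≤ C
    rw [LinearIsometryEquiv.norm_map]
    exact hx i
  obtain ⟨a, -, ha⟩ := (WeakDual.isCompact_closedBall (0 : StrongDual ℂ G') C).ultrafilter_le_nhds
    (𝒰.map u) (le_principal_iff.2 (Filter.mem_map.2 (Filter.univ_mem' hu)))
  refine ⟨(InnerProductSpace.toDual ℂ G').symm (WeakDual.toStrongDual a), fun g => ?_⟩
  rw [InnerProductSpace.toDual_symm_apply]
  have h1 : Tendsto u 𝒰 (𝓝 a) := ha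
  exact ((WeakDual.eval_continuous g).tendsto a).comp h1

/-- `A` is the limit of the operators `u i` in the weak operator topology. -/
def WeakLim (l : Filter I) (u : I → G →L[ℂ] G') (A : G →L[ℂ] G') : Prop :=
  ∀ x y, Tendsto (fun i => ⟪y, u i x⟫_ℂ) l (𝓝 ⟪y, A x⟫_ℂ)

theorem exists_weakLim [CompleteSpace G'] (𝒰 : Ultrafilter I) {u : I → G →L[ℂ] G'} {C : ℝ}
    (hC : 0 ≤ C) (hu : ∀ i, ‖u i‖ ≤ C) : ∃ A, WeakLim (𝒰 : Filter I) u A := by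
  have h1 : ∀ x, ∃ y : G', ∀ g, Tendsto (fun i => ⟪u i x, g⟫_ℂ) 𝒰 (𝓝 ⟪y, g⟫_ℂ) := fun x =>
    exists_weak_limit 𝒰 fun i => (u i).le_of_opNorm_le (hu i) x
  choose A hA using h1
  let A' : G →ₗ[ℂ] G' :=
    { toFun := A
      map_add' := fun x y => ext_inner_right ℂ fun g => tendsto_nhds_unique (hA (x + y) g) (by
        simpa only [map_add, inner_add_left] using (hA x g).add (hA y g))
      map_smul' := fun c x => ext_inner_right ℂ fun g => tendsto_nhds_unique (hA (c • x) g) (by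
        simpa only [map_smul, inner_smul_left, RingHom.id_apply] using
          (hA x g).const_mul (starRingEnd ℂ c)) }
  have hbound : ∀ x, ‖A' x‖ ≤ C * ‖x‖ := by
    intro x
    have h2 : ‖⟪A x, A x⟫_ℂ‖ ≤ C * ‖x‖ * ‖A x‖ :=
      le_of_tendsto (hA x (A x)).norm (Eventually.of_forall fun i =>
        (norm_inner_le_norm _ _).trans
          (mul_le_mul_of_nonneg_right ((u i).le_of_opNorm_le (hu i) x) (norm_nonneg _)))
    rw [inner_self_eq_norm_sq_to_K, norm_pow, RCLike.norm_ofReal, abs_norm, sq] at h2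
    rcases (norm_nonneg (A x)).eq_or_lt with h0 | h0
    · change ‖A x‖ ≤ _
      rw [← h0]; positivity
    · exact le_of_mul_le_mul_right h2 h0
  refine ⟨A'.mkContinuous C hbound, fun x y => ?_⟩
  have h3 := (RCLike.continuous_conj (K := ℂ)).continuousAt.tendsto.comp (hA x y)
  simp only [Function.comp_def, inner_conj_symm] at h3
  exact h3

theorem WeakLim.unique {l : Filter I} [l.NeBot] {u : I → G →L[ℂ] G'} {A B : G →L[ℂ] G'}
    (hA : WeakLim l u A) (hB : WeakLim l u B) : A = B := by
  ext x
  exact ext_inner_left ℂ fun y => tendsto_nhds_unique (hA x y) (hB x y)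

theorem WeakLim.sub {l : Filter I} {u v : I → G →L[ℂ] G'} {A B : G →L[ℂ] G'}
    (hA : WeakLim l u A) (hB : WeakLim l v B) : WeakLim l (fun i => u i - v i) (A - B) :=
  fun x y => by simpa only [sub_apply, inner_sub_right] using (hA x y).sub (hB x y)

theorem WeakLim.smul {l : Filter I} {u : I → G →L[ℂ] G'} {A : G →L[ℂ] G'}
    (hA : WeakLim l u A) (c : ℂ) : WeakLim l (fun i => c • u i) (c • A) :=
  fun x y => by simpa only [smul_apply, inner_smul_right] using (hA x y).const_mul c

theorem WeakLim.norm_le {l : Filter I} [l.NeBot] {u : I → G →L[ℂ] G'} {A : G →L[ℂ] G'}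
    (hA : WeakLim l u A) {c : ℝ} (hc : 0 ≤ c) (hu : ∀ i, ‖u i‖ ≤ c) : ‖A‖ ≤ c := by
  refine opNorm_le_of_inner _ hc fun x y => le_of_tendsto (hA x y).norm
    (Eventually.of_forall fun i => ?_)
  rw [mul_comm]
  exact (norm_inner_le_norm _ _).trans
    (mul_le_mul_of_nonneg_left ((u i).le_of_opNorm_le (hu i) x) (norm_nonneg _))

theorem WeakLim.rowOp {l : Filter I} {n : ℕ} {u : I → Fin n → G →L[ℂ] G} {A : Fin n → G →L[ℂ] G}
    (hA : ∀ q, WeakLim l (fun i => u i q) (A q)) :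
    WeakLim l (fun i => rowOp (u i)) (rowOp A) := fun x y => by
  simp only [rowOp_apply, inner_sum]
  exact tendsto_finsetSum _ fun q _ => hA q (x q) y

theorem WeakLim.colOp {l : Filter I} {n : ℕ} {u : I → Fin n → G →L[ℂ] G} {A : Fin n → G →L[ℂ] G}
    (hA : ∀ q, WeakLim l (fun i => u i q) (A q)) :
    WeakLim l (fun i => colOp (u i)) (colOp A) := fun x y => by
  simp only [PiLp.inner_apply, colOp_apply]
  exact tendsto_finsetSum _ fun q _ => hA q x (y q)

/-- A first-order Taylor estimate from two Schwarz-type bounds, for `f` and then for its difference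
quotient. The constants depend only on C and r, so the estimate survives a weak limit of a whole
family. -/
theorem norm_sub_sub_smul_le {E : Type*} [NormedAddCommGroup E] [NormedSpace ℂ E] [CompleteSpace E]
    {f : ℂ → E} {z₀ : ℂ} {r C : ℝ} (hr : 0 < r) (hf : DifferentiableOn ℂ f (Metric.ball z₀ r))
    (hC : ∀ z ∈ Metric.ball z₀ r, ‖f z‖ ≤ C) :
    ‖dslope f z₀ z₀‖ ≤ 2 * C / r ∧ ∀ z ∈ Metric.ball z₀ r,
      ‖f z - f z₀ - (z - z₀) • dslope f z₀ z₀‖ ≤ 2 * (2 * C / r) / r * ‖z - z₀‖ ^ 2 := by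
  have hz₀ : z₀ ∈ Metric.ball z₀ r := Metric.mem_ball_self hr
  have hmaps : ∀ {g : ℂ → E} {D : ℝ}, (∀ z ∈ Metric.ball z₀ r, ‖g z‖ ≤ D) →
      Set.MapsTo g (Metric.ball z₀ r) (Metric.closedBall (g z₀) (2 * D)) := by
    intro g D hg z hz
    rw [Metric.mem_closedBall, dist_eq_norm]
    have := norm_sub_le (g z) (g z₀)
    linarith [hg z hz, hg z₀ hz₀]
  have h1 : ∀ z ∈ Metric.ball z₀ r, ‖dslope f z₀ z‖ ≤ 2 * C / r := fun z hz =>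
    Complex.norm_dslope_le_div_of_mapsTo_ball hf (hmaps hC) hz
  refine ⟨h1 z₀ hz₀, fun z hz => ?_⟩
  have hd : DifferentiableOn ℂ (dslope f z₀) (Metric.ball z₀ r) :=
    (Complex.differentiableOn_dslope (Metric.ball_mem_nhds z₀ hr)).2 hf
  have h2 := Complex.dist_le_div_mul_dist_of_mapsTo_ball hd (hmaps h1) hz
  rw [dist_eq_norm, dist_eq_norm] at h2
  rw [← sub_smul_dslope f z₀ z, ← smul_sub, norm_smul, mul_comm, sq, ← mul_assoc]
  exact mul_le_mul_of_nonneg_right h2 (norm_nonneg _)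

/-- A weak limit of uniformly bounded holomorphic functions is holomorphic. -/
theorem differentiableOn_of_weakLim [CompleteSpace G'] (𝒰 : Ultrafilter I) {U : Set ℂ}
    (hU : IsOpen U) {f : I → ℂ → G →L[ℂ] G'} {F : ℂ → G →L[ℂ] G'} {C : ℝ} (hC : 0 ≤ C)
    (hf : ∀ i, DifferentiableOn ℂ (f i) U) (hfC : ∀ i, ∀ z ∈ U, ‖f i z‖ ≤ C)
    (hF : ∀ z ∈ U, WeakLim (𝒰 : Filter I) (fun i => f i z) (F z)) : DifferentiableOn ℂ F U := by
  intro z₀ hz₀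
  obtain ⟨r, hr, hrU⟩ := Metric.isOpen_iff.1 hU z₀ hz₀
  have h1 := fun i => norm_sub_sub_smul_le hr ((hf i).mono hrU) fun z hz => hfC i z (hrU hz)
  -- The weak limit of the derivatives at z₀ is the candidate for the derivative of F.
  obtain ⟨D, hD⟩ := exists_weakLim 𝒰 (by positivity) fun i => (h1 i).1
  have h2 : ∀ z ∈ Metric.ball z₀ r,
      ‖F z - F z₀ - (z - z₀) • D‖ ≤ 2 * (2 * C / r) / r * ‖z - z₀‖ ^ 2 := fun z hz =>
    (((hF z (hrU hz)).sub (hF z₀ hz₀)).sub (hD.smul (z - z₀))).norm_le (by positivity)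
      fun i => (h1 i).2 z hz
  have h3 : HasDerivAt F D z₀ := by
    rw [hasDerivAt_iff_isLittleO]
    have hO : (fun z => F z - F z₀ - (z - z₀) • D) =O[𝓝 z₀] fun z => ‖z - z₀‖ ^ 2 :=
      Asymptotics.IsBigO.of_bound (2 * (2 * C / r) / r)
        (Filter.eventually_of_mem (Metric.ball_mem_nhds z₀ hr) fun z hz => by
          simpa using h2 z hz)
    refine hO.trans_isLittleO ?_
    have ho : (fun z : ℂ => ‖z‖ ^ 2) =o[𝓝 0] fun z => z := by
      simpa using (Asymptotics.isLittleO_norm_pow_id (E' := ℂ) one_lt_two)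
    have ht : Tendsto (fun z => z - z₀) (𝓝 z₀) (𝓝 0) := by
      have : Continuous fun z : ℂ => z - z₀ := by fun_prop
      simpa using this.tendsto z₀
    exact ho.comp_tendsto ht
  exact h3.differentiableAt.differentiableWithinAt

end WeakLimits

end OpInterp

namespace OpInterp

/-! ### Passing between operators and matrices along orthonormal families -/

section Frames

open scoped InnerProductSpace Matrix ComplexOrder Matrix.Norms.Frobenius

variable {n : ℕ}

/-- `∑ a l * (a l)ᴴ ≤ c`, in terms of vectors. -/
theorem isRow_iff {d : ℕ} {a : Fin n → Matrix (Fin d) (Fin d) ℂ} {c : ℝ} :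
    IsRow a c ↔ ∀ z : EuclideanSpace ℂ (Fin d),
      ∑ l, ‖Matrix.toEuclideanCLM (n := Fin d) (𝕜 := ℂ) (a l)ᴴ z‖ ^ 2 ≤ c * ‖z‖ ^ 2 := by
  have hq : ∀ z : EuclideanSpace ℂ (Fin d),
      star z.ofLp ⬝ᵥ (((c : ℂ) • (1 : Matrix (Fin d) (Fin d) ℂ) - ∑ l, a l * (a l)ᴴ) *ᵥ z.ofLp)
        = ((c * ‖z‖ ^ 2 - ∑ l, ‖Matrix.toEuclideanCLM (n := Fin d) (𝕜 := ℂ) (a l)ᴴ z‖ ^ 2 : ℝ) : ℂ) := by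
    intro z
    have hn : ∀ y : EuclideanSpace ℂ (Fin d), star y.ofLp ⬝ᵥ y.ofLp = ((‖y‖ ^ 2 : ℝ) : ℂ) := by
      intro y
      have := inner_self_eq_norm_sq_to_K (𝕜 := ℂ) y
      rw [EuclideanSpace.inner_eq_star_dotProduct, dotProduct_comm] at this
      rw [this]
      push_cast
      rfl
    rw [Matrix.sub_mulVec, dotProduct_sub, Matrix.smul_mulVec, Matrix.one_mulVec, dotProduct_smul,
      hn, Matrix.sum_mulVec, dotProduct_sum]
    push_cast
    rw [smul_eq_mul]
    congr 1
    refine Finset.sum_congr rfl fun l _ => ?_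
    have := hn (Matrix.toEuclideanCLM (n := Fin d) (𝕜 := ℂ) (a l)ᴴ z)
    push_cast at this
    rw [← this, Matrix.ofLp_toEuclideanCLM, Matrix.star_mulVec, Matrix.conjTranspose_conjTranspose,
      ← Matrix.mulVec_mulVec, Matrix.dotProduct_mulVec]
  rw [IsRow, Matrix.posSemidef_iff_dotProduct_mulVec]
  constructor
  · rintro ⟨-, h⟩ z
    have := h z.ofLp
    rw [hq] at this
    have h' : (0 : ℝ) ≤ c * ‖z‖ ^ 2
        - ∑ l, ‖Matrix.toEuclideanCLM (n := Fin d) (𝕜 := ℂ) (a l)ᴴ z‖ ^ 2 := by exact_mod_cast this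
    linarith
  · intro h
    refine ⟨?_, fun z => ?_⟩
    · rw [Matrix.IsHermitian, Matrix.conjTranspose_sub, Matrix.conjTranspose_smul,
        Matrix.conjTranspose_one, Matrix.conjTranspose_sum]
      simp [Matrix.conjTranspose_mul]
    · have := hq (WithLp.toLp 2 z)
      change star z ⬝ᵥ _ = _ at this
      rw [this]
      exact_mod_cast sub_nonneg.2 (h (WithLp.toLp 2 z))

theorem isCol_iff {d : ℕ} {a : Fin n → Matrix (Fin d) (Fin d) ℂ} {c : ℝ} :
    IsCol a c ↔ ∀ z : EuclideanSpace ℂ (Fin d),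
      ∑ l, ‖Matrix.toEuclideanCLM (n := Fin d) (𝕜 := ℂ) (a l) z‖ ^ 2 ≤ c * ‖z‖ ^ 2 := by
  rw [IsCol, isRow_iff]
  simp only [Matrix.conjTranspose_conjTranspose]

variable {G : Type*} [NormedAddCommGroup G] [InnerProductSpace ℂ G] {d : ℕ}

/-- The map `z ↦ ∑ s, z s • v s`. -/
noncomputable def synth (v : Fin d → G) : EuclideanSpace ℂ (Fin d) →L[ℂ] G :=
  ∑ s, (EuclideanSpace.proj s : EuclideanSpace ℂ (Fin d) →L[ℂ] ℂ).smulRight (v s)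

theorem synth_apply (v : Fin d → G) (z : EuclideanSpace ℂ (Fin d)) :
    synth v z = ∑ s, z s • v s := by
  simp [synth]

/-- The map `g ↦ (⟪v s, g⟫)_s`. -/
noncomputable def analysis (v : Fin d → G) : G →L[ℂ] EuclideanSpace ℂ (Fin d) :=
  ((PiLp.continuousLinearEquiv 2 ℂ (fun _ : Fin d => ℂ)).symm :
      (Fin d → ℂ) →L[ℂ] PiLp 2 (fun _ : Fin d => ℂ)) ∘L
    ContinuousLinearMap.pi fun s => innerSL ℂ (v s)

theorem analysis_apply (v : Fin d → G) (g : G) (s : Fin d) : analysis v g s = ⟪v s, g⟫_ℂ := by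
  simp [analysis]

theorem inner_synth (v : Fin d → G) (g : G) (z : EuclideanSpace ℂ (Fin d)) :
    ⟪g, synth v z⟫_ℂ = ⟪analysis v g, z⟫_ℂ := by
  rw [synth_apply, inner_sum, PiLp.inner_apply]
  refine Finset.sum_congr rfl fun s _ => ?_
  rw [inner_smul_right, analysis_apply, RCLike.inner_apply, inner_conj_symm]

variable {v : Fin d → G} (hv : Orthonormal ℂ v)
include hv

theorem norm_synth (z : EuclideanSpace ℂ (Fin d)) : ‖synth v z‖ = ‖z‖ := by
  rw [← sq_eq_sq₀ (norm_nonneg _) (norm_nonneg _), EuclideanSpace.norm_sq_eq]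
  have h : ⟪synth v z, synth v z⟫_ℂ = ∑ s, starRingEnd ℂ (z s) * z s := by
    rw [synth_apply]
    exact hv.inner_sum z z Finset.univ
  simp only [inner_self_eq_norm_sq_to_K, Complex.conj_mul'] at h
  refine Complex.ofReal_injective ?_
  push_cast
  exact h

theorem norm_analysis_le (g : G) : ‖analysis v g‖ ≤ ‖g‖ := by
  rw [← sq_le_sq₀ (norm_nonneg _) (norm_nonneg _), EuclideanSpace.norm_sq_eq]
  simp only [analysis_apply]
  exact hv.sum_inner_products_le g

omit hv

theorem toEuclideanCLM_compMat (A : G →L[ℂ] G) (z : EuclideanSpace ℂ (Fin d)) :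
    Matrix.toEuclideanCLM (n := Fin d) (𝕜 := ℂ) (compMat v A) z = analysis v (A (synth v z)) := by
  ext s
  rw [analysis_apply, synth_apply, map_sum, inner_sum, Matrix.ofLp_toEuclideanCLM]
  simp only [Matrix.mulVec, dotProduct, compMat, Matrix.of_apply, map_smul, inner_smul_right]
  exact Finset.sum_congr rfl fun t _ => mul_comm _ _

include hv

theorem isCol_compMat {a : Fin n → (G →L[ℂ] G)} {c : ℝ} (h : ‖colOp a‖ ≤ c) :
    IsCol (fun l => compMat v (a l)) (c ^ 2) := by
  rw [isCol_iff]
  intro z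
  calc ∑ l, ‖Matrix.toEuclideanCLM (n := Fin d) (𝕜 := ℂ) (compMat v (a l)) z‖ ^ 2
      ≤ ∑ l, ‖a l (synth v z)‖ ^ 2 := by
        refine Finset.sum_le_sum fun l _ => ?_
        rw [toEuclideanCLM_compMat]
        exact pow_le_pow_left₀ (norm_nonneg _) (norm_analysis_le hv _) 2
    _ = ‖colOp a (synth v z)‖ ^ 2 := by
        rw [PiLp.norm_sq_eq_of_L2]
        simp only [colOp_apply]
    _ ≤ (c * ‖z‖) ^ 2 := by
        rw [← norm_synth hv z]
        exact pow_le_pow_left₀ (norm_nonneg _) ((colOp a).le_of_opNorm_le h _) 2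
    _ = c ^ 2 * ‖z‖ ^ 2 := mul_pow _ _ _

omit hv in
theorem inner_toEuclideanCLM_conjTranspose (M : Matrix (Fin d) (Fin d) ℂ)
    (y z : EuclideanSpace ℂ (Fin d)) :
    ⟪Matrix.toEuclideanCLM (n := Fin d) (𝕜 := ℂ) Mᴴ z, y⟫_ℂ
      = ⟪z, Matrix.toEuclideanCLM (n := Fin d) (𝕜 := ℂ) M y⟫_ℂ := by
  rw [← Matrix.star_eq_conjTranspose, map_star, ContinuousLinearMap.star_eq_adjoint,
    ContinuousLinearMap.adjoint_inner_left]

theorem isRow_compMat {a : Fin n → (G →L[ℂ] G)} {c : ℝ} (h : ‖rowOp a‖ ≤ c) :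
    IsRow (fun l => compMat v (a l)) (c ^ 2) := by
  have hc : 0 ≤ c := (ContinuousLinearMap.opNorm_nonneg _).trans h
  rw [isRow_iff]
  intro z
  let u : Fin n → EuclideanSpace ℂ (Fin d) := fun l =>
    Matrix.toEuclideanCLM (n := Fin d) (𝕜 := ℂ) (compMat v (a l))ᴴ z
  -- The space G need not be complete, so no adjoint of the row operator is used. It is tested on
  -- the vector w built from the adjoint matrices, for which the pairing of `synth v z` with the row
  -- of w is exactly ‖w‖².
  let w : PiLp 2 fun _ : Fin n => G := WithLp.toLp 2 fun l => synth v (u l)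
  have hw : ‖w‖ ^ 2 = ∑ l, ‖u l‖ ^ 2 := by
    rw [PiLp.norm_sq_eq_of_L2]
    exact Finset.sum_congr rfl fun l _ => by rw [← norm_synth hv (u l)]
  have h1 : ((∑ l, ‖u l‖ ^ 2 : ℝ) : ℂ) = ⟪synth v z, rowOp a w⟫_ℂ := by
    rw [rowOp_apply, inner_sum]
    push_cast
    refine Finset.sum_congr rfl fun l _ => ?_
    have h2 := inner_self_eq_norm_sq_to_K (𝕜 := ℂ) (u l)
    refine h2.symm.trans ?_
    change ⟪Matrix.toEuclideanCLM (n := Fin d) (𝕜 := ℂ) (compMat v (a l))ᴴ z, u l⟫_ℂ = _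
    rw [inner_toEuclideanCLM_conjTranspose, toEuclideanCLM_compMat, ← inner_conj_symm,
      ← inner_synth, inner_conj_symm]
  rw [← hw] at h1
  have h3 : ‖w‖ ^ 2 ≤ ‖z‖ * (c * ‖w‖) := by
    calc ‖w‖ ^ 2 = ‖((‖w‖ ^ 2 : ℝ) : ℂ)‖ := by
          rw [Complex.norm_real, Real.norm_of_nonneg (by positivity)]
      _ = ‖⟪synth v z, rowOp a w⟫_ℂ‖ := by rw [h1]
      _ ≤ ‖synth v z‖ * ‖rowOp a w‖ := norm_inner_le_norm _ _
      _ ≤ ‖z‖ * (c * ‖w‖) := by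
          rw [norm_synth hv]
          exact mul_le_mul_of_nonneg_left ((rowOp a).le_of_opNorm_le h _) (norm_nonneg _)
  change ∑ l, ‖u l‖ ^ 2 ≤ _
  rw [← hw, ← mul_pow]
  refine pow_le_pow_left₀ (norm_nonneg _) ?_ 2
  rcases (norm_nonneg w).eq_or_lt with h0 | h0
  · rw [← h0]; positivity
  · exact le_of_mul_le_mul_right (by nlinarith) h0

omit hv

/-- The operator with matrix `M` on an orthonormal family, and `0` on its complement. -/
noncomputable def expand (v : Fin d → G) (M : Matrix (Fin d) (Fin d) ℂ) : G →L[ℂ] G :=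
  synth v ∘L Matrix.toEuclideanCLM (n := Fin d) (𝕜 := ℂ) M ∘L analysis v

theorem expand_apply (M : Matrix (Fin d) (Fin d) ℂ) (g : G) :
    expand v M g = synth v (Matrix.toEuclideanCLM (n := Fin d) (𝕜 := ℂ) M (analysis v g)) := rfl

theorem expand_eq_sum (M : Matrix (Fin d) (Fin d) ℂ) :
    expand v M = ∑ s, ∑ t, M s t • (innerSL ℂ (v t)).smulRight (v s) := by
  ext g
  simp only [expand_apply, synth_apply, Matrix.ofLp_toEuclideanCLM, Matrix.mulVec, dotProduct,
    analysis_apply, sum_apply, smul_apply, ContinuousLinearMap.smulRight_apply, innerSL_apply_apply,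
    Finset.sum_smul, mul_smul]

theorem differentiable_expand {F : ℂ → Matrix (Fin d) (Fin d) ℂ}
    (hF : ∀ i j, Differentiable ℂ fun z => F z i j) : Differentiable ℂ fun z => expand v (F z) := by
  simp only [expand_eq_sum]
  fun_prop

include hv

theorem norm_colOp_expand_le {M : Fin n → Matrix (Fin d) (Fin d) ℂ} {c : ℝ} (hc : 0 ≤ c)
    (h : IsCol M (c ^ 2)) : ‖colOp fun l => expand v (M l)‖ ≤ c := by
  refine ContinuousLinearMap.opNorm_le_bound _ hc fun g => ?_
  rw [← sq_le_sq₀ (norm_nonneg _) (by positivity), PiLp.norm_sq_eq_of_L2]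
  simp only [colOp_apply, expand_apply, norm_synth hv]
  refine (isCol_iff.1 h _).trans ?_
  rw [mul_pow]
  gcongr
  exact norm_analysis_le hv g

theorem norm_rowOp_expand_le {M : Fin n → Matrix (Fin d) (Fin d) ℂ} {c : ℝ} (hc : 0 ≤ c)
    (h : IsRow M (c ^ 2)) : ‖rowOp fun l => expand v (M l)‖ ≤ c := by
  refine opNorm_le_of_inner _ hc fun w g => ?_
  rw [rowOp_apply, inner_sum]
  calc ‖∑ l, ⟪g, expand v (M l) (w l)⟫_ℂ‖
      ≤ ∑ l, ‖Matrix.toEuclideanCLM (n := Fin d) (𝕜 := ℂ) (M l)ᴴ (analysis v g)‖ * ‖w l‖ := by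
        refine (norm_sum_le _ _).trans (Finset.sum_le_sum fun l _ => ?_)
        rw [expand_apply, inner_synth, ← inner_toEuclideanCLM_conjTranspose]
        exact (norm_inner_le_norm _ _).trans
          (mul_le_mul_of_nonneg_left (norm_analysis_le hv _) (norm_nonneg _))
    _ ≤ √(∑ l, ‖Matrix.toEuclideanCLM (n := Fin d) (𝕜 := ℂ) (M l)ᴴ (analysis v g)‖ ^ 2)
        * √(∑ l, ‖w l‖ ^ 2) := Real.sum_mul_le_sqrt_mul_sqrt _ _ _
    _ ≤ √((c * ‖g‖) ^ 2) * ‖w‖ := by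
        rw [PiLp.norm_eq_of_L2 w]
        refine mul_le_mul_of_nonneg_right (Real.sqrt_le_sqrt ?_) (Real.sqrt_nonneg _)
        refine (isRow_iff.1 h _).trans ?_
        rw [mul_pow]
        gcongr
        exact norm_analysis_le hv g
    _ = c * ‖w‖ * ‖g‖ := by
        rw [Real.sqrt_sq (by positivity)]
        ring

omit hv

/-- Compression followed by expansion is A cut down by the projection onto Q, which fixes x and y.
-/
theorem inner_expand_compMat_frame {Q : Submodule ℂ G} [FiniteDimensional ℂ Q] {x y : G}
    (hx : x ∈ Q) (hy : y ∈ Q) (A : G →L[ℂ] G) :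
    ⟪y, expand (frame Q) (compMat (frame Q) A) x⟫_ℂ = ⟪y, A x⟫_ℂ := by
  have h1 : ∀ {g : G}, g ∈ Q → synth (frame Q) (analysis (frame Q) g) = g := fun hg => by
    rw [synth_apply]
    simp only [analysis_apply]
    exact sum_inner_frame hg
  rw [expand_apply, toEuclideanCLM_compMat, h1 hx, inner_synth, ← inner_conj_symm, ← inner_synth,
    inner_conj_symm, h1 hy]

end Frames

end OpInterp

namespace OpInterp

/-! ### Strip families for operators on Hilbert space -/

section InterpolatingFamily

open scoped InnerProductSpace Matrix Topology
open Filter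

variable {n : ℕ} {G : Type*} [NormedAddCommGroup G] [InnerProductSpace ℂ G]

theorem exists_norm_expand_le {d : ℕ} (v : Fin d → G) (C : ℝ) :
    ∃ B : ℝ, ∀ M : Matrix (Fin d) (Fin d) ℂ, (∀ i j, ‖M i j‖ ≤ C) → ‖expand v M‖ ≤ B := by
  refine ⟨∑ s, ∑ t, C * ‖(innerSL ℂ (v t)).smulRight (v s)‖, fun M hM => ?_⟩
  rw [expand_eq_sum]
  refine (norm_sum_le _ _).trans (Finset.sum_le_sum fun s _ => (norm_sum_le _ _).trans
    (Finset.sum_le_sum fun t _ => ?_))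
  rw [norm_smul]
  exact mul_le_mul_of_nonneg_right (hM s t) (norm_nonneg _)

theorem _root_.LinearMap.differentiable_comp_of_bound {E F : Type*} [NormedAddCommGroup E]
    [NormedSpace ℂ E] [NormedAddCommGroup F] [NormedSpace ℂ F] (T : E →ₗ[ℂ] F) (c : ℝ)
    (h : ∀ x, ‖T x‖ ≤ c * ‖x‖) {f : ℂ → E} (hf : Differentiable ℂ f) :
    Differentiable ℂ fun z => T (f z) :=
  (T.mkContinuous c h).differentiable.comp hf

theorem norm_rowOp_le (a : Fin n → (G →L[ℂ] G)) : ‖rowOp a‖ ≤ √n * ‖a‖ :=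
  norm_rowOp_le_sqrt_mul a (norm_nonneg _) fun l => norm_le_pi_norm a l

theorem differentiable_rowOp {f : ℂ → Fin n → (G →L[ℂ] G)} (hf : Differentiable ℂ f) :
    Differentiable ℂ fun z => rowOp (f z) :=
  LinearMap.differentiable_comp_of_bound (E := (Fin n → (G →L[ℂ] G)))
    (F := ((PiLp 2 fun _ : Fin n => G) →L[ℂ] G)) rowOp (√n) norm_rowOp_le hf

theorem norm_colOp_le (a : Fin n → (G →L[ℂ] G)) : ‖colOp a‖ ≤ √n * ‖a‖ :=
  norm_colOp_le_sqrt_mul a (norm_nonneg _) fun l => norm_le_pi_norm a l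

theorem differentiable_colOp {f : ℂ → Fin n → (G →L[ℂ] G)} (hf : Differentiable ℂ f) :
    Differentiable ℂ fun z => colOp (f z) :=
  LinearMap.differentiable_comp_of_bound (E := (Fin n → (G →L[ℂ] G)))
    (F := (G →L[ℂ] (PiLp 2 fun _ : Fin n => G))) colOp (√n) norm_colOp_le hf

theorem norm_le_of_strip {E : Type*} [NormedAddCommGroup E] [NormedSpace ℂ E] {f : ℂ → E}
    (hf : Differentiable ℂ f) (hB : ∃ C : ℝ, ∀ z : ℂ, 0 ≤ z.re → z.re ≤ 1 → ‖f z‖ ≤ C)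
    {a b : ℝ} (h0 : ∀ z : ℂ, z.re = 0 → ‖f z‖ ≤ a) (h1 : ∀ z : ℂ, z.re = 1 → ‖f z‖ ≤ b)
    {z : ℂ} (hz0 : 0 ≤ z.re) (hz1 : z.re ≤ 1) : ‖f z‖ ≤ a ^ (1 - z.re) * b ^ z.re := by
  obtain ⟨C, hC⟩ := hB
  have := Complex.HadamardThreeLines.norm_le_interp_of_mem_verticalClosedStrip' (f := f) (z := z)
    (a := a) (b := b) zero_lt_one ⟨hz0, hz1⟩ hf.diffContOnCl
    ⟨C, by rintro _ ⟨w, hw, rfl⟩; exact hC w hw.1 hw.2⟩ h0 h1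
  simpa using this

/-- The family obtained from the compressions to one finite-dimensional subspace. -/
theorem exists_family_of_frame {a : Fin n → (G →L[ℂ] G)} {N M : ℝ} (hN : 0 ≤ N) (hNM : N < M)
    {d : ℕ} {v : Fin d → G} (hv : Orthonormal ℂ v)
    (h : HSBound (fun l => compMat v (a l)) (fun l => (compMat v (a l))ᴴ) (N ^ 2)) :
    ∃ f : ℂ → Fin n → (G →L[ℂ] G), (∀ l, Differentiable ℂ fun z => f z l) ∧
      f (1 / 2) = (fun l => expand v (compMat v (a l))) ∧
      ∀ z : ℂ, 0 ≤ z.re → z.re ≤ 1 → ‖rowOp (f z)‖ ≤ M * (n + 1 : ℝ) ^ z.re ∧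
        ‖colOp (f z)‖ ≤ M * (n + 1 : ℝ) ^ (1 - z.re) := by
  have hM : 0 < M := hN.trans_lt hNM
  obtain ⟨F, hFd, ⟨C, hFC⟩, hF, hF0, hF1⟩ := exists_strip_family (sq_nonneg N)
    (pow_lt_pow_left₀ hNM hN two_ne_zero) h
  obtain ⟨B, hB⟩ := exists_norm_expand_le v C
  have hd : ∀ l, Differentiable ℂ fun z => expand v (F z l) := fun l =>
    differentiable_expand (hFd l)
  have hd' : Differentiable ℂ fun z => fun l => expand v (F z l) := differentiable_pi.2 hd
  have hrow0 : ∀ z : ℂ, z.re = 0 → ‖rowOp fun l => expand v (F z l)‖ ≤ M := fun z hz =>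
    norm_rowOp_expand_le hv hM.le (hF0 z hz)
  have hcol1 : ∀ z : ℂ, z.re = 1 → ‖colOp fun l => expand v (F z l)‖ ≤ M := fun z hz =>
    norm_colOp_expand_le hv hM.le (hF1 z hz)
  -- Row and column norms differ by a factor of at most √n. The larger n + 1 serves as base because
  -- it is at least 1 even when n = 0.
  have hsqrt : √(n : ℝ) ≤ n + 1 := by
    rw [Real.sqrt_le_left (by positivity)]
    nlinarith [(Nat.cast_nonneg n : (0 : ℝ) ≤ n)]
  have hrow1 : ∀ z : ℂ, z.re = 1 → ‖rowOp fun l => expand v (F z l)‖ ≤ (n + 1) * M := fun z hz =>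
    (norm_rowOp_le_sqrt_mul _ hM.le fun l => (norm_apply_le_norm_colOp _ l).trans
      (hcol1 z hz)).trans (mul_le_mul_of_nonneg_right hsqrt hM.le)
  have hcol0 : ∀ z : ℂ, z.re = 0 → ‖colOp fun l => expand v (F z l)‖ ≤ (n + 1) * M := fun z hz =>
    (norm_colOp_le_sqrt_mul _ hM.le fun l => (norm_apply_le_norm_rowOp _ l).trans
      (hrow0 z hz)).trans (mul_le_mul_of_nonneg_right hsqrt hM.le)
  have hbd : ∀ z : ℂ, 0 ≤ z.re → z.re ≤ 1 → ∀ l, ‖expand v (F z l)‖ ≤ max B 0 :=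
    fun z h0 h1 l => (hB _ (hFC z h0 h1 l)).trans (le_max_left _ _)
  have hn1 : (0 : ℝ) < n + 1 := by positivity
  refine ⟨fun z l => expand v (F z l), hd, by simp only [hF], fun z h0 h1 => ⟨?_, ?_⟩⟩
  · have := norm_le_of_strip (f := fun z => rowOp fun l => expand v (F z l))
      (differentiable_rowOp hd') ⟨√n * max B 0, fun z h0 h1 =>
        norm_rowOp_le_sqrt_mul _ (le_max_right _ _) (hbd z h0 h1)⟩ hrow0 hrow1 h0 h1
    refine this.trans (le_of_eq ?_)
    rw [Real.mul_rpow hn1.le hM.le, mul_left_comm, ← Real.rpow_add hM, sub_add_cancel, Real.rpow_one,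
      mul_comm]
  · have := norm_le_of_strip (f := fun z => colOp fun l => expand v (F z l))
      (differentiable_colOp hd') ⟨√n * max B 0, fun z h0 h1 =>
        norm_colOp_le_sqrt_mul _ (le_max_right _ _) (hbd z h0 h1)⟩ hcol0 hcol1 h0 h1
    refine this.trans (le_of_eq ?_)
    rw [Real.mul_rpow hn1.le hM.le, mul_assoc, ← Real.rpow_add hM, sub_add_cancel, Real.rpow_one,
      mul_comm]

/-- A weak limit of the families obtained from the finite-dimensional compressions. -/
theorem exists_interpolating_family [CompleteSpace G] {a : Fin n → (G →L[ℂ] G)} {N M : ℝ}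
    (hN : 0 ≤ N) (hNM : N < M)
    (h : ∀ (Q : Submodule ℂ G) [FiniteDimensional ℂ Q],
      HSBound (fun l => compMat (frame Q) (a l)) (fun l => (compMat (frame Q) (a l))ᴴ) (N ^ 2)) :
    ∃ F : ℂ → Fin n → (G →L[ℂ] G),
      (∀ l, DifferentiableOn ℂ (fun z => F z l) {z | 0 < z.re ∧ z.re < 1}) ∧ F (1 / 2) = a ∧
      ∀ z : ℂ, 0 < z.re → z.re < 1 → ‖rowOp (F z)‖ ≤ M * (n + 1 : ℝ) ^ z.re ∧
        ‖colOp (F z)‖ ≤ M * (n + 1 : ℝ) ^ (1 - z.re) := by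
  classical
  have hM : 0 < M := hN.trans_lt hNM
  let Q : Finset G → Submodule ℂ G := fun s => Submodule.span ℂ (s : Set G)
  have hQ : ∀ s, FiniteDimensional ℂ (Q s) := fun s => FiniteDimensional.span_finset ℂ s
  have hfam := fun s : Finset G =>
    exists_family_of_frame hN hNM (orthonormal_frame (Q s)) (h (Q s))
  choose f hfd hfa hf using hfam
  -- Finite subsets of G are directed by inclusion; an ultrafilter finer than `atTop` makes all
  -- bounded nets converge weakly while their spans exhaust G.
  let 𝒰 : Ultrafilter (Finset G) := Ultrafilter.of atTop
  have hn1 : (1 : ℝ) ≤ n + 1 := by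
    have : (0 : ℝ) ≤ n := Nat.cast_nonneg n
    linarith
  have hfC : ∀ s, ∀ z : ℂ, 0 < z.re → z.re < 1 → ∀ l, ‖f s z l‖ ≤ M * (n + 1) := by
    intro s z h0 h1 l
    refine (norm_apply_le_norm_rowOp _ l).trans ((hf s z h0.le h1.le).1.trans ?_)
    refine mul_le_mul_of_nonneg_left ?_ hM.le
    calc (n + 1 : ℝ) ^ z.re ≤ (n + 1 : ℝ) ^ (1 : ℝ) := Real.rpow_le_rpow_of_exponent_le hn1 h1.le
      _ = n + 1 := Real.rpow_one _
  -- The value 0 outside the open strip is a mere default.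
  have hlim : ∀ (z : ℂ) (l : Fin n), ∃ A : G →L[ℂ] G, 0 < z.re → z.re < 1 →
      WeakLim (𝒰 : Filter (Finset G)) (fun s => f s z l) A := by
    intro z l
    by_cases hz : 0 < z.re ∧ z.re < 1
    · obtain ⟨A, hA⟩ := exists_weakLim 𝒰 (by positivity) fun s => hfC s z hz.1 hz.2 l
      exact ⟨A, fun _ _ => hA⟩
    · exact ⟨0, fun h0 h1 => absurd ⟨h0, h1⟩ hz⟩
  choose F hF using hlim
  refine ⟨F, fun l => ?_, ?_, fun z h0 h1 => ⟨?_, ?_⟩⟩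
  · have hU : IsOpen {z : ℂ | 0 < z.re ∧ z.re < 1} :=
      (isOpen_lt continuous_const Complex.continuous_re).inter
        (isOpen_lt Complex.continuous_re continuous_const)
    exact differentiableOn_of_weakLim 𝒰 hU (by positivity) (f := fun s z => f s z l)
      (fun s => (hfd s l).differentiableOn) (fun s z hz => hfC s z hz.1 hz.2 l)
      fun z hz => hF z l hz.1 hz.2
  · funext l
    refine (hF (1 / 2) l (by norm_num) (by norm_num)).unique fun x y => ?_
    refine tendsto_const_nhds.congr' ?_
    -- As soon as s contains x and y, the coefficient of the approximating operator at 1/2 equals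
    -- that of a_l.
    have : ∀ᶠ s : Finset G in atTop, ⟪y, a l x⟫_ℂ = ⟪y, f s (1 / 2) l x⟫_ℂ := by
      filter_upwards [eventually_ge_atTop ({x, y} : Finset G)] with s hs
      rw [hfa]
      refine (inner_expand_compMat_frame ?_ ?_ _).symm
      · exact Submodule.subset_span (hs (by simp))
      · exact Submodule.subset_span (hs (by simp))
    exact (Ultrafilter.of_le atTop) this
  · exact (WeakLim.rowOp fun q => hF z q h0 h1).norm_le (by positivity) fun s =>
      (hf s z h0.le h1.le).1
  · exact (WeakLim.colOp fun q => hF z q h0 h1).norm_le (by positivity) fun s =>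
      (hf s z h0.le h1.le).2

end InterpolatingFamily

end OpInterp

namespace OpInterp

/-! ### Building functions of the Calderón space -/

section AbstractInterpolation

open scoped Topology
open Filter

variable {E₀ E₁ X : Type*} [SeminormedAddCommGroup E₀] [NormedSpace ℂ E₀]
  [SeminormedAddCommGroup E₁] [NormedSpace ℂ E₁] [AddCommGroup X] [Module ℂ X]

/-- Stated for seminormed spaces, since the sum of a couple carries only a seminorm; the remainder
is therefore estimated in its topological form. -/
theorem differentiableOn_clm_comp {E F : Type*} [SeminormedAddCommGroup E] [NormedSpace ℂ E]
    [SeminormedAddCommGroup F] [NormedSpace ℂ F] (T : E →L[ℂ] F) {f : ℂ → E} {s : Set ℂ}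
    (hf : DifferentiableOn ℂ f s) : DifferentiableOn ℂ (fun z => T (f z)) s := by
  intro z hz
  obtain ⟨f', hf'⟩ := hf z hz
  refine ⟨T ∘L f', ⟨?_⟩⟩
  refine (T.isBigOTVS_fun_comp.trans_isLittleOTVS
    (HasFDerivAtFilter.isLittleOTVS hf')).congr_left fun p => ?_
  simp

theorem SumSpace.mk_eq_mk (i₀ : E₀ →ₗ[ℂ] X) (i₁ : E₁ →ₗ[ℂ] X) {a a' : E₀} {b b' : E₁}
    (h : i₀ a + i₁ b = i₀ a' + i₁ b') : SumSpace.mk i₀ i₁ a b = SumSpace.mk i₀ i₁ a' b' := by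
  rw [SumSpace.mk, SumSpace.mk, Submodule.mkQ_apply, Submodule.mkQ_apply, Submodule.Quotient.eq,
    LinearMap.mem_ker, map_sub, sub_eq_zero]
  simpa [coupleMap] using h

/-- The inclusion of `E₀` in `E₀ + E₁`. -/
noncomputable def SumSpace.inl (i₀ : E₀ →ₗ[ℂ] X) (i₁ : E₁ →ₗ[ℂ] X) : E₀ →L[ℂ] SumSpace i₀ i₁ :=
  LinearMap.mkContinuous ((LinearMap.ker (coupleMap i₀ i₁)).mkQ ∘ₗ
    (WithLp.linearEquiv 1 ℂ (E₀ × E₁)).symm.toLinearMap ∘ₗ LinearMap.inl ℂ E₀ E₁) 1 fun a => by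
      rw [one_mul]
      refine (Submodule.Quotient.norm_mk_le _ _).trans (le_of_eq ?_)
      simp

theorem SumSpace.norm_mk_zero_le (i₀ : E₀ →ₗ[ℂ] X) (i₁ : E₁ →ₗ[ℂ] X) (a : E₀) :
    ‖SumSpace.mk i₀ i₁ a 0‖ ≤ ‖a‖ := by
  refine (Submodule.Quotient.norm_mk_le _ _).trans (le_of_eq ?_)
  simp

/-- A linear map on the ambient space that is contractive on `E₀` and `E₁` is contractive on
`E₀ + E₁`. -/
theorem SumSpace.norm_comp_toAmbient_le {Y : Type*} [NormedAddCommGroup Y] [NormedSpace ℂ Y]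
    (i₀ : E₀ →ₗ[ℂ] X) (i₁ : E₁ →ₗ[ℂ] X) (e : X →ₗ[ℂ] Y) (h₀ : ∀ a, ‖e (i₀ a)‖ ≤ ‖a‖)
    (h₁ : ∀ b, ‖e (i₁ b)‖ ≤ ‖b‖) (x : SumSpace i₀ i₁) :
    ‖e (SumSpace.toAmbient i₀ i₁ x)‖ ≤ ‖x‖ := by
  refine le_of_forall_pos_le_add fun ε hε => ?_
  obtain ⟨p, rfl, hp⟩ := Submodule.Quotient.norm_mk_lt x hε
  refine le_trans ?_ hp.le
  have : SumSpace.toAmbient i₀ i₁ (Submodule.Quotient.mk p) = i₀ p.fst + i₁ p.snd :=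
    SumSpace.toAmbient_mk i₀ i₁ p.fst p.snd
  rw [this, map_add, WithLp.prod_norm_eq_of_L1]
  exact (norm_add_le _ _).trans (add_le_add (h₀ _) (h₁ _))

/-- Pushing a function of the Calderón space forward to a normed space. -/
theorem Calderon.diffContOnCl_image {Y : Type*} [NormedAddCommGroup Y] [NormedSpace ℂ Y]
    {i₀ : E₀ →ₗ[ℂ] X} {i₁ : E₁ →ₗ[ℂ] X} (f : Calderon i₀ i₁) (e : X →ₗ[ℂ] Y)
    (h₀ : ∀ a, ‖e (i₀ a)‖ ≤ ‖a‖) (h₁ : ∀ b, ‖e (i₁ b)‖ ≤ ‖b‖) :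
    DiffContOnCl ℂ (fun z => e (SumSpace.toAmbient i₀ i₁ (f.toFun z)))
      (Complex.HadamardThreeLines.verticalStrip 0 1) ∧
    ∃ C : ℝ, ∀ z : ℂ, 0 ≤ z.re → z.re ≤ 1 →
      ‖e (SumSpace.toAmbient i₀ i₁ (f.toFun z))‖ ≤ C := by
  let T : SumSpace i₀ i₁ →L[ℂ] Y := LinearMap.mkContinuous (e ∘ₗ SumSpace.toAmbient i₀ i₁) 1
    fun x => by
      rw [one_mul]
      exact SumSpace.norm_comp_toAmbient_le i₀ i₁ e h₀ h₁ x
  refine ⟨⟨?_, ?_⟩, ?_⟩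
  · exact differentiableOn_clm_comp T f.differentiableOn'
  · have hcl : closure (Complex.HadamardThreeLines.verticalStrip 0 1)
        ⊆ {z : ℂ | 0 ≤ z.re ∧ z.re ≤ 1} := by
      refine closure_minimal (fun z hz => ⟨hz.1.le, hz.2.le⟩) ?_
      exact (isClosed_le continuous_const Complex.continuous_re).inter
        (isClosed_le Complex.continuous_re continuous_const)
    exact (T.continuous.comp_continuousOn f.continuousOn').mono hcl
  · obtain ⟨C, hC⟩ := f.bounded'
    exact ⟨C, fun z h0 h1 => (SumSpace.norm_comp_toAmbient_le i₀ i₁ e h₀ h₁ _).trans (hC z h0 h1)⟩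

theorem C0_norm_le {E : Type*} [SeminormedAddCommGroup E] (f : C₀(ℝ, E)) {c : ℝ} (hc : 0 ≤ c)
    (h : ∀ t, ‖f t‖ ≤ c) : ‖f‖ ≤ c := by
  rw [← ZeroAtInftyContinuousMap.norm_toBCF_eq_norm]
  exact (BoundedContinuousFunction.norm_le hc).2 h

theorem C0_norm_apply_le {E : Type*} [SeminormedAddCommGroup E] (f : C₀(ℝ, E)) (t : ℝ) :
    ‖f t‖ ≤ ‖f‖ := by
  rw [← ZeroAtInftyContinuousMap.norm_toBCF_eq_norm]
  exact f.toBCF.norm_coe_le_norm t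

theorem tendsto_exp_neg_mul_sq_cocompact {δ : ℝ} (hδ : 0 < δ) (C : ℝ) :
    Tendsto (fun t : ℝ => Real.exp (-(δ * t ^ 2)) * C) (cocompact ℝ) (𝓝 0) := by
  have h1 : Tendsto (fun t : ℝ => t ^ 2) (cocompact ℝ) atTop := by
    have := (tendsto_pow_atTop two_ne_zero).comp (tendsto_norm_cocompact_atTop (E := ℝ))
    refine this.congr fun t => ?_
    simp
  have h2 := (Real.tendsto_exp_neg_atTop_nhds_zero.comp (h1.const_mul_atTop hδ)).mul_const C
  simpa using h2

/-- The Gaussian factor. -/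
noncomputable def gauss (δ : ℝ) (z : ℂ) : ℂ := Complex.exp (δ * (z ^ 2 - 1 / 4))

theorem differentiable_gauss (δ : ℝ) : Differentiable ℂ (gauss δ) := by
  unfold gauss
  fun_prop

/-- On the strip (Re z)² - 1/4 ≤ 1, while -(Im z)² supplies the decay at infinity. -/
theorem norm_gauss_le {δ : ℝ} (hδ : 0 < δ) {z : ℂ} (h0 : 0 ≤ z.re) (h1 : z.re ≤ 1) :
    ‖gauss δ z‖ ≤ Real.exp δ * Real.exp (-(δ * z.im ^ 2)) := by
  rw [gauss, Complex.norm_exp, ← Real.exp_add, Real.exp_le_exp]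
  have : ((δ : ℂ) * (z ^ 2 - 1 / 4)).re = δ * (z.re ^ 2 - z.im ^ 2 - 1 / 4) := by
    simp [pow_two]
  rw [this]
  nlinarith [mul_nonneg hδ.le (show 0 ≤ 1 - z.re ^ 2 + 1 / 4 by nlinarith)]

/-- The affine map that moves the closed strip into the open strip. -/
noncomputable def squeeze (δ : ℝ) (z : ℂ) : ℂ := δ + (1 - 2 * δ : ℝ) * z

theorem squeeze_re (δ : ℝ) (z : ℂ) : (squeeze δ z).re = δ + (1 - 2 * δ) * z.re := by
  rw [squeeze, Complex.add_re, Complex.re_ofReal_mul, Complex.ofReal_re]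

theorem squeeze_mem {δ : ℝ} (hδ : 0 < δ) (hδ' : δ < 1 / 2) {z : ℂ} (h0 : 0 ≤ z.re)
    (h1 : z.re ≤ 1) : 0 < (squeeze δ z).re ∧ (squeeze δ z).re < 1 := by
  rw [squeeze_re]
  constructor <;> nlinarith

/-- A function that is holomorphic in the open strip gives functions of the Calderón space. -/
theorem exists_calderon {Y : Type*} [NormedAddCommGroup Y] [NormedSpace ℂ Y]
    {i₀ : E₀ →ₗ[ℂ] X} {i₁ : E₁ →ₗ[ℂ] X} (s₀ : Y →L[ℂ] E₀) (s₁ : Y →L[ℂ] E₁)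
    (hs : ∀ y, i₀ (s₀ y) = i₁ (s₁ y)) {F : ℂ → Y}
    (hF : DifferentiableOn ℂ F {z | 0 < z.re ∧ z.re < 1}) {M D : ℝ} (hM : 0 ≤ M) (hD : 1 ≤ D)
    (h₀ : ∀ z : ℂ, 0 < z.re → z.re < 1 → ‖s₀ (F z)‖ ≤ M * D ^ z.re)
    (h₁ : ∀ z : ℂ, 0 < z.re → z.re < 1 → ‖s₁ (F z)‖ ≤ M * D ^ (1 - z.re))
    {δ : ℝ} (hδ : 0 < δ) (hδ' : δ < 1 / 2) :
    ∃ f : Calderon i₀ i₁, SumSpace.toAmbient i₀ i₁ (f.toFun ((1 / 2 : ℝ) : ℂ))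
        = i₀ (s₀ (F (1 / 2))) ∧
      ‖f.left‖ ≤ Real.exp δ * (M * D ^ δ) ∧ ‖f.right‖ ≤ Real.exp δ * (M * D ^ δ) := by
  have hD0 : 0 < D := zero_lt_one.trans_le hD
  -- Squeezing gives continuity up to the boundary, where F has no controlled values, and the
  -- Gaussian makes the boundary functions vanish at infinity. Both are normalized at 1/2: `squeeze`
  -- fixes it and `gauss` equals 1 there. The sides move to real parts δ and 1 - δ, whence the
  -- factor D^δ.
  let h : ℂ → Y := fun z => gauss δ z • F (squeeze δ z)
  have hsq : Differentiable ℂ (squeeze δ) := by unfold squeeze; fun_prop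
  have hhc : ContinuousOn h {z : ℂ | 0 ≤ z.re ∧ z.re ≤ 1} :=
    (differentiable_gauss δ).continuous.continuousOn.smul
      (hF.continuousOn.comp hsq.continuous.continuousOn fun z hz => squeeze_mem hδ hδ' hz.1 hz.2)
  have hhd : DifferentiableOn ℂ h {z : ℂ | 0 < z.re ∧ z.re < 1} :=
    (differentiable_gauss δ).differentiableOn.smul
      (hF.comp hsq.differentiableOn fun z hz => squeeze_mem hδ hδ' hz.1.le hz.2.le)
  have hn₀ : ∀ z : ℂ, 0 ≤ z.re → z.re ≤ 1 →
      ‖s₀ (h z)‖ ≤ Real.exp (-(δ * z.im ^ 2)) * (Real.exp δ * (M * D ^ (squeeze δ z).re)) := by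
    intro z h0 h1
    have hz := squeeze_mem hδ hδ' h0 h1
    rw [map_smul, norm_smul, ← mul_assoc, mul_comm (Real.exp _) (Real.exp δ)]
    exact mul_le_mul (norm_gauss_le hδ h0 h1) (h₀ _ hz.1 hz.2) (norm_nonneg _) (by positivity)
  have hn₁ : ∀ z : ℂ, 0 ≤ z.re → z.re ≤ 1 →
      ‖s₁ (h z)‖ ≤ Real.exp (-(δ * z.im ^ 2)) *
        (Real.exp δ * (M * D ^ (1 - (squeeze δ z).re))) := by
    intro z h0 h1
    have hz := squeeze_mem hδ hδ' h0 h1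
    rw [map_smul, norm_smul, ← mul_assoc, mul_comm (Real.exp _) (Real.exp δ)]
    exact mul_le_mul (norm_gauss_le hδ h0 h1) (h₁ _ hz.1 hz.2) (norm_nonneg _) (by positivity)
  have hleft : ∀ t : ℝ, ‖s₀ (h (t * Complex.I))‖ ≤
      Real.exp (-(δ * t ^ 2)) * (Real.exp δ * (M * D ^ δ)) := fun t => by
    simpa [squeeze_re] using hn₀ (t * Complex.I) (by simp) (by simp)
  have hright : ∀ t : ℝ, ‖s₁ (h (1 + t * Complex.I))‖ ≤
      Real.exp (-(δ * t ^ 2)) * (Real.exp δ * (M * D ^ δ)) := fun t => by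
    have := hn₁ (1 + t * Complex.I) (by simp) (by simp)
    have e : (1 : ℝ) - (δ + (1 - 2 * δ)) = δ := by ring
    simpa [squeeze_re, e] using this
  have hexp : ∀ t : ℝ, Real.exp (-(δ * t ^ 2)) * (Real.exp δ * (M * D ^ δ)) ≤
      Real.exp δ * (M * D ^ δ) := fun t =>
    mul_le_of_le_one_left (by positivity) (Real.exp_le_one_iff.2 (by nlinarith [sq_nonneg t]))
  have hcl : Continuous fun t : ℝ => h (t * Complex.I) :=
    hhc.comp_continuous (by fun_prop) fun t => by simp
  have hcr : Continuous fun t : ℝ => h (1 + t * Complex.I) :=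
    hhc.comp_continuous (by fun_prop) fun t => by simp
  let L : C₀(ℝ, E₀) := ⟨⟨fun t => s₀ (h (t * Complex.I)), s₀.continuous.comp hcl⟩,
    squeeze_zero_norm hleft (tendsto_exp_neg_mul_sq_cocompact hδ _)⟩
  let R : C₀(ℝ, E₁) := ⟨⟨fun t => s₁ (h (1 + t * Complex.I)), s₁.continuous.comp hcr⟩,
    squeeze_zero_norm hright (tendsto_exp_neg_mul_sq_cocompact hδ _)⟩
  let J : Y →L[ℂ] SumSpace i₀ i₁ := (SumSpace.inl i₀ i₁).comp s₀
  refine ⟨{ toFun := fun z => J (h z)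
            bounded' := ⟨Real.exp δ * (M * D), fun z h0 h1 => ?_⟩
            continuousOn' := J.continuous.comp_continuousOn hhc
            differentiableOn' := differentiableOn_clm_comp J hhd
            left := L
            left_eq := fun t => rfl
            right := R
            right_eq := fun t => ?_ }, ?_, ?_, ?_⟩
  · refine (SumSpace.norm_mk_zero_le i₀ i₁ _).trans ((hn₀ z h0 h1).trans ?_)
    have hz := squeeze_mem hδ hδ' h0 h1
    have hDle : D ^ (squeeze δ z).re ≤ D :=
      (Real.rpow_le_rpow_of_exponent_le hD hz.2.le).trans_eq (Real.rpow_one D)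
    refine (mul_le_of_le_one_left (by positivity)
      (Real.exp_le_one_iff.2 (by nlinarith [sq_nonneg z.im]))).trans ?_
    gcongr
  · change SumSpace.mk i₀ i₁ (s₀ (h _)) 0 = SumSpace.mk i₀ i₁ 0 (s₁ (h _))
    exact SumSpace.mk_eq_mk i₀ i₁ (by rw [map_zero, map_zero, add_zero, zero_add, hs])
  · change SumSpace.toAmbient i₀ i₁ (SumSpace.mk i₀ i₁ (s₀ (h _)) 0) = _
    rw [SumSpace.toAmbient_mk, map_zero, add_zero]
    have e1 : gauss δ ((1 / 2 : ℝ) : ℂ) = 1 := by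
      rw [gauss]
      norm_num
    have e2 : squeeze δ ((1 / 2 : ℝ) : ℂ) = 1 / 2 := by
      rw [squeeze]
      push_cast
      ring
    simp only [h, e1, e2, one_smul]
  · exact C0_norm_le L (by positivity) fun t => (hleft t).trans (hexp t)
  · exact C0_norm_le R (by positivity) fun t => (hright t).trans (hexp t)

/-- As δ tends to 0, the cost exp(δ) D^δ tends to 1, so the growth of the two norms across the strip
leaves no trace. -/
theorem interpNorm_le {Y : Type*} [NormedAddCommGroup Y] [NormedSpace ℂ Y]
    {i₀ : E₀ →ₗ[ℂ] X} {i₁ : E₁ →ₗ[ℂ] X} (s₀ : Y →L[ℂ] E₀) (s₁ : Y →L[ℂ] E₁)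
    (hs : ∀ y, i₀ (s₀ y) = i₁ (s₁ y)) {F : ℂ → Y}
    (hF : DifferentiableOn ℂ F {z | 0 < z.re ∧ z.re < 1}) {M D : ℝ} (hM : 0 ≤ M) (hD : 1 ≤ D)
    (h₀ : ∀ z : ℂ, 0 < z.re → z.re < 1 → ‖s₀ (F z)‖ ≤ M * D ^ z.re)
    (h₁ : ∀ z : ℂ, 0 < z.re → z.re < 1 → ‖s₁ (F z)‖ ≤ M * D ^ (1 - z.re)) :
    interpNorm i₀ i₁ (1 / 2) (i₀ (s₀ (F (1 / 2)))) ≤ ENNReal.ofReal M := by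
  have hD0 : 0 < D := zero_lt_one.trans_le hD
  have hlim : Tendsto (fun δ : ℝ => ENNReal.ofReal (Real.exp δ * (M * D ^ δ))) (𝓝[>] 0)
      (𝓝 (ENNReal.ofReal M)) := by
    have hc : Continuous fun δ : ℝ => ENNReal.ofReal (Real.exp δ * (M * D ^ δ)) :=
      ENNReal.continuous_ofReal.comp (Real.continuous_exp.mul (continuous_const.mul
        (Real.continuous_const_rpow hD0.ne')))
    have := hc.tendsto 0
    simp only [Real.exp_zero, Real.rpow_zero, mul_one, one_mul] at this
    exact this.mono_left nhdsWithin_le_nhds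
  refine ge_of_tendsto hlim ?_
  filter_upwards [Ioo_mem_nhdsGT (show (0 : ℝ) < 1 / 2 by norm_num)] with δ hδ
  obtain ⟨f, hf, hl, hr⟩ := exists_calderon s₀ s₁ hs hF hM hD h₀ h₁ hδ.1 hδ.2
  refine (iInf₂_le f hf).trans (max_le ?_ ?_)
  · rw [← ofReal_norm]
    exact ENNReal.ofReal_le_ofReal hl
  · rw [← ofReal_norm]
    exact ENNReal.ofReal_le_ofReal hr

end AbstractInterpolation

end OpInterp

namespace OpInterp

/-! ### The two estimates of the interpolation norm -/

section Main

open scoped InnerProductSpace Matrix Topology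
open Filter

variable {n m : ℕ} {H : Type*} [NormedAddCommGroup H] [InnerProductSpace ℂ H]

/-- An entry of the compression of a matrix, as a linear functional. -/
noncomputable def compEntry {d : ℕ} (v : Fin d → PiLp 2 fun _ : Fin m => H) (l : Fin n)
    (s t : Fin d) :
    Matrix (Fin m) (Fin m) (EuclideanSpace ℂ (Fin n) ⊗[ℂ] (H →L[ℂ] H)) →ₗ[ℂ] ℂ where
  toFun X := compMat v (tuple n m H X l) s t
  map_add' X Y := by simp [compMat]
  map_smul' c X := by simp [compMat]

/-- Entries of compressions are then contractive for both the row and the column norm, hence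
holomorphic along functions of the Calderón space. -/
theorem norm_compEntry_le {d : ℕ} {v : Fin d → PiLp 2 fun _ : Fin m => H} (hv : Orthonormal ℂ v)
    (l : Fin n) (s t : Fin d)
    (X : Matrix (Fin m) (Fin m) (EuclideanSpace ℂ (Fin n) ⊗[ℂ] (H →L[ℂ] H))) :
    ‖compEntry v l s t X‖ ≤ ‖tuple n m H X l‖ := by
  change ‖⟪v s, tuple n m H X l (v t)⟫_ℂ‖ ≤ _
  refine (norm_inner_le_norm _ _).trans ?_
  rw [hv.1 s, one_mul]
  refine ((tuple n m H X l).le_opNorm _).trans ?_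
  rw [hv.1 t, mul_one]

/-- The lower estimate for the interpolation norm, for the compressions to an orthonormal
family. -/
theorem hsBound_of_calderon
    (f : Calderon
      (matIncl (minEmb (rowEmb n) (LinearMap.id (R := ℂ) (M := H →L[ℂ] H))) LinearMap.id m)
      (matIncl (minEmb (colEmb n) (LinearMap.id (R := ℂ) (M := H →L[ℂ] H))) LinearMap.id m))
    {X : Matrix (Fin m) (Fin m) (EuclideanSpace ℂ (Fin n) ⊗[ℂ] (H →L[ℂ] H))}
    (hX : SumSpace.toAmbient _ _ (f.toFun ((1 / 2 : ℝ) : ℂ)) = X) {c : ℝ}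
    (hl : ‖f.left‖ ≤ c) (hr : ‖f.right‖ ≤ c)
    {d : ℕ} {v : Fin d → PiLp 2 fun _ : Fin m => H} (hv : Orthonormal ℂ v) :
    HSBound (fun l => compMat v (tuple n m H X l)) (fun l => (compMat v (tuple n m H X l))ᴴ)
      (c ^ 2) := by
  have hc : 0 ≤ c := (norm_nonneg f.left).trans hl
  set x : Fin n → Matrix (Fin d) (Fin d) ℂ := fun l => compMat v (tuple n m H X l) with hx
  let g : ℂ → Fin n → Matrix (Fin d) (Fin d) ℂ := fun z l =>
    compMat v (tuple n m H (SumSpace.toAmbient _ _ (f.toFun z)) l)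
  have him := fun l s t => f.diffContOnCl_image (compEntry v l s t)
    (fun a => (norm_compEntry_le hv l s t _).trans <| (norm_apply_le_norm_rowOp _ l).trans_eq
      (norm_amplify_rowEmb _).symm)
    (fun b => (norm_compEntry_le hv l s t _).trans <| (norm_apply_le_norm_colOp _ l).trans_eq
      (norm_amplify_colEmb _).symm)
  choose hgd C hC using him
  have hg0 : ∀ z : ℂ, z.re = 0 → IsRow (g z) (c ^ 2) := by
    intro z hz
    refine isRow_compMat hv ?_
    have hz' : z = z.im * Complex.I := by apply Complex.ext <;> simp [hz]
    rw [hz', f.left_eq, SumSpace.toAmbient_mk, map_zero, add_zero]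
    exact (norm_amplify_rowEmb _).symm.trans_le ((C0_norm_apply_le f.left _).trans hl)
  have hg1 : ∀ z : ℂ, z.re = 1 → IsCol (g z) (c ^ 2) := by
    intro z hz
    refine isCol_compMat hv ?_
    have hz' : z = 1 + z.im * Complex.I := by apply Complex.ext <;> simp [hz]
    rw [hz', f.right_eq, SumSpace.toAmbient_mk, map_zero, zero_add]
    exact (norm_amplify_colEmb _).symm.trans_le ((C0_norm_apply_le f.right _).trans hr)
  have hgx : g (1 / 2) = x := by
    have : ((1 / 2 : ℝ) : ℂ) = 1 / 2 := by push_cast; rfl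
    rw [this] at hX
    simp only [g, hx, hX]
  obtain ⟨r, hr0, hr1, hr2⟩ := exists_least_hsBound x fun l => (x l)ᴴ
  -- Here r = ‖Φ_x‖. The compressed function has row and column bounds c² and value x at 1/2; it is
  -- paired with the strip family of the adjoint tuple, of bound ρ. Minimality of r gives r ≤ c √ρ,
  -- and ρ → r yields √r ≤ c.
  have key : ∀ ρ > r, r ≤ c * √ρ := by
    intro ρ hρ
    have hadj : HSBound (fun l => (x l)ᴴ) (fun l => ((x l)ᴴ)ᴴ) r := hr1.conjTranspose
    obtain ⟨F, hFd, ⟨B, hB⟩, hF, hF0, hF1⟩ := exists_strip_family hr0 hρ hadj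
    have hCg : ∀ z : ℂ, 0 ≤ z.re → z.re ≤ 1 → ∀ l s t, ‖g z l s t‖ ≤ ∑ l, ∑ s, ∑ t, |C l s t| := by
      intro z h0 h1 l s t
      calc ‖g z l s t‖ ≤ C l s t := hC l s t z h0 h1
        _ ≤ |C l s t| := le_abs_self _
        _ ≤ ∑ t, |C l s t| := Finset.single_le_sum (f := fun t => |C l s t|)
            (fun _ _ => abs_nonneg _) (Finset.mem_univ t)
        _ ≤ ∑ s, ∑ t, |C l s t| := Finset.single_le_sum (f := fun s => ∑ t, |C l s t|)
            (fun _ _ => Finset.sum_nonneg fun _ _ => abs_nonneg _) (Finset.mem_univ s)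
        _ ≤ _ := Finset.single_le_sum (f := fun l => ∑ s, ∑ t, |C l s t|)
            (fun _ _ => Finset.sum_nonneg fun _ _ => Finset.sum_nonneg fun _ _ => abs_nonneg _)
            (Finset.mem_univ l)
    have hb := hsBound_of_strip (f := g) (h := F) hgd (fun l i j => (hFd l i j).diffContOnCl)
      hCg hB hg0 hF0 hg1 hF1
    rw [hgx, hF, Real.sqrt_sq hc] at hb
    exact hr2 _ (by positivity) hb
  have hle : r ≤ c * √r := by
    have hlim : Tendsto (fun ρ => c * √ρ) (𝓝[>] r) (𝓝 (c * √r)) :=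
      ((continuous_const.mul Real.continuous_sqrt).tendsto r).mono_left nhdsWithin_le_nhds
    exact ge_of_tendsto hlim (eventually_mem_nhdsWithin.mono key)
  refine hr1.mono ?_
  rcases hr0.eq_or_lt with h | h
  · rw [← h]
    positivity
  · have hs : 0 < √r := Real.sqrt_pos.2 h
    have hsr : √r * √r = r := Real.mul_self_sqrt hr0
    have : √r ≤ c := le_of_mul_le_mul_right (hsr.trans_le hle) hs
    calc r = √r * √r := hsr.symm
      _ ≤ c * c := mul_le_mul this this hs.le hc
      _ = c ^ 2 := (sq c).symm

theorem opMatNorm_le_interpMatNorm {K : Type*} [NormedAddCommGroup K] [InnerProductSpace ℂ K]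
    {j : EuclideanSpace ℂ (Fin n) →ₗᵢ[ℂ] (K →L[ℂ] K)} (hj : IsOH j)
    (X : Matrix (Fin m) (Fin m) (EuclideanSpace ℂ (Fin n) ⊗[ℂ] (H →L[ℂ] H))) :
    opMatNorm (minEmb j.toLinearMap (LinearMap.id (R := ℂ) (M := H →L[ℂ] H))) m X ≤
      interpMatNorm (minEmb (rowEmb n) (LinearMap.id (R := ℂ) (M := H →L[ℂ] H)))
        (minEmb (colEmb n) (LinearMap.id (R := ℂ) (M := H →L[ℂ] H)))
        LinearMap.id LinearMap.id (1 / 2) m X := by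
  refine le_iInf₂ fun f hf => ?_
  set c := max ‖f.left‖ ‖f.right‖ with hc
  have hc0 : 0 ≤ c := (norm_nonneg f.left).trans (le_max_left _ _)
  have h1 : max ‖f.left‖ₑ ‖f.right‖ₑ = ENNReal.ofReal c := by
    rw [hc, ENNReal.ofReal_max, ofReal_norm, ofReal_norm]
  have h2 : ‖amplify (minEmb j.toLinearMap (LinearMap.id (R := ℂ) (M := H →L[ℂ] H))) m X‖ ≤ c := by
    refine norm_amplify_minEmb_le _ _ hc0 fun Q _ => ?_
    rw [hj.norm_amplify_le_iff hc0, coords_compTuple]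
    exact hsBound_of_calderon f hf (le_max_left _ _) (le_max_right _ _) (orthonormal_frame Q)
  rw [h1, opMatNorm, ← ofReal_norm]
  exact ENNReal.ofReal_le_ofReal h2

/-- Tuples with the supremum norm serve as one common normed space that maps continuously into both
endpoints; its sections `s₀`, `s₁` are what `interpNorm_le` needs. -/
theorem exists_matSpace_clm {V K L Y : Type*} [AddCommGroup V] [Module ℂ V]
    [NormedAddCommGroup K] [InnerProductSpace ℂ K] [NormedAddCommGroup L] [InnerProductSpace ℂ L]
    [NormedAddCommGroup Y] [NormedSpace ℂ Y] (j : V →ₗ[ℂ] (K →L[ℂ] L))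
    {τ : Matrix (Fin m) (Fin m) V →ₗ[ℂ] Y} (hτ : Function.Bijective τ) (c : ℝ)
    (hj : ∀ x, ‖amplify j m x‖ ≤ c * ‖τ x‖) :
    ∃ s : Y →L[ℂ] MatSpace j m, ∀ y, τ (matIncl j LinearMap.id m (s y)) = y := by
  let e := LinearEquiv.ofBijective τ hτ
  have he : ∀ y, τ (e.symm y) = y := e.apply_symm_apply
  refine ⟨LinearMap.mkContinuous
    ((Induced.toV (F := PiLp 2 (fun _ : Fin m => K) →L[ℂ] PiLp 2 (fun _ : Fin m => L))
      (amplify j m)).symm.toLinearMap ∘ₗ e.symm.toLinearMap) c fun y => ?_, fun y => he y⟩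
  have := hj (e.symm y)
  rwa [he] at this

theorem interpMatNorm_le_opMatNorm [CompleteSpace H]
    {K : Type*} [NormedAddCommGroup K] [InnerProductSpace ℂ K]
    {j : EuclideanSpace ℂ (Fin n) →ₗᵢ[ℂ] (K →L[ℂ] K)} (hj : IsOH j)
    (X : Matrix (Fin m) (Fin m) (EuclideanSpace ℂ (Fin n) ⊗[ℂ] (H →L[ℂ] H))) :
    interpMatNorm (minEmb (rowEmb n) (LinearMap.id (R := ℂ) (M := H →L[ℂ] H)))
        (minEmb (colEmb n) (LinearMap.id (R := ℂ) (M := H →L[ℂ] H)))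
        LinearMap.id LinearMap.id (1 / 2) m X ≤
      opMatNorm (minEmb j.toLinearMap (LinearMap.id (R := ℂ) (M := H →L[ℂ] H))) m X := by
  set N := ‖amplify (minEmb j.toLinearMap (LinearMap.id (R := ℂ) (M := H →L[ℂ] H))) m X‖ with hN
  have hN0 : 0 ≤ N := ContinuousLinearMap.opNorm_nonneg _
  have h : ∀ (Q : Submodule ℂ (PiLp 2 fun _ : Fin m => H)) [FiniteDimensional ℂ Q],
      HSBound (fun l => compMat (frame Q) (tuple n m H X l))
        (fun l => (compMat (frame Q) (tuple n m H X l))ᴴ) (N ^ 2) := fun Q _ => by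
    have := (hj.norm_amplify_le_iff hN0 _).1
      (norm_amplify_compTuple_le (orthonormal_frame Q) j.toLinearMap X)
    rwa [coords_compTuple] at this
  obtain ⟨s₀, hs₀⟩ := exists_matSpace_clm
    (Y := Fin n → ((PiLp 2 fun _ : Fin m => H) →L[ℂ] (PiLp 2 fun _ : Fin m => H)))
    (minEmb (rowEmb n) (LinearMap.id (R := ℂ) (M := H →L[ℂ] H)))
    (τ := tuple n m H) ⟨tuple_injective, tuple_surjective⟩ (√n) fun X => by
      rw [norm_amplify_rowEmb]
      exact norm_rowOp_le _
  obtain ⟨s₁, hs₁⟩ := exists_matSpace_clm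
    (Y := Fin n → ((PiLp 2 fun _ : Fin m => H) →L[ℂ] (PiLp 2 fun _ : Fin m => H)))
    (minEmb (colEmb n) (LinearMap.id (R := ℂ) (M := H →L[ℂ] H)))
    (τ := tuple n m H) ⟨tuple_injective, tuple_surjective⟩ (√n) fun X => by
      rw [norm_amplify_colEmb]
      exact norm_colOp_le _
  -- Compressions do not increase the OH norm, so each has Hilbert–Schmidt bound N². The margin M >
  -- N absorbs the strict inequality in the construction of strip families.
  have key : ∀ M > N, interpMatNorm (minEmb (rowEmb n) (LinearMap.id (R := ℂ) (M := H →L[ℂ] H)))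
        (minEmb (colEmb n) (LinearMap.id (R := ℂ) (M := H →L[ℂ] H)))
        LinearMap.id LinearMap.id (1 / 2) m X ≤ ENNReal.ofReal M := by
    intro M hM
    obtain ⟨F, hFd, hFa, hF⟩ := exists_interpolating_family hN0 hM h
    have hle := interpNorm_le s₀ s₁ (fun y => tuple_injective ((hs₀ y).trans (hs₁ y).symm))
      (F := F) (differentiableOn_pi.2 hFd) (M := M) (D := n + 1) (hN0.trans hM.le)
      (by linarith [(Nat.cast_nonneg n : (0 : ℝ) ≤ n)])
      (fun z h0 h1 => by
        refine le_trans (le_of_eq ?_) (hF z h0 h1).1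
        refine (norm_amplify_rowEmb _).trans ?_
        congr 2
        exact hs₀ (F z))
      (fun z h0 h1 => by
        refine le_trans (le_of_eq ?_) (hF z h0 h1).2
        refine (norm_amplify_colEmb _).trans ?_
        congr 2
        exact hs₁ (F z))
    have hX : matIncl (minEmb (rowEmb n) (LinearMap.id (R := ℂ) (M := H →L[ℂ] H)))
        LinearMap.id m (s₀ (F (1 / 2))) = X := by
      rw [hFa]
      exact tuple_injective (hs₀ _)
    rwa [hX] at hle
  have hlim : Tendsto ENNReal.ofReal (𝓝[>] N) (𝓝 (ENNReal.ofReal N)) :=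
    (ENNReal.continuous_ofReal.tendsto N).mono_left nhdsWithin_le_nhds
  rw [opMatNorm, ← ofReal_norm]
  exact ge_of_tendsto hlim (eventually_mem_nhdsWithin.mono key)

end Main

end OpInterp

theorem mainTheorem6 (n : ℕ) :
    (∃ (K : Type) (_ : NormedAddCommGroup K) (_ : InnerProductSpace ℂ K) (_ : CompleteSpace K)
      (j : EuclideanSpace ℂ (Fin n) →ₗᵢ[ℂ] (K →L[ℂ] K)), OpInterp.IsOH j) ∧
    ∀ (K : Type*) [NormedAddCommGroup K] [InnerProductSpace ℂ K] [CompleteSpace K]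
      (j : EuclideanSpace ℂ (Fin n) →ₗᵢ[ℂ] (K →L[ℂ] K)), OpInterp.IsOH j →
    ∀ (H : Type*) [NormedAddCommGroup H] [InnerProductSpace ℂ H] [CompleteSpace H],
      OpInterp.IsCompleteIsometry
        (OpInterp.interpMatNorm
          (OpInterp.minEmb (OpInterp.rowEmb n) (LinearMap.id (R := ℂ) (M := H →L[ℂ] H)))
          (OpInterp.minEmb (OpInterp.colEmb n) (LinearMap.id (R := ℂ) (M := H →L[ℂ] H)))
          LinearMap.id LinearMap.id (1 / 2))
        (OpInterp.opMatNorm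
          (OpInterp.minEmb j.toLinearMap (LinearMap.id (R := ℂ) (M := H →L[ℂ] H))))
        (LinearEquiv.refl ℂ (EuclideanSpace ℂ (Fin n) ⊗[ℂ] (H →L[ℂ] H))) := by
  refine ⟨⟨OpInterp.OHSpace n, _, _, inferInstance, OpInterp.ohIsometry n,
    OpInterp.isOH_ohIsometry⟩, fun K _ _ _ j hj H _ _ _ m X => ?_⟩
  exact le_antisymm (OpInterp.opMatNorm_le_interpMatNorm hj X)
    (OpInterp.interpMatNorm_le_opMatNorm hj X)
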